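/- **Set-up.** Let $\{a_n\}_{n\ge1},\{b_n\}_{n\ge1}$ be complex sequences with $a_1,b_1\ne0$, and let $\{\lambda_n\},\{\mu_n\}$ be strictly increasing sequences of positive numbers tending to $\infty$. Assume: (A1) The series $\phi(s)=\sum_{n\ge1}a_n\lambda_n^{-s}$ and $\psi(s)=\sum_{n\ge1}b_n\mu_n^{-s}$ converge absolutely in some half-plane $\Re e\, s\ge\sigma^*$, where $\sigma^*>0$. (A2) For some $d\ge1$, $\alpha_\nu>0$ and $\beta_\nu,\widetilde\beta_\nu\in\mathbb C$ $(1\le\nu\le d)$, put $\Delta(s)=\prod_{\nu=1}^d\Gamma(\alpha_\nu s+\beta_\nu)$ and $\widetilde\Delta(s)=\prod_{\nu=1}^d\Gamma(\alpha_\nu s+\widetilde\beta_\nu)$. Then $\phi$ and $\psi$ continue to meromorphic functions on $\mathbb C$, denoted by the same letters, with $\Delta(s)\phi(s)=\omega\widetilde\Delta(1-s)\psi(1-s)$ for some constant $\omega\in\mathbb C$ with $|\omega|=1$. (A3) All singularities of the meromorphic function $\Delta(s)\phi(s)$ lie inside a disk $|s|<R$, for some $R>0$, and $\Delta(\sigma+\mathrm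 it)\phi(\sigma+\mathrm it)\to0$ as $|t|\to\infty$, uniformly in every vertical strip $b\le\sigma\le b'$. Put $A=\sum_\nu\alpha_\nu$, $B=\sum_\nu\beta_\nu$, $\widetilde B=\sum_\nu\widetilde\beta_\nu$, $h=\prod_\nu(2A/\alpha_\nu)^{2\alpha_\nu}$, $$-\vartheta+\mathrm i\xi=\frac1{4A}-\frac12-\frac{B-\widetilde B}{2A}\quad(\vartheta,\xi\in\mathbb R),\qquad k=\frac d2-\frac14-\frac{A+B+\widetilde B}2,$$ $$e_0=\sqrt{\frac2\pi}\prod_{\nu=1}^d\Big(\frac{2A}{\alpha_\nu}\Big)^{\alpha_\nu+\beta_\nu-\widetilde\beta_\nu}.$$ Fix a smooth function $\varphi_0:\mathbb R\to\mathbb R$ supported on $[-1,1]$, with $0\le\varphi_0\le1$ and $1\le\int_{\mathbb R}\varphi_0\le2$, and fix $\delta>0$. For $X>0$ put $L=\delta^{-1}X^{1/(2A)}$, $\varphi(u)=\varphi_0((u-1)L)$, $\widehat\varphi(s)=\int_0^\infty\varphi(u)u^{s-1}\,\mathrm du$, and $$S_\varphi(x)=\sum_{n\ge1}a_n\varphi\Big(\frac{\lambda_n}x\Big)-\frac1{2\pi\mathrm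 i}\oint_{|s|=R}\phi(s)\widehat\varphi(s)x^s\,\mathrm ds,$$ the circle being described anticlockwise. **Theorem.** We have $e_0\neq0$, and for all sufficiently large $X$ and all $x\in[X,4X]$, $$S_\varphi(x)=\frac{\omega e_0}{2Ah}(hx)^{1-\vartheta+\mathrm i\xi}\,S_{\varphi,0}(x)+O\big(L^{-1}x^{1-\vartheta-1/(2A)}\big),$$ where the series $$S_{\varphi,0}(x)=\sum_{n\ge1}\frac{b_n}{\mu_n^{\vartheta-\mathrm i\xi}}\int_0^\infty\frac{\varphi(u)}{u^{\vartheta}}u^{\mathrm i\xi}\cos\big((h\mu_nxu)^{1/(2A)}+k\pi\big)\,\mathrm du$$ converges absolutely. Moreover $S_\varphi(x)\ll x^{1-\vartheta}L^{-1}$ for all such $x$. The implied constants depend only on $\varphi_0$, $\delta$ and the data in (A1) and (A2); in particular, they do not depend on $R$, $X$ or $x$. -/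

import Mathlib

noncomputable section

namespace Voronoi

/-- A strictly increasing sequence of positive reals tending to infinity (the frequencies of a
general Dirichlet series). The first term has index `0`. -/
structure IsFrequency (l : ℕ → ℝ) : Prop where
  pos : ∀ n, 0 < l n
  strictMono : StrictMono l
  tendsto : Filter.Tendsto l Filter.atTop Filter.atTop

/-- The general Dirichlet series `∑ aₙ lₙ^{-s}` converges absolutely for `Re s ≥ σ`. -/
def AbsConvergent (a : ℕ → ℂ) (l : ℕ → ℝ) (σ : ℝ) : Prop :=
  ∀ s : ℂ, σ ≤ s.re → Summable fun n => ‖a n * (l n : ℂ) ^ (-s)‖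

/-- `f` is a meromorphic function on the whole plane that continues the general Dirichlet series
`∑ aₙ lₙ^{-s}`, given on the half-plane `Re s > σ`. -/
structure IsContinuation (f : ℂ → ℂ) (a : ℕ → ℂ) (l : ℕ → ℝ) (σ : ℝ) : Prop where
  meromorphic : MeromorphicOn f Set.univ
  eq_series : ∀ s : ℂ, σ < s.re → f s = ∑' n, a n * (l n : ℂ) ^ (-s)

/-- The parameters of the two gamma factors: positive reals `α ν` and complex numbers
`β ν`, `βt ν` for the `d` indices `ν`. -/
structure GammaParams (d : ℕ) where
  α : Fin d → ℝ
  β : Fin d → ℂ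
  βt : Fin d → ℂ
  α_pos : ∀ ν, 0 < α ν

namespace GammaParams

variable {d : ℕ} (G : GammaParams d)

/-- The gamma factor `Δ(s) = ∏ Γ(α_ν s + β_ν)`. -/
def Delta (s : ℂ) : ℂ := ∏ ν, Complex.Gamma ((G.α ν : ℂ) * s + G.β ν)

/-- The dual gamma factor `∏ Γ(α_ν s + βt_ν)`. -/
def Deltat (s : ℂ) : ℂ := ∏ ν, Complex.Gamma ((G.α ν : ℂ) * s + G.βt ν)

/-- `A = ∑ α_ν`. -/
def A : ℝ := ∑ ν, G.α ν

/-- `B = ∑ β_ν`. -/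
def B : ℂ := ∑ ν, G.β ν

/-- The sum of the `βt_ν`. -/
def Bt : ℂ := ∑ ν, G.βt ν

/-- `h = ∏ (2A/α_ν)^{2 α_ν}`. -/
def h : ℝ := ∏ ν, (2 * G.A / G.α ν) ^ (2 * G.α ν)

/-- `a = 1/(4A) - 1/2 - (B - Bt)/(2A)`, also written `-ϑ + iξ`. -/
def a : ℂ := 1 / (4 * (G.A : ℂ)) - 1 / 2 - (G.B - G.Bt) / (2 * (G.A : ℂ))

/-- `k = d/2 - 1/4 - (A + B + Bt)/2`. -/
def k : ℂ := (d : ℂ) / 2 - 1 / 4 - ((G.A : ℂ) + G.B + G.Bt) / 2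

/-- `ϑ = -Re a`. -/
def theta : ℝ := -G.a.re

/-- `ξ = Im a`. -/
def xi : ℝ := G.a.im

/-- `e₀ = √(2/π) ∏ (2A/α_ν)^{α_ν + β_ν - βt_ν}`. -/
def e0 : ℂ :=
  (Real.sqrt (2 / Real.pi) : ℂ) *
    ∏ ν, ((2 * G.A / G.α ν : ℝ) : ℂ) ^ ((G.α ν : ℂ) + G.β ν - G.βt ν)

/-- `L = δ⁻¹ X^{1/(2A)}`. -/
def L (δ X : ℝ) : ℝ := δ⁻¹ * X ^ (1 / (2 * G.A))

/-- `Δ(s) φ(s) = ω Δt(1-s) ψ(1-s)` as an identity of meromorphic functions, that is, off a closed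
discrete set of points (the value of a Lean function at a pole carries no meaning). -/
def FunctionalEquation (ω : ℂ) (phi psi : ℂ → ℂ) : Prop :=
  (fun s => G.Delta s * phi s) =ᶠ[Filter.codiscrete ℂ]
    fun s => ω * (G.Deltat (1 - s) * psi (1 - s))

/-- All singularities of the meromorphic function `Δ φ` lie in the open disk `|z| < R`:
it has no pole (its order is nonnegative) at any other point. -/
def SingularitiesInDisk (phi : ℂ → ℂ) (R : ℝ) : Prop :=
  ∀ s : ℂ, R ≤ ‖s‖ → 0 ≤ meromorphicOrderAt (fun z => G.Delta z * phi z) s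

/-- `Δ(σ + it) φ(σ + it) → 0` as `|t| → ∞`, uniformly in every vertical strip `b ≤ σ ≤ b'`. -/
def VerticalDecay (phi : ℂ → ℂ) : Prop :=
  ∀ b b' ε : ℝ, 0 < ε → ∃ T : ℝ, ∀ σ t : ℝ, b ≤ σ → σ ≤ b' → T ≤ |t| →
    ‖G.Delta ((σ : ℂ) + (t : ℂ) * Complex.I) * phi ((σ : ℂ) + (t : ℂ) * Complex.I)‖ < ε

/-- The `n`-th term of the series `S_{φ,0}(x)`:
`bₙ μₙ^{-(ϑ - iξ)} ∫₀^∞ φ(u) u^{-ϑ} u^{iξ} cos((h μₙ x u)^{1/(2A)} + kπ) du`. -/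
def voronoiTerm (b : ℕ → ℂ) (mu : ℕ → ℝ) (φ : ℝ → ℝ) (x : ℝ) (n : ℕ) : ℂ :=
  b n / (mu n : ℂ) ^ ((G.theta : ℂ) - Complex.I * (G.xi : ℂ)) *
    ∫ u in Set.Ioi (0 : ℝ),
      ((φ u / u ^ G.theta : ℝ) : ℂ) * (u : ℂ) ^ (Complex.I * (G.xi : ℂ)) *
        Complex.cos ((((G.h * mu n * x * u) ^ (1 / (2 * G.A)) : ℝ) : ℂ) + G.k * (Real.pi : ℂ))

/-- The leading term `ω e₀/(2Ah) (hx)^{1-ϑ+iξ} S_{φ,0}(x)`. -/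
def mainTerm (ω : ℂ) (b : ℕ → ℂ) (mu : ℕ → ℝ) (φ : ℝ → ℝ) (x : ℝ) : ℂ :=
  ω * G.e0 / (2 * (G.A : ℂ) * (G.h : ℂ)) *
    ((G.h * x : ℝ) : ℂ) ^ (1 - (G.theta : ℂ) + Complex.I * (G.xi : ℂ)) *
      ∑' n, G.voronoiTerm b mu φ x n

end GammaParams

/-- The admissible fixed bump functions: smooth, supported on `[-1,1]`, with values in `[0,1]`
and total integral in `[1,2]`. -/
structure IsBump (φ₀ : ℝ → ℝ) : Prop where
  smooth : ContDiff ℝ (⊤ : ℕ∞) φ₀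
  support : Function.support φ₀ ⊆ Set.Icc (-1) 1
  nonneg : ∀ u ∈ Set.Icc (-1 : ℝ) 1, 0 ≤ φ₀ u
  le_one : ∀ u ∈ Set.Icc (-1 : ℝ) 1, φ₀ u ≤ 1
  one_le_integral : 1 ≤ ∫ u, φ₀ u
  integral_le_two : ∫ u, φ₀ u ≤ 2

/-- The localized weight `φ(u) = φ₀((u-1)L)`. -/
def weight (φ₀ : ℝ → ℝ) (L : ℝ) (u : ℝ) : ℝ := φ₀ ((u - 1) * L)

/-- The residual term `M_φ(x) = (2πi)⁻¹ ∮_{|s|=R} φ(s) φ̂(s) x^s ds`, with `φ̂` the Mellin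
transform of the weight. -/
def residualTerm (phi : ℂ → ℂ) (R : ℝ) (φ : ℝ → ℝ) (x : ℝ) : ℂ :=
  (2 * (Real.pi : ℂ) * Complex.I)⁻¹ *
    ∮ s in C(0, R), phi s * mellin (fun u => (φ u : ℂ)) s * (x : ℂ) ^ s

/-- The local weighted mean `S_φ(x) = ∑ aₙ φ(lₙ/x) - M_φ(x)`. -/
def localMean (a : ℕ → ℂ) (l : ℕ → ℝ) (phi : ℂ → ℂ) (R : ℝ) (φ : ℝ → ℝ) (x : ℝ) : ℂ :=
  (∑' n, a n * (φ (l n / x) : ℂ)) - residualTerm phi R φ x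

end Voronoi

end

/-!
The smoothed sum `∑ aₙ φ(lₙ/x)` is, by Mellin inversion, the integral of `phi(s) φ̂(s) x^s` over a
vertical line far to the right. The continuation has only finitely many poles, so it is an entire
function divided by a polynomial, and it grows at most exponentially in vertical strips since `1/Δ`
does. Its contour may therefore be moved to the reflected line `Re s = 1 - c`
(`line_sub_line`); the residues crossed are exactly the circle integral subtracted in the local
mean. For a growing integrand the horizontal sides are killed by a factor `exp(εs²)` with `ε → 0`,
and the residue theorem that is needed, for an entire function over a polynomial, follows from
partial fractions. The functional equation turns the reflected integral into one over `Re s = c`, of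
the absolutely convergent dual series against the kernel `Δt(s)/Δ(1-s)`
(`localMean_eq_integral`).

Stirling's formula with its first correction term gives, on the line `Re s = c`,
`Δt(s)/Δ(1-s) = e₀ h^{-s} Γ(w) cos(π(w/2 + k)) (1 + κ/(w-1)) + O(|t|^{Re w - 5/2})` with
`w = 2A(s + a)` (`exists_kernel_sub_model₂_le`). The two terms of the model are gamma functions
times cosines, because `Γ(w)/(w-1) = Γ(w-1)`; their Mellin–Barnes integrals against `φ̂(1-s)` are
cosine integrals of the weight (`integral_gammaCos`). The first of them yields precisely the terms of
`S_{φ,0}`, the second is smaller by `x^{-1/(2A)}`, and the remainder is estimated trivially by the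
moments of the Mellin transform of a weight of width `1/L`.

Repeated integration by parts shows that the `n`-th cosine integral is `O(L⁻¹ μₙ^{-N/(2A)})` for
every `N`. This gives the absolute convergence of `S_{φ,0}`, the size `O(L⁻¹)` of its sum, and with
it both estimates of the theorem. The line `Re s = c` is chosen by means of one fixed radius for which
the disk contains all singularities; every other admissible radius encloses the same poles, so the
constants do not depend on `R`.
-/

noncomputable section

namespace Voronoi

open Complex Filter Topology Asymptotics

/-! ### Stirling's formula on vertical lines -/

/-- The exponent `(z - 1/2) log z - z` of Stirling's formula. -/
def stirlingExp (z : ℂ) : ℂ := (z - 1 / 2) * log z - z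

/-- The quotient of `Γ(z)` by Stirling's approximation `√(2π) exp((z - 1/2) log z - z + 1/(12z))`,
the first correction term included. -/
def stirlingQuot (z : ℂ) : ℂ :=
  Gamma z / ((Real.sqrt (2 * Real.pi) : ℂ) * exp (stirlingExp z + 1 / (12 * z)))

/-- The logarithm of the quotient of two consecutive values of `stirlingQuot`. -/
def stirlingStep (z : ℂ) : ℂ :=
  (z + 1 / 2) * log (1 + 1 / z) - 1 - (1 / (12 * z) - 1 / (12 * (z + 1)))

lemma sqrt_two_pi_ne_zero : (Real.sqrt (2 * Real.pi) : ℂ) ≠ 0 := by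
  have : (0 : ℝ) < Real.sqrt (2 * Real.pi) := by positivity
  exact_mod_cast this.ne'

/-- The correction term `1/(12z)` in `stirlingQuot` cancels the leading term of the step, which
is therefore `O(z⁻³)`. -/
lemma norm_stirlingStep_le {z : ℂ} (hz : 2 ≤ ‖z‖) : ‖stirlingStep z‖ ≤ (‖z‖ ^ 3)⁻¹ := by
  have hz0 : z ≠ 0 := by
    rintro rfl
    norm_num at hz
  set w : ℂ := 1 / z with hw
  have hwz : z = 1 / w := by rw [hw]; field_simp
  have hw0 : w ≠ 0 := one_div_ne_zero hz0
  have hwn : ‖w‖ ≤ 1 / 2 := by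
    rw [hw, norm_div, norm_one]
    exact one_div_le_one_div_of_le (by norm_num) hz
  have hz1 : z + 1 ≠ 0 := by
    intro h
    have : z = -1 := by linear_combination h
    rw [this] at hz
    norm_num at hz
  have hw1 : 1 + w ≠ 0 := by
    intro h
    apply hz1
    rw [hwz]; field_simp; linear_combination h
  set r : ℂ := log (1 + w) - (w - w ^ 2 / 2 + w ^ 3 / 3) with hr
  have hrn : ‖r‖ ≤ ‖w‖ ^ 4 / 2 := by
    have h := norm_log_sub_logTaylor_le 3 (z := w) (by linarith)
    have h2 : logTaylor (3 + 1) w = w - w ^ 2 / 2 + w ^ 3 / 3 := by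
      simp [logTaylor, Finset.sum_range_succ]
      ring
    rw [h2] at h
    refine h.trans ?_
    have : (1 - ‖w‖)⁻¹ ≤ 2 := by
      rw [inv_le_comm₀ (by linarith) (by norm_num)]
      linarith
    have h4 : 0 ≤ ‖w‖ ^ 4 := by positivity
    norm_num
    nlinarith
  have key : stirlingStep z = w ^ 3 / 6 + w ^ 3 / (12 * (1 + w)) + (1 / w + 1 / 2) * r := by
    have hl : log (1 + 1 / z) = r + (w - w ^ 2 / 2 + w ^ 3 / 3) := by rw [hr]; ring
    rw [stirlingStep, hl, hwz]
    have : (1 / w + 1) ≠ 0 := by rwa [← hwz]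
    field_simp
    ring
  have h1w : 1 / 2 ≤ ‖1 + w‖ := by
    have := norm_sub_norm_le (1 : ℂ) (-w)
    rw [norm_neg, norm_one, sub_neg_eq_add] at this
    linarith
  have hwp : 0 < ‖w‖ := norm_pos_iff.mpr hw0
  have e1 : ‖w ^ 3 / 6‖ = ‖w‖ ^ 3 / 6 := by simp
  have e2 : ‖w ^ 3 / (12 * (1 + w))‖ ≤ ‖w‖ ^ 3 / 6 := by
    rw [norm_div, norm_mul, norm_pow]
    apply div_le_div_of_nonneg_left (by positivity) (by norm_num)
    norm_num; linarith
  have e3 : ‖(1 / w + 1 / 2) * r‖ ≤ ‖w‖ ^ 3 * (5 / 8) := by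
    rw [norm_mul]
    have : ‖1 / w + 1 / 2‖ ≤ 1 / ‖w‖ + 1 / 2 := by
      refine (norm_add_le _ _).trans ?_
      simp
    calc _ ≤ (1 / ‖w‖ + 1 / 2) * (‖w‖ ^ 4 / 2) := by gcongr
      _ = ‖w‖ ^ 3 / 2 + ‖w‖ ^ 3 * ‖w‖ / 4 := by field_simp; ring
      _ ≤ _ := by nlinarith [pow_pos hwp 3]
  have e4 : (‖z‖ ^ 3)⁻¹ = ‖w‖ ^ 3 := by rw [hwz]; simp
  rw [key, e4]
  calc _ ≤ ‖w ^ 3 / 6‖ + ‖w ^ 3 / (12 * (1 + w))‖ + ‖(1 / w + 1 / 2) * r‖ := norm_add₃_le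
    _ ≤ _ := by rw [e1]; nlinarith [pow_pos hwp 3]

lemma log_add_one_eq {z : ℂ} (hz : 0 < z.re) : log (z + 1) = log z + log (1 + 1 / z) := by
  have hz0 : z ≠ 0 := by rintro rfl; simp at hz
  have h1 : z + 1 = z * (1 + 1 / z) := by field_simp
  have hw : 0 < (1 / z).re := by
    rw [one_div, inv_re]
    exact div_pos hz (normSq_pos.mpr hz0)
  have h2 : (1 + 1 / z) ≠ 0 := by
    intro h
    have := congrArg re h
    simp only [add_re, one_re, zero_re] at this
    linarith
  rw [h1, log_mul_eq_add_log_iff hz0 h2]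
  have a1 := abs_lt.mp (abs_arg_lt_pi_div_two_iff.mpr (Or.inl hz))
  have a2 := abs_lt.mp (abs_arg_lt_pi_div_two_iff (z := 1 + 1 / z) |>.mpr
    (Or.inl (by rw [add_re, one_re]; linarith)))
  constructor <;> linarith [a1.1, a1.2, a2.1, a2.2]

lemma stirlingQuot_eq {z : ℂ} (hz : 0 < z.re) :
    stirlingQuot z = stirlingQuot (z + 1) * exp (stirlingStep z) := by
  have hz0 : z ≠ 0 := by rintro rfl; simp at hz
  rw [stirlingQuot, stirlingQuot, Gamma_add_one z hz0, stirlingExp, stirlingExp, stirlingStep,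
    log_add_one_eq hz, div_mul_eq_mul_div, div_eq_div_iff
      (mul_ne_zero sqrt_two_pi_ne_zero (exp_ne_zero _))
      (mul_ne_zero sqrt_two_pi_ne_zero (exp_ne_zero _))]
  have hzl : z = exp (log z) := (exp_log hz0).symm
  have : exp ((z + 1 - 1 / 2) * (log z + log (1 + 1 / z)) - (z + 1) + 1 / (12 * (z + 1)))
      = z * exp ((z + 1 / 2) * log (1 + 1 / z) - 1 - (1 / (12 * z) - 1 / (12 * (z + 1))))
        * exp ((z - 1 / 2) * log z - z + 1 / (12 * z)) := by
    conv_rhs => rw [mul_assoc, ← exp_add]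
    conv_rhs => enter [1]; rw [hzl]
    rw [← exp_add]
    congr 1
    ring
  rw [this]
  ring

/-- The quotient telescopes over the shifts `z, z + 1, …`; in the limit this expresses it through the
convergent series of the steps. -/
lemma stirlingQuot_eq_prod {z : ℂ} (hz : 0 < z.re) (n : ℕ) :
    stirlingQuot z = stirlingQuot (z + n) * exp (∑ j ∈ Finset.range n, stirlingStep (z + j)) := by
  induction n with
  | zero => simp
  | succ n ih =>
    rw [ih, stirlingQuot_eq (z := z + n) (by simp; positivity), Finset.sum_range_succ, exp_add]
    push_cast
    rw [add_assoc]
    ring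

/-- A cubic sum is bounded by telescoping `1/(r-1)² - 1/r² ≥ 1/r³`. -/
lemma sum_inv_cube_le {m : ℝ} (hm : 2 ≤ m) (n : ℕ) :
    ∑ j ∈ Finset.range n, ((m + j) ^ 3)⁻¹ ≤ 1 / (m - 1) ^ 2 - 1 / (m + n - 1) ^ 2 := by
  induction n with
  | zero => simp
  | succ n ih =>
    rw [Finset.sum_range_succ]
    have hr : 2 ≤ m + n := by have : (0 : ℝ) ≤ n := by positivity
                              linarith
    push_cast
    have : ((m + n) ^ 3)⁻¹ ≤ 1 / (m + n - 1) ^ 2 - 1 / (m + (n + 1) - 1) ^ 2 := by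
      have e : m + (n + 1) - 1 = m + n := by ring
      rw [e]
      generalize m + (n : ℝ) = r at hr
      have h1 : 0 < r - 1 := by linarith
      have h0 : 0 < r := by linarith
      rw [div_sub_div _ _ (by positivity) (by positivity), inv_eq_one_div,
        div_le_div_iff₀ (by positivity) (by positivity)]
      have : 0 ≤ r ^ 2 * (r * (2 * r - 1) - (r - 1) ^ 2) := by
        apply mul_nonneg (by positivity)
        nlinarith
      nlinarith
    linarith

lemma norm_sum_stirlingStep_le {z : ℂ} (hz : 0 < z.re) (hy : 2 ≤ |z.im|) (n : ℕ) :
    ‖∑ j ∈ Finset.range n, stirlingStep (z + j)‖ ≤ 32 / z.im ^ 2 := by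
  have hj : ∀ j : ℕ, ‖stirlingStep (z + j)‖ ≤ 8 * ((|z.im| + j) ^ 3)⁻¹ := by
    intro j
    have him : |z.im| ≤ ‖z + j‖ := by simpa using abs_im_le_norm (z + j)
    have hre : (j : ℝ) ≤ ‖z + j‖ := by
      have := re_le_norm (z + j)
      simp at this
      linarith
    refine (norm_stirlingStep_le (hy.trans him)).trans ?_
    have h0 : 0 < |z.im| + j := by positivity
    have : (|z.im| + j) ^ 3 ≤ (2 * ‖z + j‖) ^ 3 := by
      gcongr; linarith
    have hp : 0 < ‖z + j‖ := by linarith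
    rw [inv_eq_one_div, inv_eq_one_div, mul_one_div, div_le_div_iff₀ (by positivity) (by positivity)]
    nlinarith
  refine (norm_sum_le _ _).trans ((Finset.sum_le_sum fun j _ => hj j).trans ?_)
  rw [← Finset.mul_sum]
  have h := sum_inv_cube_le hy n
  have hpos : 0 ≤ 1 / (|z.im| + n - 1) ^ 2 := by positivity
  have h2 : 1 / (|z.im| - 1) ^ 2 ≤ 4 / z.im ^ 2 := by
    have : 0 < |z.im| - 1 := by linarith
    rw [← sq_abs z.im, div_le_div_iff₀ (by positivity) (by positivity)]
    nlinarith
  have : 32 / z.im ^ 2 = 8 * (4 / z.im ^ 2) := by ring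
  rw [this]
  linarith

lemma tendsto_add_nat_inv (z : ℂ) :
    Tendsto (fun n : ℕ => 1 / (12 * (z + n + 1))) atTop (𝓝 0) := by
  have h1 : Tendsto (fun n : ℕ => z + 1 + (n : ℂ)) atTop (Bornology.cobounded ℂ) :=
    (tendsto_const_add_cobounded _).comp tendsto_natCast_atTop_cobounded
  have h2 := (tendsto_inv₀_cobounded.comp h1).const_mul (1 / 12 : ℂ)
  rw [mul_zero] at h2
  refine h2.congr fun n => ?_
  simp only [Function.comp]
  rw [one_div, one_div, mul_inv]
  congr 2
  ring

/-- `Γ(z + n)` is asymptotic to Stirling's approximation along the integers: a consequence of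
Euler's limit formula and of Stirling's formula for the factorial. -/
lemma tendsto_stirlingQuot_add_nat {z : ℂ} (hz : 0 < z.re) :
    Tendsto (fun n : ℕ => stirlingQuot (z + n)) atTop (𝓝 1) := by
  rw [← tendsto_add_atTop_iff_nat 1]
  have hG : Gamma z ≠ 0 := Gamma_ne_zero_of_re_pos hz
  have t1 : Tendsto (fun n => Gamma z / GammaSeq z n) atTop (𝓝 1) := by
    have := (tendsto_const_nhds (x := Gamma z)).div (GammaSeq_tendsto_Gamma z) hG
    rwa [div_self hG] at this
  have t2 : Tendsto (fun n : ℕ => ((n.factorial : ℝ) /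
      (Real.sqrt (2 * n * Real.pi) * (n / Real.exp 1) ^ n) : ℝ)) atTop (𝓝 1) := by
    have := Stirling.factorial_isEquivalent_stirling
    refine (isEquivalent_iff_tendsto_one ?_).mp this
    filter_upwards [eventually_gt_atTop 0] with n hn
    positivity
  have t2' : Tendsto (fun n : ℕ => (((n.factorial : ℝ) /
      (Real.sqrt (2 * n * Real.pi) * (n / Real.exp 1) ^ n) : ℝ) : ℂ)) atTop (𝓝 1) := by
    exact ofReal_one ▸ (continuous_ofReal.tendsto 1).comp t2
  have hlog : Tendsto (fun n : ℕ => (n : ℂ) * log (1 + (z + 1) / n)) atTop (𝓝 (z + 1)) := by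
    apply tendsto_nat_mul_log_one_add_of_tendsto
    refine tendsto_const_nhds.congr' ?_
    filter_upwards [eventually_ne_atTop 0] with n hn
    field_simp
  have hinv : Tendsto (fun n : ℕ => (n : ℂ)⁻¹) atTop (𝓝 0) :=
    tendsto_inv₀_cobounded.comp tendsto_natCast_atTop_cobounded
  have hlog0 : Tendsto (fun n : ℕ => log (1 + (z + 1) / n)) atTop (𝓝 0) := by
    have := hlog.mul hinv
    rw [mul_zero] at this
    refine this.congr' ?_
    filter_upwards [eventually_ne_atTop 0] with n hn
    field_simp
  have t3 : Tendsto (fun n : ℕ => exp (-((n : ℂ) * log (1 + (z + 1) / n)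
      + (z + 1 / 2) * log (1 + (z + 1) / n) - (z + 1) + 1 / (12 * (z + n + 1)))))
      atTop (𝓝 1) := by
    have h := (((hlog.add (hlog0.const_mul (z + 1 / 2))).sub_const (z + 1)).add
      (tendsto_add_nat_inv z)).neg
    have h2 := (continuous_exp.tendsto _).comp h
    rw [add_zero, mul_zero, add_zero, sub_self, neg_zero, exp_zero] at h2
    exact h2
  have tt := (t1.mul t2').mul t3
  simp only [mul_one] at tt
  refine tt.congr' ?_
  filter_upwards [eventually_gt_atTop 0] with n hn
  have hn0 : (n : ℂ) ≠ 0 := by exact_mod_cast hn.ne'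
  have hzre : ∀ j : ℕ, z + j ≠ 0 := by
    intro j h
    have := congrArg re h
    simp at this
    have hj : (0 : ℝ) ≤ j := by positivity
    linarith
  have hprod : ∏ j ∈ Finset.range (n + 1), (z + j) ≠ 0 :=
    Finset.prod_ne_zero_iff.mpr fun j _ => hzre j
  have hGp : ∀ m : ℕ, Gamma (z + m) = Gamma z * ∏ j ∈ Finset.range m, (z + j) := by
    intro m
    induction m with
    | zero => simp
    | succ m ih =>
      rw [Finset.prod_range_succ, ← mul_assoc, ← ih]
      push_cast
      rw [← add_assoc, Gamma_add_one _ (hzre m), mul_comm]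
  have hlogz : log (z + ((n + 1 : ℕ) : ℂ)) = log n + log (1 + (z + 1) / n) := by
    have : z + ((n + 1 : ℕ) : ℂ) = ((n : ℝ) : ℂ) * (1 + (z + 1) / n) := by
      push_cast; field_simp; ring
    rw [this, log_ofReal_mul (by exact_mod_cast hn)]
    · rw [ofReal_log (by positivity)]; push_cast; rfl
    · intro h
      rw [h, mul_zero] at this
      exact hzre _ this
  have hnexp : (n : ℂ) = exp (log n) := (exp_log hn0).symm
  have hsq : (Real.sqrt (2 * n * Real.pi) : ℂ) =
      (Real.sqrt (2 * Real.pi) : ℂ) * exp (log n * (1 / 2)) := by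
    have h1 : Real.sqrt (2 * n * Real.pi) = Real.sqrt (2 * Real.pi) * Real.exp (Real.log n / 2) := by
      rw [show 2 * (n : ℝ) * Real.pi = (2 * Real.pi) * n by ring, Real.sqrt_mul (by positivity)]
      congr 1
      rw [Real.sqrt_eq_rpow, Real.rpow_def_of_pos (by exact_mod_cast hn)]
      ring_nf
    rw [h1]
    push_cast
    congr 2
    ring
  have hpow : (((n : ℝ) / Real.exp 1 : ℝ) : ℂ) ^ n = exp (n * log n - n) := by
    push_cast
    rw [div_pow, ← exp_nat_mul, mul_one, exp_sub]
    congr 1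
    rw [exp_nat_mul, exp_log hn0]
  have hfac : (n.factorial : ℂ) ≠ 0 := by exact_mod_cast n.factorial_ne_zero
  have hcp : (n : ℂ) ^ z = exp (log n * z) := cpow_def_of_ne_zero hn0 z
  have hE : exp (stirlingExp (z + ((n + 1 : ℕ) : ℂ)) + 1 / (12 * (z + ((n + 1 : ℕ) : ℂ)))) *
      exp (-((n : ℂ) * log (1 + (z + 1) / n)
      + (z + 1 / 2) * log (1 + (z + 1) / n) - (z + 1) + 1 / (12 * (z + n + 1))))
      = exp (log n * z) * (exp (log n * (1 / 2)) * exp (n * log n - n)) := by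
    rw [← exp_add, ← exp_add, ← exp_add, stirlingExp, hlogz]
    congr 1
    push_cast
    ring
  rw [stirlingQuot, hGp, GammaSeq, hcp]
  push_cast
  push_cast at hE hsq hpow
  rw [hpow, hsq, eq_div_iff (mul_ne_zero sqrt_two_pi_ne_zero (exp_ne_zero _))]
  rw [mul_comm (Real.sqrt (2 * Real.pi) : ℂ) (exp (stirlingExp _ + _)), mul_assoc, ← mul_assoc
    (exp (-_)), mul_comm (exp (-_)), hE]
  have := exp_ne_zero (log n * z)
  have := exp_ne_zero (log n * (1 / 2))
  have := exp_ne_zero (n * log n - n)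
  have := sqrt_two_pi_ne_zero
  field_simp

/-- Stirling's formula with its first correction, uniformly in the right half-plane away from the
real axis. -/
lemma norm_stirlingQuot_sub_one_le {z : ℂ} (hz : 0 < z.re) (hy : 6 ≤ |z.im|) :
    ‖stirlingQuot z - 1‖ ≤ 64 / z.im ^ 2 := by
  have hlim := tendsto_stirlingQuot_add_nat hz
  have h1 : Tendsto (fun n : ℕ => ‖stirlingQuot z - stirlingQuot (z + n)‖) atTop
      (𝓝 ‖stirlingQuot z - 1‖) := (hlim.const_sub _).norm
  have h2 : Tendsto (fun n : ℕ => ‖stirlingQuot (z + n)‖ * (64 / z.im ^ 2)) atTop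
      (𝓝 (‖(1 : ℂ)‖ * (64 / z.im ^ 2))) := hlim.norm.mul_const _
  rw [norm_one, one_mul] at h2
  refine le_of_tendsto_of_tendsto' h1 h2 fun n => ?_
  have hs := norm_sum_stirlingStep_le hz (by linarith) n
  have hy2 : 36 ≤ z.im ^ 2 := by rw [← sq_abs]; nlinarith
  have hle1 : 32 / z.im ^ 2 ≤ 1 := by
    rw [div_le_one (by linarith)]; linarith
  rw [stirlingQuot_eq_prod hz n, show ∀ a b : ℂ, a * b - a = a * (b - 1) by intros; ring, norm_mul]
  gcongr
  refine (norm_exp_sub_one_le (hs.trans hle1)).trans ?_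
  rw [show 64 / z.im ^ 2 = 2 * (32 / z.im ^ 2) by ring]
  gcongr

lemma Gamma_eq_stirling {z : ℂ} :
    Gamma z = (Real.sqrt (2 * Real.pi) : ℂ) * exp (stirlingExp z) *
      (exp (1 / (12 * z)) * stirlingQuot z) := by
  have := sqrt_two_pi_ne_zero
  have := exp_ne_zero (stirlingExp z)
  have := exp_ne_zero (1 / (12 * z))
  rw [stirlingQuot, exp_add]
  field_simp

/-! ### The size of the gamma function on vertical lines -/

lemma rpow_le_of_mem_Icc {r M : ℝ} (e : ℝ) (hM : 1 ≤ M) (h1 : M⁻¹ ≤ r) (h2 : r ≤ M) :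
    r ^ e ≤ M ^ |e| := by
  have hM0 : 0 < M := by linarith
  have hr : 0 < r := lt_of_lt_of_le (by positivity) h1
  rw [Real.rpow_def_of_pos hr, Real.rpow_def_of_pos hM0]
  apply Real.exp_le_exp.mpr
  have l1 : Real.log r ≤ Real.log M := Real.log_le_log hr h2
  have l2 : -Real.log M ≤ Real.log r := by
    rw [← Real.log_inv]; exact Real.log_le_log (by positivity) h1
  calc Real.log r * e ≤ |Real.log r * e| := le_abs_self _
    _ = |Real.log r| * |e| := abs_mul _ _
    _ ≤ _ := by gcongr; exact abs_le.mpr ⟨l2, l1⟩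

lemma pi_div_two_sub_arg_le {z : ℂ} (hx : 0 < z.re) (hy : 0 < z.im) :
    Real.pi / 2 - arg z ≤ z.re / z.im := by
  have h1 : 0 < arg z := by
    refine lt_of_le_of_ne (arg_nonneg_iff.mpr hy.le) fun h => ?_
    have := (arg_eq_zero_iff.mp h.symm).2
    linarith
  have h2 : arg z < Real.pi / 2 :=
    (abs_lt.mp (abs_arg_lt_pi_div_two_iff.mpr (Or.inl hx))).2
  have := Real.le_tan (x := Real.pi / 2 - arg z) (by linarith) (by linarith)
  rwa [Real.tan_pi_div_two_sub, tan_arg, inv_div] at this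

/-- The factor `exp(-π|Im z|/2)` in the size of `Γ` comes from `arg z → π/2`. -/
lemma norm_exp_stirlingExp_le {z : ℂ} (hx : 0 < z.re) (hy : 0 < z.im) :
    ‖exp (stirlingExp z)‖ * Real.exp (Real.pi / 2 * z.im) ≤ ‖z‖ ^ (z.re - 1 / 2) := by
  have hz0 : z ≠ 0 := by rintro rfl; simp at hx
  have hn : 0 < ‖z‖ := norm_pos_iff.mpr hz0
  rw [norm_exp, ← Real.exp_add, Real.rpow_def_of_pos hn]
  apply Real.exp_le_exp.mpr
  have hre : (stirlingExp z).re = (z.re - 1 / 2) * Real.log ‖z‖ - z.im * arg z - z.re := by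
    simp [stirlingExp, log_re, log_im]
  rw [hre]
  have h := pi_div_two_sub_arg_le hx hy
  have : (Real.pi / 2 - arg z) * z.im ≤ z.re := by
    calc _ ≤ z.re / z.im * z.im := by gcongr
      _ = z.re := by field_simp
  nlinarith

lemma norm_Gamma_le_of_im_ge {x y : ℝ} (hx : 0 < x) (hy : 6 ≤ y) :
    ‖Gamma (x + y * I)‖ * Real.exp (Real.pi / 2 * y) ≤
      (Real.sqrt (2 * Real.pi) * Real.exp 1 * 3 * (x + 2) ^ |x - 1 / 2|) *
        (1 + y) ^ (x - 1 / 2) := by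
  set z : ℂ := x + y * I with hz
  have hre : z.re = x := by simp [hz]
  have him : z.im = y := by simp [hz]
  have hzn : y ≤ ‖z‖ := by
    have := abs_im_le_norm z
    rw [him] at this
    exact (le_abs_self y).trans this
  have hzn2 : ‖z‖ ≤ x + y := by
    have := norm_le_abs_re_add_abs_im z
    rwa [him, hre, abs_of_pos hx, abs_of_pos (by linarith : 0 < y)] at this
  have q : ‖stirlingQuot z‖ ≤ 3 := by
    have h := norm_stirlingQuot_sub_one_le (z := z) (by rw [hre]; exact hx)
      (by rw [him, abs_of_pos (by linarith)]; exact hy)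
    have h2 : 64 / z.im ^ 2 ≤ 2 := by
      rw [him, div_le_iff₀ (by positivity)]; nlinarith
    have h3 := norm_sub_norm_le (stirlingQuot z) 1
    rw [norm_one] at h3
    linarith
  have e1 : ‖exp (1 / (12 * z))‖ ≤ Real.exp 1 := by
    refine (norm_exp_le_exp_norm _).trans (Real.exp_le_exp.mpr ?_)
    have hzp : 0 < ‖z‖ := by linarith
    rw [norm_div, norm_one, norm_mul, div_le_one (mul_pos (by norm_num) hzp)]
    norm_num
    linarith
  have e2 := norm_exp_stirlingExp_le (z := z) (by rw [hre]; exact hx) (by rw [him]; linarith)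
  rw [hre, him] at e2
  have e3 : ‖z‖ ^ (x - 1 / 2) ≤ (x + 2) ^ |x - 1 / 2| * (1 + y) ^ (x - 1 / 2) := by
    have hy0 : (0 : ℝ) < 1 + y := by linarith
    have h := rpow_le_of_mem_Icc (r := ‖z‖ / (1 + y)) (M := x + 2) (x - 1 / 2) (by linarith)
      (by
        rw [inv_eq_one_div, div_le_div_iff₀ (by linarith) hy0]
        nlinarith)
      (by rw [div_le_iff₀ hy0]; nlinarith)
    rw [Real.div_rpow (norm_nonneg _) hy0.le, div_le_iff₀ (by positivity)] at h
    exact h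
  have hG : ‖Gamma z‖ = Real.sqrt (2 * Real.pi) * ‖exp (stirlingExp z)‖ *
      (‖exp (1 / (12 * z))‖ * ‖stirlingQuot z‖) := by
    rw [Gamma_eq_stirling, norm_mul, norm_mul, norm_mul, norm_real, Real.norm_of_nonneg (by positivity)]
  rw [hG]
  calc _ = Real.sqrt (2 * Real.pi) * ‖exp (1 / (12 * z))‖ * ‖stirlingQuot z‖ *
        (‖exp (stirlingExp z)‖ * Real.exp (Real.pi / 2 * y)) := by ring
    _ ≤ Real.sqrt (2 * Real.pi) * Real.exp 1 * 3 *
        ((x + 2) ^ |x - 1 / 2| * (1 + y) ^ (x - 1 / 2)) := by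
        refine mul_le_mul ?_ (e2.trans e3) (by positivity) (by positivity)
        gcongr
    _ = _ := by ring

lemma norm_Gamma_le_of_abs_im_ge {x y : ℝ} (hx : 0 < x) (hy : 6 ≤ |y|) :
    ‖Gamma (x + y * I)‖ * Real.exp (Real.pi / 2 * |y|) ≤
      (Real.sqrt (2 * Real.pi) * Real.exp 1 * 3 * (x + 2) ^ |x - 1 / 2|) *
        (1 + |y|) ^ (x - 1 / 2) := by
  rcases le_abs.mp hy with h | h
  · rw [abs_of_pos (by linarith)]
    exact norm_Gamma_le_of_im_ge hx h
  · have h2 := norm_Gamma_le_of_im_ge hx h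
    rw [abs_of_neg (by linarith)]
    have : (x + y * I : ℂ) = (starRingEnd ℂ) (x + (-y : ℝ) * I) := by simp
    rw [this, Gamma_conj, norm_conj]
    exact h2

/-- A continuous function on the line that is `O((1 + |t|) ^ e)` at infinity is bounded by a
multiple of `(1 + |t|) ^ e` everywhere. -/
lemma exists_bound_of_isBigO {f : ℝ → ℂ} (hf : Continuous f) {e : ℝ}
    (h : f =O[cocompact ℝ] fun t => (1 + |t|) ^ e) :
    ∃ K : ℝ, 0 < K ∧ ∀ t, ‖f t‖ ≤ K * (1 + |t|) ^ e := by
  obtain ⟨K₁, hK₁, hb⟩ := h.exists_pos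
  rw [IsBigOWith] at hb
  obtain ⟨S, hS, hS2⟩ := mem_cocompact.mp hb
  have hpos : ∀ t : ℝ, 0 < (1 + |t|) ^ e := fun t => by positivity
  have hc : Continuous fun t => ‖f t‖ / (1 + |t|) ^ e := by
    refine hf.norm.div ?_ fun t => (hpos t).ne'
    exact (continuous_const.add continuous_abs).rpow_const fun t => Or.inl (show (1 : ℝ) + |t| ≠ 0 by positivity)
  obtain ⟨K₂, hK₂⟩ := hS.exists_bound_of_continuousOn hc.continuousOn
  refine ⟨max K₁ K₂, lt_max_of_lt_left hK₁, fun t => ?_⟩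
  by_cases ht : t ∈ S
  · have := (le_abs_self _).trans (hK₂ t ht)
    rw [div_le_iff₀ (hpos t)] at this
    exact this.trans (mul_le_mul_of_nonneg_right (le_max_right _ _) (hpos t).le)
  · have := hS2 ht
    rw [Set.mem_ofPred_eq, Real.norm_of_nonneg (hpos t).le] at this
    exact this.trans (mul_le_mul_of_nonneg_right (le_max_left _ _) (hpos t).le)

lemma eventually_abs_ge (T : ℝ) : ∀ᶠ t : ℝ in cocompact ℝ, T ≤ |t| := by
  have := (tendsto_norm_cocompact_atTop (E := ℝ)).eventually (eventually_ge_atTop T)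
  simpa using this

lemma continuous_Gamma_line {x : ℝ} (hx : 0 < x) :
    Continuous fun y : ℝ => Gamma (x + y * I) := by
  rw [continuous_iff_continuousAt]
  intro y
  have h : ContinuousAt Gamma ((x : ℂ) + y * I) := by
    refine (differentiableAt_Gamma _ fun m h => ?_).continuousAt
    have := congrArg re h
    simp at this
    have hm : (0 : ℝ) ≤ m := by positivity
    linarith
  exact ContinuousAt.comp (f := fun y : ℝ => ((x : ℂ) + y * I)) h (by fun_prop)

/-- `|Γ(x + iy)|` has size `|y| ^ (x - 1/2) exp(-π|y|/2)` on a vertical line. -/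
lemma exists_norm_Gamma_le {x : ℝ} (hx : 0 < x) :
    ∃ K : ℝ, 0 < K ∧ ∀ y : ℝ, ‖Gamma (x + y * I)‖ * Real.exp (Real.pi / 2 * |y|) ≤
      K * (1 + |y|) ^ (x - 1 / 2) := by
  have hc : Continuous fun y : ℝ => Gamma (x + y * I) * (Real.exp (Real.pi / 2 * |y|) : ℂ) :=
    (continuous_Gamma_line hx).mul (continuous_ofReal.comp (by fun_prop))
  obtain ⟨K, hK, h⟩ := exists_bound_of_isBigO (e := x - 1 / 2) hc (by
    refine IsBigO.of_bound
      (Real.sqrt (2 * Real.pi) * Real.exp 1 * 3 * (x + 2) ^ |x - 1 / 2|) ?_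
    filter_upwards [eventually_abs_ge 6] with y hy
    rw [norm_mul, norm_real, Real.norm_of_nonneg (Real.exp_pos _).le,
      Real.norm_of_nonneg (by positivity)]
    exact norm_Gamma_le_of_abs_im_ge hx hy)
  refine ⟨K, hK, fun y => ?_⟩
  have := h y
  rwa [norm_mul, norm_real, Real.norm_of_nonneg (Real.exp_pos _).le] at this

/-! ### First-order expansions at infinity -/

/-- `f(s) = 1 + κ/s + O(s⁻²)` along the filter `l`. -/
def FirstOrder (l : Filter ℂ) (κ : ℂ) (f : ℂ → ℂ) : Prop :=
  (fun s => f s - 1 - κ / s) =O[l] fun s => (s ^ 2)⁻¹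

namespace FirstOrder

variable {l : Filter ℂ} {κ κ' : ℂ} {f g : ℂ → ℂ}

lemma inv_isBigO_one (hl : l ≤ Bornology.cobounded ℂ) :
    (fun s : ℂ => s⁻¹) =O[l] fun _ => (1 : ℂ) :=
  (tendsto_inv₀_cobounded.mono_left hl).isBigO_one ℂ

lemma inv_sq_isBigO_inv (hl : l ≤ Bornology.cobounded ℂ) :
    (fun s : ℂ => (s ^ 2)⁻¹) =O[l] fun s => s⁻¹ := by
  have := (inv_isBigO_one hl).mul (isBigO_refl (fun s : ℂ => s⁻¹) l)
  simp only [one_mul] at this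
  refine this.congr_left fun s => ?_
  rw [sq, mul_inv]

lemma div_isBigO_inv (κ : ℂ) : (fun s : ℂ => κ / s) =O[l] fun s => s⁻¹ := by
  simp only [div_eq_mul_inv]
  exact isBigO_const_mul_self κ _ _

lemma sub_one (hl : l ≤ Bornology.cobounded ℂ) (hf : FirstOrder l κ f) :
    (fun s => f s - 1) =O[l] fun s => s⁻¹ := by
  have := (IsBigO.trans hf (inv_sq_isBigO_inv hl)).add (div_isBigO_inv (l := l) κ)
  exact this.congr_left fun s => by ring

lemma tendsto_one (hl : l ≤ Bornology.cobounded ℂ) (hf : FirstOrder l κ f) :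
    Tendsto f l (𝓝 1) := by
  have := (hf.sub_one hl).trans_tendsto (tendsto_inv₀_cobounded.mono_left hl)
  simpa using this.add_const 1

lemma mul (hl : l ≤ Bornology.cobounded ℂ) (hf : FirstOrder l κ f) (hg : FirstOrder l κ' g) :
    FirstOrder l (κ + κ') fun s => f s * g s := by
  have h1 : (fun s => (f s - 1 - κ / s) * g s) =O[l] fun s => (s ^ 2)⁻¹ := by
    have := IsBigO.mul hf ((hg.tendsto_one hl).isBigO_one ℂ)
    simpa using this
  have h2 : (fun s => (1 + κ / s) * (g s - 1 - κ' / s)) =O[l] fun s => (s ^ 2)⁻¹ := by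
    have hb : (fun s : ℂ => 1 + κ / s) =O[l] fun _ => (1 : ℂ) :=
      (isBigO_refl _ _).add ((div_isBigO_inv κ).trans (inv_isBigO_one hl))
    have := hb.mul hg
    simpa using this
  have h3 : (fun s : ℂ => κ * κ' * (s ^ 2)⁻¹) =O[l] fun s => (s ^ 2)⁻¹ :=
    isBigO_const_mul_self _ _ _
  refine ((h1.add h2).add h3).congr_left fun s => ?_
  by_cases hs : s = 0
  · simp [hs]; ring
  · field_simp; ring

lemma inv (hl : l ≤ Bornology.cobounded ℂ) (hf : FirstOrder l κ f) :
    FirstOrder l (-κ) fun s => (f s)⁻¹ := by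
  have ht := hf.tendsto_one hl
  have hi : (fun s => (f s)⁻¹) =O[l] fun _ => (1 : ℂ) :=
    (ht.inv₀ one_ne_zero).isBigO_one ℂ
  have h2 : (fun s => (f s - 1) * (κ / s)) =O[l] fun s => (s ^ 2)⁻¹ := by
    have := (hf.sub_one hl).mul (div_isBigO_inv (l := l) κ)
    exact this.congr_right fun s => by rw [sq, mul_inv]
  have h := hi.mul ((IsBigO.neg_left hf).add h2)
  simp only [one_mul] at h
  refine IsBigO.congr' h ?_ EventuallyEq.rfl
  filter_upwards [ht.eventually_ne one_ne_zero] with s hs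
  field_simp
  ring

lemma prod (hl : l ≤ Bornology.cobounded ℂ) {ι : Type*} (S : Finset ι) {κ : ι → ℂ}
    {f : ι → ℂ → ℂ} (hf : ∀ i ∈ S, FirstOrder l (κ i) (f i)) :
    FirstOrder l (∑ i ∈ S, κ i) fun s => ∏ i ∈ S, f i s := by
  classical
  induction S using Finset.induction_on with
  | empty =>
    refine (isBigO_zero _ _).congr_left fun s => ?_
    simp
  | insert a S ha ih =>
    simp only [Finset.sum_insert ha, Finset.prod_insert ha]
    exact (hf a (Finset.mem_insert_self a S)).mul hl
      (ih fun i hi => hf i (Finset.mem_insert_of_mem hi))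

lemma congr' (hf : FirstOrder l κ f) (h : f =ᶠ[l] g) : FirstOrder l κ g :=
  IsBigO.congr' hf (h.mono fun s hs => by simp only [hs]) EventuallyEq.rfl

lemma exp (hl : l ≤ Bornology.cobounded ℂ)
    (hf : (fun s => f s - κ / s) =O[l] fun s => (s ^ 2)⁻¹) :
    FirstOrder l κ fun s => exp (f s) := by
  have hf1 : f =O[l] fun s => s⁻¹ := by
    refine ((hf.trans (inv_sq_isBigO_inv hl)).add (div_isBigO_inv (l := l) κ)).congr_left
      fun s => by ring
  have ht : Tendsto f l (𝓝 0) := hf1.trans_tendsto (tendsto_inv₀_cobounded.mono_left hl)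
  have he : (fun s => Complex.exp (f s) - 1 - f s) =O[l] fun s => (s ^ 2)⁻¹ := by
    have : (fun s => Complex.exp (f s) - 1 - f s) =O[l] fun s => f s ^ 2 := by
      refine IsBigO.of_bound 1 ?_
      filter_upwards [ht.norm.eventually_le_const (u := 1) (by simp)] with s hs
      rw [one_mul, norm_pow]
      exact norm_exp_sub_one_sub_id_le hs
    exact this.trans ((hf1.pow 2).congr_right fun s => by rw [inv_pow])
  exact (he.add hf).congr_left fun s => by ring

end FirstOrder

/-! ### Gamma quotients along a vertical line -/

/-- The filter of points `c + it` with `t → +∞`. -/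
def lineTop (c : ℝ) : Filter ℂ := map (fun t : ℝ => (c : ℂ) + t * I) atTop

/-- The filter of points `c + it` with `t → -∞`. -/
def lineBot (c : ℝ) : Filter ℂ := map (fun t : ℝ => (c : ℂ) + t * I) atBot

/-- The filter of points `c + it` with `|t| → ∞`. -/
def lineEnds (c : ℝ) : Filter ℂ := map (fun t : ℝ => (c : ℂ) + t * I) (cocompact ℝ)

lemma lineEnds_eq (c : ℝ) : lineEnds c = lineBot c ⊔ lineTop c := by
  rw [lineEnds, cocompact_eq_atBot_atTop, map_sup, lineBot, lineTop]

lemma eventually_lineEnds {c : ℝ} {p : ℂ → Prop} (T : ℝ)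
    (h : ∀ s : ℂ, s.re = c → T ≤ |s.im| → p s) : ∀ᶠ s in lineEnds c, p s := by
  rw [lineEnds, eventually_map]
  filter_upwards [eventually_abs_ge T] with t ht
  exact h _ (by simp) (by simpa using ht)

lemma lineEnds_le (c : ℝ) : lineEnds c ≤ Bornology.cobounded ℂ := by
  have : Tendsto (fun t : ℝ => (c : ℂ) + t * I) (cocompact ℝ) (Bornology.cobounded ℂ) := by
    rw [← tendsto_norm_atTop_iff_cobounded]
    refine tendsto_atTop_mono (fun t => ?_) (tendsto_norm_cocompact_atTop (E := ℝ))
    simpa using abs_im_le_norm ((c : ℂ) + t * I)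
  exact this

lemma lineTop_le (c : ℝ) : lineTop c ≤ lineEnds c := by rw [lineEnds_eq]; exact le_sup_right

lemma lineBot_le (c : ℝ) : lineBot c ≤ lineEnds c := by rw [lineEnds_eq]; exact le_sup_left

/-- Stirling's approximation to `Γ(αs + β)`, recentred at `log s`. -/
def stirlingLin (α : ℝ) (β s : ℂ) : ℂ :=
  (Real.sqrt (2 * Real.pi) : ℂ) * exp ((α * s + β - 1 / 2) * (Real.log α + log s) - α * s)

lemma stirlingLin_ne_zero (α : ℝ) (β s : ℂ) : stirlingLin α β s ≠ 0 :=
  mul_ne_zero sqrt_two_pi_ne_zero (exp_ne_zero _)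

lemma tendsto_inv_lineEnds (c : ℝ) : Tendsto (fun s : ℂ => s⁻¹) (lineEnds c) (𝓝 0) :=
  tendsto_inv₀_cobounded.mono_left (lineEnds_le c)

lemma firstOrder_stirlingQuot {α c : ℝ} {β : ℂ} (hα : 0 < α) (hp : 0 < α * c + β.re) :
    FirstOrder (lineEnds c) 0 fun s => stirlingQuot (α * s + β) := by
  refine IsBigO.of_bound (64 * (4 / α ^ 2 * (|c| + 1) ^ 2)) ?_
  refine eventually_lineEnds (max ((6 + |β.im|) / α) (max (2 * |β.im| / α) 1)) fun s hs hT => ?_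
  have h1 := (le_max_left _ _).trans hT
  have h2 := ((le_max_left _ _).trans (le_max_right _ _)).trans hT
  have h3 := ((le_max_right _ _).trans (le_max_right _ _)).trans hT
  rw [div_le_iff₀ hα] at h1 h2
  have him : ((α : ℂ) * s + β).im = α * s.im + β.im := by simp
  have hre : ((α : ℂ) * s + β).re = α * c + β.re := by simp [hs]
  have hlow : α * |s.im| - |β.im| ≤ |α * s.im + β.im| := by
    have := abs_sub_abs_le_abs_sub (α * s.im) (-β.im)
    rwa [abs_neg, abs_mul, abs_of_pos hα, sub_neg_eq_add] at this
  have hq := norm_stirlingQuot_sub_one_le (z := (α : ℂ) * s + β) (by rw [hre]; exact hp)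
    (by rw [him]; linarith)
  rw [zero_div, sub_zero]
  refine hq.trans ?_
  rw [him, norm_inv, norm_pow, div_eq_mul_inv, mul_assoc]
  gcongr
  have hsn : ‖s‖ ≤ (|c| + 1) * |s.im| := by
    have := norm_le_abs_re_add_abs_im s
    rw [hs] at this
    nlinarith [abs_nonneg c]
  have hsp : 0 < ‖s‖ := by
    have := abs_im_le_norm s
    linarith
  have hhalf : α * |s.im| / 2 ≤ |α * s.im + β.im| := by linarith
  have hpos : 0 < α * |s.im| / 2 := by positivity
  have habs : 0 < |α * s.im + β.im| := hpos.trans_le hhalf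
  rw [← sq_abs (α * s.im + β.im), inv_eq_one_div, ← div_eq_mul_inv,
    div_le_div_iff₀ (by positivity) (by positivity)]
  calc 1 * ‖s‖ ^ 2 ≤ ((|c| + 1) * |s.im|) ^ 2 := by rw [one_mul]; gcongr
    _ = 4 / α ^ 2 * (|c| + 1) ^ 2 * (α * |s.im| / 2) ^ 2 := by field_simp; norm_num
    _ ≤ _ := by gcongr

lemma firstOrder_exp_inv {α c : ℝ} {β : ℂ} (hα : 0 < α) :
    FirstOrder (lineEnds c) (1 / (12 * α)) fun s => exp (1 / (12 * (α * s + β))) := by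
  have hα' : (α : ℂ) ≠ 0 := by exact_mod_cast hα.ne'
  have ht : Tendsto (fun s : ℂ => (α + β * s⁻¹)) (lineEnds c) (𝓝 α) := by
    have := ((tendsto_inv_lineEnds c).const_mul β).const_add (α : ℂ)
    simpa using this
  apply FirstOrder.exp (lineEnds_le c)
  have hb : (fun s : ℂ => -β / (12 * α) * (α + β * s⁻¹)⁻¹) =O[lineEnds c] fun _ => (1 : ℂ) :=
    ((ht.inv₀ hα').const_mul _).isBigO_one ℂ
  have h := hb.mul (isBigO_refl (fun s : ℂ => (s ^ 2)⁻¹) (lineEnds c))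
  simp only [one_mul] at h
  refine IsBigO.congr' h ?_ EventuallyEq.rfl
  filter_upwards [ht.eventually_ne hα', eventually_lineEnds (c := c) 1
    (p := fun s => s ≠ 0) (by rintro s - h rfl; norm_num at h)] with s h1 h2
  have h3 : α * s + β ≠ 0 := by
    have : α * s + β = s * (α + β * s⁻¹) := by field_simp
    rw [this]; exact mul_ne_zero h2 h1
  have h4 : α + β * s⁻¹ = (α * s + β) / s := by field_simp
  rw [h4]
  field_simp
  ring

lemma norm_log_one_add_sub_le {w : ℂ} (hw : ‖w‖ ≤ 1 / 2) :
    ‖log (1 + w) - (w - w ^ 2 / 2)‖ ≤ ‖w‖ ^ 3 := by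
  have h := norm_log_sub_logTaylor_le 2 (z := w) (by linarith)
  have h2 : logTaylor (2 + 1) w = w - w ^ 2 / 2 := by
    simp [logTaylor, Finset.sum_range_succ]
    ring
  rw [h2] at h
  refine h.trans ?_
  have : (1 - ‖w‖)⁻¹ ≤ 2 := by
    rw [inv_le_comm₀ (by linarith) (by norm_num)]
    linarith
  have h4 : 0 ≤ ‖w‖ ^ 3 := by positivity
  norm_num
  nlinarith

/-- The principal branches are additive here because all arguments lie in the right half-plane. -/
lemma log_linear_eq {α : ℝ} {β s : ℂ} (hα : 0 < α) (hs : 0 < s.re) (hw : ‖β / (α * s)‖ ≤ 1 / 2) :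
    log (α * s + β) = Real.log α + log s + log (1 + β / (α * s)) := by
  have hs0 : s ≠ 0 := by rintro rfl; simp at hs
  have hα' : (α : ℂ) ≠ 0 := by exact_mod_cast hα.ne'
  set w := β / (α * s) with hwd
  have hwre : 0 < (1 + w).re := by
    have := (abs_le.mp (abs_re_le_norm w)).1
    rw [add_re, one_re]
    linarith
  have h1 : 1 + w ≠ 0 := by
    intro h
    rw [h] at hwre
    simp at hwre
  have e : α * s + β = (α : ℂ) * (s * (1 + w)) := by rw [hwd]; field_simp
  rw [e, log_ofReal_mul hα (mul_ne_zero hs0 h1), add_assoc]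
  congr 1
  rw [log_mul_eq_add_log_iff hs0 h1]
  have a1 := abs_lt.mp (abs_arg_lt_pi_div_two_iff.mpr (Or.inl hs))
  have a2 := abs_lt.mp (abs_arg_lt_pi_div_two_iff.mpr (Or.inl hwre))
  constructor <;> linarith [a1.1, a1.2, a2.1, a2.2]

/-- Replacing `log (αs + β)` by `log α + log s` in Stirling's formula costs a factor
`1 + κ/s + O(s⁻²)`. -/
lemma firstOrder_exp_stirlingExp {α c : ℝ} {β : ℂ} (hα : 0 < α) (hc : 0 < c) :
    FirstOrder (lineEnds c) (((β - 1 / 2) * β - β ^ 2 / 2) / α) fun s =>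
      (Real.sqrt (2 * Real.pi) : ℂ) * exp (stirlingExp (α * s + β)) / stirlingLin α β s := by
  have hα' : (α : ℂ) ≠ 0 := by exact_mod_cast hα.ne'
  have hlim : Tendsto (fun s : ℂ => β / (α * s)) (lineEnds c) (𝓝 0) := by
    have := (tendsto_inv_lineEnds c).const_mul (β / α)
    rw [mul_zero] at this
    refine this.congr fun s => ?_
    rw [div_mul_eq_div_div, ← div_eq_mul_inv]
  have hsmall := hlim.norm.eventually_le_const (u := 1 / 2) (by simp)
  have hne := eventually_lineEnds (c := c) 1 (p := fun s => s ≠ 0)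
    (by rintro s - h rfl; norm_num at h)
  have hre : ∀ᶠ s in lineEnds c, 0 < s.re :=
    eventually_lineEnds 0 fun s hs _ => by rw [hs]; exact hc
  have key : FirstOrder (lineEnds c) (((β - 1 / 2) * β - β ^ 2 / 2) / α) fun s =>
      exp ((α * s + β - 1 / 2) * log (1 + β / (α * s)) - β) := by
    apply FirstOrder.exp (lineEnds_le c)
    have hwO : (fun s : ℂ => β / (α * s)) =O[lineEnds c] fun s => s⁻¹ := by
      refine (isBigO_const_mul_self (β / α) (fun s : ℂ => s⁻¹) _).congr_left fun s => ?_
      rw [div_mul_eq_div_div, ← div_eq_mul_inv]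
    have hr : (fun s : ℂ => log (1 + β / (α * s)) - (β / (α * s) - (β / (α * s)) ^ 2 / 2))
        =O[lineEnds c] fun s => (s⁻¹) ^ 3 := by
      refine IsBigO.trans ?_ (hwO.pow 3)
      refine IsBigO.of_bound 1 ?_
      filter_upwards [hsmall] with s hs
      rw [one_mul, norm_pow]
      exact norm_log_one_add_sub_le hs
    have hlinO : (fun s : ℂ => α * s + β - 1 / 2) =O[lineEnds c] fun s => s := by
      have h1 : (fun s : ℂ => (α : ℂ) * s) =O[lineEnds c] fun s => s :=
        isBigO_const_mul_self _ _ _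
      have h2 : (fun _ : ℂ => β - 1 / 2) =O[lineEnds c] fun s => s :=
        (isLittleO_const_id_cobounded _).isBigO.mono (lineEnds_le c)
      exact (h1.add h2).congr_left fun s => by ring
    have hm := hlinO.mul hr
    have hm2 : (fun s : ℂ => (α * s + β - 1 / 2) *
        (log (1 + β / (α * s)) - (β / (α * s) - (β / (α * s)) ^ 2 / 2)))
        =O[lineEnds c] fun s => (s ^ 2)⁻¹ := by
      refine IsBigO.congr' hm EventuallyEq.rfl ?_
      filter_upwards [hne] with s hs
      field_simp
    have hm3 : (fun s : ℂ => (-(β - 1 / 2) * β ^ 2 / (2 * α ^ 2)) * (s ^ 2)⁻¹) =O[lineEnds c]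
        fun s => (s ^ 2)⁻¹ := isBigO_const_mul_self _ _ _
    refine IsBigO.congr' (hm2.add hm3) ?_ EventuallyEq.rfl
    filter_upwards [hne] with s hs
    field_simp
    ring
  refine key.congr' ?_
  filter_upwards [hsmall, hre] with s hs hsr
  rw [eq_div_iff (stirlingLin_ne_zero _ _ _), stirlingLin, stirlingExp, log_linear_eq hα hsr hs,
    mul_comm, mul_assoc, ← exp_add]
  congr 2
  ring

/-- Stirling's formula for `Γ(αs + β)` on a vertical line, to first order. -/
lemma exists_firstOrder_Gamma {α c : ℝ} {β : ℂ} (hα : 0 < α) (hc : 0 < c)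
    (hp : 0 < α * c + β.re) :
    ∃ κ, FirstOrder (lineEnds c) κ fun s => Gamma (α * s + β) / stirlingLin α β s := by
  refine ⟨_, (((firstOrder_exp_stirlingExp (β := β) hα hc).mul (lineEnds_le c)
    (firstOrder_exp_inv (β := β) hα)).mul (lineEnds_le c)
      (firstOrder_stirlingQuot hα hp)).congr' (Eventually.of_forall fun s => ?_)⟩
  simp only
  rw [Gamma_eq_stirling (z := α * s + β)]
  ring

/-! ### Sines and exponentials along a vertical line -/

/-- The exponential decay of one of the two exponentials in a sine, for `t → +∞`. -/
lemma exp_decay_top {b c : ℝ} (hb : 0 < b) (q : ℂ) :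
    (fun s : ℂ => exp (q + b * I * s)) =O[lineTop c] fun s => (s ^ 2)⁻¹ := by
  rw [lineTop, isBigO_map]
  have h1 : (fun t : ℝ => exp (q + b * I * ((c : ℂ) + t * I))) =O[atTop]
      fun t : ℝ => Real.exp (-b * t) := by
    refine IsBigO.of_bound (Real.exp q.re) (Eventually.of_forall fun t => ?_)
    rw [norm_exp, Real.norm_of_nonneg (Real.exp_pos _).le, ← Real.exp_add]
    apply le_of_eq
    congr 1
    simp
  have h2 : (fun t : ℝ => Real.exp (-b * t)) =O[atTop] fun t : ℝ => t ^ (-2 : ℝ) :=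
    (isLittleO_exp_neg_mul_rpow_atTop hb (-2)).isBigO
  have h3 : (fun t : ℝ => t ^ (-2 : ℝ)) =O[atTop] fun t : ℝ => (((c : ℂ) + t * I) ^ 2)⁻¹ := by
    refine IsBigO.of_bound ((|c| + 1) ^ 2) ?_
    filter_upwards [eventually_ge_atTop 1] with t ht
    have ht0 : 0 < t := by linarith
    have hn : ‖(c : ℂ) + t * I‖ ≤ (|c| + 1) * t := by
      refine (norm_add_le _ _).trans ?_
      rw [norm_mul, norm_I, mul_one, norm_real, norm_real, Real.norm_eq_abs,
        Real.norm_of_nonneg ht0.le]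
      nlinarith [abs_nonneg c]
    have hp : 0 < ‖(c : ℂ) + t * I‖ := by
      have := abs_im_le_norm ((c : ℂ) + t * I)
      simp only [add_im, ofReal_im, mul_im, ofReal_re, I_im, mul_one, I_re, mul_zero, add_zero,
        zero_add, abs_of_pos ht0] at this
      linarith
    rw [norm_inv, norm_pow, Real.norm_of_nonneg (by positivity), Real.rpow_neg ht0.le,
      ← div_eq_mul_inv, inv_eq_one_div, div_le_div_iff₀ (by positivity) (by positivity),
      show (2 : ℝ) = ((2 : ℕ) : ℝ) by norm_num, Real.rpow_natCast, one_mul, ← mul_pow]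
    gcongr
  exact (h1.trans h2).trans h3

lemma exp_decay_bot {b c : ℝ} (hb : 0 < b) (q : ℂ) :
    (fun s : ℂ => exp (q - b * I * s)) =O[lineBot c] fun s => (s ^ 2)⁻¹ := by
  have h := exp_decay_top (c := -c) hb q
  rw [lineTop, isBigO_map, ← map_neg_atBot, isBigO_map] at h
  rw [lineBot, isBigO_map]
  refine h.congr (fun t => ?_) (fun t => ?_)
  · simp only [Function.comp]
    congr 1
    push_cast
    ring
  · simp only [Function.comp]
    congr 1
    push_cast
    ring

lemma firstOrder_one_add {l : Filter ℂ} {f : ℂ → ℂ} (hf : f =O[l] fun s => (s ^ 2)⁻¹) :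
    FirstOrder l 0 fun s => 1 + f s := by
  refine hf.congr_left fun s => ?_
  simp

/-! ### The kernel of the functional equation and its gamma–cosine model -/

namespace GammaParams

variable {d : ℕ} (G : GammaParams d)

/-- The quotient of gamma factors `Δt(s) / Δ(1 - s)` of the functional equation. -/
def kernel (s : ℂ) : ℂ := G.Deltat s / G.Delta (1 - s)

/-- The shift `g = 2Aa`, so that `Γ(2As + g)` models the kernel. -/
def shift : ℂ := 2 * G.A * G.a

lemma A_pos (hd : 0 < d) : 0 < G.A := by
  have : Nonempty (Fin d) := ⟨⟨0, hd⟩⟩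
  exact Finset.sum_pos (fun ν _ => G.α_pos ν) Finset.univ_nonempty

lemma shift_eq (hd : 0 < d) : G.shift = G.Bt - G.B - G.A + 1 / 2 := by
  have h : (G.A : ℂ) ≠ 0 := by exact_mod_cast (G.A_pos hd).ne'
  rw [shift, a]
  field_simp
  ring

lemma shift_re : G.shift.re = -2 * G.A * G.theta := by
  simp [shift, theta]

/-- The phase `π(w/2 + k)` with `w = 2As + g`. -/
def phase (s : ℂ) : ℂ := Real.pi * ((2 * G.A * s + G.shift) / 2 + G.k)

lemma phase_eq (hd : 0 < d) (s : ℂ) :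
    G.phase s = Real.pi * (G.A * s + d / 2 - G.A - G.B) := by
  rw [phase, G.shift_eq hd, k]
  ring

lemma h_pos (hd : 0 < d) : 0 < G.h :=
  Finset.prod_pos fun ν _ => Real.rpow_pos_of_pos
    (div_pos (mul_pos two_pos (G.A_pos hd)) (G.α_pos ν)) _

lemma exp_I_pi_half_pow (d : ℕ) : exp (Real.pi * I * (d / 2)) = I ^ d := by
  rw [show (Real.pi * I * (d / 2) : ℂ) = d * (Real.pi / 2 * I) by ring, exp_nat_mul,
    exp_pi_div_two_mul_I]

/-- The product of the sines from the reflection formula is asymptotic to a single cosine. -/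
lemma firstOrder_trig (hd : 0 < d) (c : ℝ) :
    FirstOrder (lineEnds c) 0 fun s =>
      (∏ ν, 2 * sin (Real.pi * (G.α ν + G.β ν - G.α ν * s))) / (2 * cos (G.phase s)) := by
  have hA := G.A_pos hd
  have hpi := Real.pi_pos
  have hsumA : ∑ ν, (G.α ν : ℂ) = G.A := by rw [A]; push_cast; rfl
  have hsum (s : ℂ) : ∑ ν, (G.α ν + G.β ν - G.α ν * s) = G.A + G.B - G.A * s := by
    rw [Finset.sum_sub_distrib, Finset.sum_add_distrib, ← Finset.sum_mul, hsumA]; rfl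
  unfold FirstOrder
  rw [lineEnds_eq, isBigO_sup]
  constructor
  -- below the real axis `exp(-πi·)` dominates each sine and the cosine, above it `exp(πi·)`
  · have hl : lineBot c ≤ Bornology.cobounded ℂ := (lineBot_le c).trans (lineEnds_le c)
    have hnum : FirstOrder (lineBot c) (∑ ν : Fin d, 0) fun s =>
        ∏ ν, (1 + -exp (2 * Real.pi * I * (G.α ν + G.β ν) - (2 * Real.pi * G.α ν : ℝ) * I * s)) :=
      FirstOrder.prod hl _ fun ν _ => firstOrder_one_add
        ((exp_decay_bot (by have := G.α_pos ν; positivity) _).neg_left)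
    have hden : FirstOrder (lineBot c) 0 fun s => 1 + exp (-(2 * Real.pi * I *
        (d / 2 - G.A - G.B)) - (2 * Real.pi * G.A : ℝ) * I * s) :=
      firstOrder_one_add (exp_decay_bot (by positivity) _)
    have h := hnum.mul hl (hden.inv hl)
    simp only [Finset.sum_const_zero, neg_zero, add_zero] at h
    refine h.congr' (Eventually.of_forall fun s => ?_)
    simp only
    have hs : ∀ ν, 2 * sin (Real.pi * (G.α ν + G.β ν - G.α ν * s)) =
        I * exp (-(Real.pi * I) * (G.α ν + G.β ν - G.α ν * s)) *
        (1 + -exp (2 * Real.pi * I * (G.α ν + G.β ν) - (2 * Real.pi * G.α ν : ℝ) * I * s)) := by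
      intro ν
      rw [Complex.sin, mul_add, mul_neg, mul_assoc I (exp _) (exp _), ← exp_add]
      push_cast
      ring_nf
    have hc : 2 * cos (G.phase s) = exp (Real.pi * I * (d / 2)) *
        exp (-(Real.pi * I) * (G.A + G.B - G.A * s)) * (1 + exp (-(2 * Real.pi * I *
        (d / 2 - G.A - G.B)) - (2 * Real.pi * G.A : ℝ) * I * s)) := by
      rw [Complex.cos, G.phase_eq hd, ← exp_add, mul_add, mul_one, ← exp_add]
      push_cast
      ring_nf
    rw [hc, Finset.prod_congr rfl fun ν _ => hs ν, Finset.prod_mul_distrib,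
      Finset.prod_mul_distrib, ← exp_sum, ← Finset.mul_sum, hsum, exp_I_pi_half_pow]
    simp only [Finset.prod_const, Finset.card_univ, Fintype.card_fin]
    rw [mul_div_mul_left _ _ (mul_ne_zero (pow_ne_zero _ I_ne_zero) (exp_ne_zero _))]
    exact (div_eq_mul_inv _ _).symm
  · have hl : lineTop c ≤ Bornology.cobounded ℂ := (lineTop_le c).trans (lineEnds_le c)
    have hnum : FirstOrder (lineTop c) (∑ ν : Fin d, 0) fun s =>
        ∏ ν, (1 + -exp (-(2 * Real.pi * I * (G.α ν + G.β ν)) +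
          (2 * Real.pi * G.α ν : ℝ) * I * s)) :=
      FirstOrder.prod hl _ fun ν _ => firstOrder_one_add
        ((exp_decay_top (by have := G.α_pos ν; positivity) _).neg_left)
    have hden : FirstOrder (lineTop c) 0 fun s => 1 + exp (2 * Real.pi * I *
        (d / 2 - G.A - G.B) + (2 * Real.pi * G.A : ℝ) * I * s) :=
      firstOrder_one_add (exp_decay_top (by positivity) _)
    have h := hnum.mul hl (hden.inv hl)
    simp only [Finset.sum_const_zero, neg_zero, add_zero] at h
    refine h.congr' (Eventually.of_forall fun s => ?_)
    simp only
    have hs : ∀ ν, 2 * sin (Real.pi * (G.α ν + G.β ν - G.α ν * s)) =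
        (I⁻¹ * exp (Real.pi * I * (G.α ν + G.β ν - G.α ν * s))) *
        (1 + -exp (-(2 * Real.pi * I * (G.α ν + G.β ν)) +
          (2 * Real.pi * G.α ν : ℝ) * I * s)) := by
      intro ν
      rw [Complex.sin, mul_add, mul_neg, mul_assoc I⁻¹ (exp _) (exp _), ← exp_add, inv_I]
      push_cast
      ring_nf
    have hc : 2 * cos (G.phase s) = (exp (Real.pi * I * (d / 2)))⁻¹ *
        exp (Real.pi * I * (G.A + G.B - G.A * s)) * (1 + exp (2 * Real.pi * I *
        (d / 2 - G.A - G.B) + (2 * Real.pi * G.A : ℝ) * I * s)) := by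
      rw [Complex.cos, G.phase_eq hd, ← exp_neg, ← exp_add, mul_add, mul_one, ← exp_add]
      push_cast
      ring_nf
    rw [hc, Finset.prod_congr rfl fun ν _ => hs ν, Finset.prod_mul_distrib,
      Finset.prod_mul_distrib, ← exp_sum, ← Finset.mul_sum, hsum, exp_I_pi_half_pow]
    simp only [Finset.prod_const, Finset.card_univ, Fintype.card_fin]
    rw [inv_pow, mul_div_mul_left _ _ (mul_ne_zero (inv_ne_zero (pow_ne_zero _ I_ne_zero))
      (exp_ne_zero _))]
    exact (div_eq_mul_inv _ _).symm

/-- The constant `e₀ h^{-s}` in exponential form. -/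
lemma e0_mul_h_cpow (hd : 0 < d) (s : ℂ) :
    G.e0 * (G.h : ℂ) ^ (-s) = (Real.sqrt (2 / Real.pi) : ℂ) *
      exp (∑ ν, (2 * G.α ν * s + G.βt ν - G.β ν - G.α ν) *
        (Real.log (G.α ν) - Real.log (2 * G.A))) := by
  have hA := G.A_pos hd
  have hpos : ∀ ν, 0 < 2 * G.A / G.α ν := fun ν => div_pos (by positivity) (G.α_pos ν)
  have hlog : ∀ ν, Real.log (2 * G.A / G.α ν) = Real.log (2 * G.A) - Real.log (G.α ν) :=
    fun ν => Real.log_div (by positivity) (G.α_pos ν).ne'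
  have hh : (G.h : ℂ) ^ (-s) = ∏ ν, exp ((2 * G.α ν * -s) *
      (Real.log (2 * G.A) - Real.log (G.α ν))) := by
    have hl : Real.log G.h = ∑ ν, 2 * G.α ν * (Real.log (2 * G.A) - Real.log (G.α ν)) := by
      rw [h, Real.log_prod (fun ν _ => (Real.rpow_pos_of_pos (hpos ν) _).ne')]
      exact Finset.sum_congr rfl fun ν _ => by rw [Real.log_rpow (hpos ν), hlog]
    rw [cpow_def_of_ne_zero (by exact_mod_cast (G.h_pos hd).ne'), ← ofReal_log (G.h_pos hd).le, hl,
      ← exp_sum]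
    push_cast
    rw [Finset.sum_mul]
    congr 1
    exact Finset.sum_congr rfl fun ν _ => by ring
  rw [e0, hh, mul_assoc, ← Finset.prod_mul_distrib, exp_sum]
  congr 1
  refine Finset.prod_congr rfl fun ν _ => ?_
  rw [cpow_def_of_ne_zero (by exact_mod_cast (hpos ν).ne'), ← ofReal_log (hpos ν).le, hlog,
    ← exp_add]
  congr 1
  push_cast
  ring

/-- The Stirling approximations of the `2d` gamma factors in the numerator combine into that of the
single function `Γ(2As + g)`, up to an exponential factor. This is what determines `e₀` and `h`. -/
lemma prod_stirlingLin (hd : 0 < d) (s : ℂ) :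
    (∏ ν, stirlingLin (G.α ν) (G.βt ν) s * stirlingLin (G.α ν) (1 - G.α ν - G.β ν) s) =
      ((2 * Real.pi) ^ d / (Real.sqrt (2 * Real.pi)) : ℝ) *
      exp (∑ ν, (2 * G.α ν * s + G.βt ν - G.β ν - G.α ν) *
        (Real.log (G.α ν) - Real.log (2 * G.A))) * stirlingLin (2 * G.A) G.shift s := by
  have hsq : (Real.sqrt (2 * Real.pi) : ℂ) * Real.sqrt (2 * Real.pi) = 2 * Real.pi := by
    have := Real.mul_self_sqrt (show 0 ≤ 2 * Real.pi by positivity)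
    exact_mod_cast this
  have h1 : ∀ ν, stirlingLin (G.α ν) (G.βt ν) s * stirlingLin (G.α ν) (1 - G.α ν - G.β ν) s =
      (2 * Real.pi) * exp ((2 * G.α ν * s + G.βt ν - G.β ν - G.α ν) *
        (Real.log (G.α ν) + log s) - 2 * G.α ν * s) := by
    intro ν
    rw [stirlingLin, stirlingLin, mul_mul_mul_comm, hsq, ← exp_add]
    congr 2
    ring
  have hsumA : ∑ ν, (G.α ν : ℂ) = G.A := by rw [A]; push_cast; rfl
  rw [Finset.prod_congr rfl fun ν _ => h1 ν, Finset.prod_mul_distrib, ← exp_sum]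
  simp only [Finset.prod_const, Finset.card_univ, Fintype.card_fin]
  rw [stirlingLin]
  have h2 : ∑ ν, ((2 * G.α ν * s + G.βt ν - G.β ν - G.α ν) *
        (Real.log (G.α ν) + log s) - 2 * G.α ν * s) =
      (∑ ν, (2 * G.α ν * s + G.βt ν - G.β ν - G.α ν) *
        (Real.log (G.α ν) - Real.log (2 * G.A))) +
      (((2 * G.A : ℝ) * s + G.shift - 1 / 2) * (Real.log (2 * G.A) + log s)
        - (2 * G.A : ℝ) * s) := by
    have e1 : ((2 * G.A : ℝ) * s + G.shift - 1 / 2) =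
        ∑ ν, (2 * G.α ν * s + G.βt ν - G.β ν - G.α ν) := by
      simp only [Finset.sum_sub_distrib, Finset.sum_add_distrib, ← Finset.sum_mul,
        ← Finset.mul_sum, hsumA]
      rw [G.shift_eq hd, B, Bt]
      push_cast
      ring
    have e2 : ((2 * G.A : ℝ) : ℂ) * s = ∑ ν, 2 * G.α ν * s := by
      simp only [← Finset.sum_mul, ← Finset.mul_sum, hsumA]
      push_cast
      ring
    rw [e1, e2, Finset.sum_mul, ← Finset.sum_sub_distrib, ← Finset.sum_add_distrib]
    exact Finset.sum_congr rfl fun ν _ => by ring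
  rw [h2, exp_add]
  generalize exp (∑ ν, (2 * G.α ν * s + G.βt ν - G.β ν - G.α ν) *
    ((Real.log (G.α ν) : ℂ) - Real.log (2 * G.A))) = E
  push_cast
  have := sqrt_two_pi_ne_zero
  field_simp

/-- By the reflection formula, the kernel is a product of gamma functions and sines. -/
lemma kernel_eq_of_sin_ne_zero {s : ℂ}
    (hs : ∀ ν, sin (Real.pi * (G.α ν + G.β ν - G.α ν * s)) ≠ 0) :
    G.kernel s = (∏ ν, Gamma (G.α ν * s + G.βt ν) * Gamma (G.α ν * s + (1 - G.α ν - G.β ν))) *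
      (∏ ν, 2 * sin (Real.pi * (G.α ν + G.β ν - G.α ν * s))) / (2 * Real.pi) ^ d := by
  have hpi : (Real.pi : ℂ) ≠ 0 := by exact_mod_cast Real.pi_ne_zero
  have h : ∀ ν, Gamma (G.α ν * s + G.βt ν) / Gamma (G.α ν * (1 - s) + G.β ν) =
      Gamma (G.α ν * s + G.βt ν) * Gamma (G.α ν * s + (1 - G.α ν - G.β ν)) *
        (2 * sin (Real.pi * (G.α ν + G.β ν - G.α ν * s))) / (2 * Real.pi) := by
    intro ν
    have hr := Gamma_mul_Gamma_one_sub (G.α ν + G.β ν - G.α ν * s)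
    rw [show 1 - (G.α ν + G.β ν - G.α ν * s) = G.α ν * s + (1 - G.α ν - G.β ν) by ring,
      show G.α ν + G.β ν - G.α ν * s = G.α ν * (1 - s) + G.β ν by ring,
      eq_div_iff (by
        have := hs ν
        rwa [show G.α ν + G.β ν - G.α ν * s = G.α ν * (1 - s) + G.β ν by ring] at this)] at hr
    rw [show G.α ν + G.β ν - G.α ν * s = G.α ν * (1 - s) + G.β ν by ring]
    have hne : Gamma (G.α ν * (1 - s) + G.β ν) ≠ 0 := by
      intro h0
      rw [h0, zero_mul, zero_mul] at hr
      exact hpi hr.symm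
    rw [div_eq_div_iff hne (mul_ne_zero two_ne_zero hpi)]
    linear_combination (-2 * Gamma (G.α ν * s + G.βt ν)) * hr
  rw [kernel, Deltat, Delta, ← Finset.prod_div_distrib, Finset.prod_congr rfl fun ν _ => h ν,
    Finset.prod_div_distrib, Finset.prod_mul_distrib]
  simp

/-- The model kernel `e₀ h^{-s} Γ(2As + g) cos(π(w/2 + k))`. -/
def model (s : ℂ) : ℂ :=
  G.e0 * (G.h : ℂ) ^ (-s) * (Gamma (2 * G.A * s + G.shift) * cos (G.phase s))

lemma eventually_sin_ne_zero (c : ℝ) {α : ℝ} (hα : 0 < α) (β : ℂ) :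
    ∀ᶠ s in lineEnds c, sin (Real.pi * (α + β - α * s)) ≠ 0 := by
  refine eventually_lineEnds ((|β.im| + 1) / α) fun s _ hT h => ?_
  obtain ⟨k, hk⟩ := sin_eq_zero_iff.mp h
  have h1 : (α + β - α * s : ℂ) = k := by
    have hpi : (Real.pi : ℂ) ≠ 0 := by exact_mod_cast Real.pi_ne_zero
    apply mul_left_cancel₀ hpi
    rw [hk, mul_comm]
  have h2 := congrArg im h1
  simp at h2
  rw [div_le_iff₀ hα] at hT
  have : |β.im| = |s.im| * α := by
    rw [show β.im = s.im * α by linarith, abs_mul, abs_of_pos hα]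
  linarith

lemma eventually_cos_ne_zero (hd : 0 < d) (c : ℝ) :
    ∀ᶠ s in lineEnds c, cos (G.phase s) ≠ 0 := by
  have := (G.firstOrder_trig hd c).tendsto_one (lineEnds_le c)
  filter_upwards [this.eventually_ne one_ne_zero] with s hs h0
  rw [h0] at hs
  simp at hs

/-- The kernel equals its model up to a factor `1 + κ/s + O(s⁻²)`. -/
lemma exists_firstOrder_kernel (hd : 0 < d) {c : ℝ} (hc : 0 < c)
    (h1 : ∀ ν, 0 < G.α ν * c + (G.βt ν).re) (h2 : ∀ ν, 0 < G.α ν * c + (1 - G.α ν - G.β ν).re)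
    (h3 : 0 < 2 * G.A * c + G.shift.re) :
    ∃ κ, FirstOrder (lineEnds c) κ fun s => G.kernel s / G.model s := by
  have hl := lineEnds_le c
  choose κ₁ hκ₁ using fun ν => exists_firstOrder_Gamma (G.α_pos ν) hc (h1 ν)
  choose κ₂ hκ₂ using fun ν => exists_firstOrder_Gamma (G.α_pos ν) hc (h2 ν)
  obtain ⟨κ₃, hκ₃⟩ := exists_firstOrder_Gamma (α := 2 * G.A) (by linarith [G.A_pos hd]) hc h3
  have hP := FirstOrder.prod hl Finset.univ fun ν _ => (hκ₁ ν).mul hl (hκ₂ ν)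
  refine ⟨_, ((hP.mul hl (hκ₃.inv hl)).mul hl (G.firstOrder_trig hd c)).congr' ?_⟩
  have hre : ∀ᶠ s in lineEnds c, s.re = c := eventually_lineEnds 0 fun s hs _ => hs
  filter_upwards [eventually_all.mpr fun ν => eventually_sin_ne_zero c (G.α_pos ν) (G.β ν),
    G.eventually_cos_ne_zero hd c, hre] with s hs hcs hsre
  have hst := G.prod_stirlingLin hd s
  have hprod : (∏ ν, stirlingLin (G.α ν) (G.βt ν) s *
      stirlingLin (G.α ν) (1 - G.α ν - G.β ν) s) ≠ 0 :=
    Finset.prod_ne_zero_iff.mpr fun ν _ =>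
      mul_ne_zero (stirlingLin_ne_zero _ _ _) (stirlingLin_ne_zero _ _ _)
  have hsl := stirlingLin_ne_zero (2 * G.A) G.shift s
  have hgam : Gamma ((2 * G.A : ℝ) * s + G.shift) ≠ 0 := by
    apply Gamma_ne_zero_of_re_pos
    simpa [hsre] using h3
  simp only [div_mul_div_comm]
  rw [Finset.prod_div_distrib, G.kernel_eq_of_sin_ne_zero hs, model, G.e0_mul_h_cpow hd, hst]
  set E := exp (∑ ν, (2 * G.α ν * s + G.βt ν - G.β ν - G.α ν) *
        ((Real.log (G.α ν) : ℂ) - Real.log (2 * G.A))) with hE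
  have hE0 : E ≠ 0 := exp_ne_zero _
  have hpi : (Real.pi : ℂ) ≠ 0 := by exact_mod_cast Real.pi_ne_zero
  have hconst : (2 : ℂ) * ((2 * Real.pi) ^ d / (Real.sqrt (2 * Real.pi)) : ℝ) =
      (Real.sqrt (2 / Real.pi) : ℂ) * (2 * Real.pi) ^ d := by
    have hr : 2 * ((2 * Real.pi) ^ d / (Real.sqrt (2 * Real.pi))) =
        Real.sqrt (2 / Real.pi) * (2 * Real.pi) ^ d := by
      have hp := Real.pi_pos
      have hm : Real.sqrt (2 / Real.pi) * Real.sqrt (2 * Real.pi) = 2 := by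
        rw [← Real.sqrt_mul (by positivity), show 2 / Real.pi * (2 * Real.pi) = 2 ^ 2 by field_simp,
          Real.sqrt_sq (by norm_num)]
      have h0 : 0 < Real.sqrt (2 * Real.pi) := by positivity
      rw [← mul_div_assoc, div_eq_iff h0.ne']
      linear_combination (-(2 * Real.pi) ^ d) * hm
    exact_mod_cast hr
  have hs2 : (Real.sqrt (2 / Real.pi) : ℂ) ≠ 0 := by
    have : 0 < Real.sqrt (2 / Real.pi) := by
      have := Real.pi_pos
      positivity
    exact_mod_cast this.ne'
  have hc2 : (((2 * Real.pi) ^ d / (Real.sqrt (2 * Real.pi)) : ℝ) : ℂ) ≠ 0 := by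
    have : 0 < ((2 * Real.pi) ^ d / (Real.sqrt (2 * Real.pi))) := by positivity
    exact_mod_cast this.ne'
  have hq : ((2 * G.A : ℝ) : ℂ) = 2 * G.A := by push_cast; rfl
  rw [hq] at hgam ⊢
  generalize (((2 * Real.pi) ^ d / (Real.sqrt (2 * Real.pi)) : ℝ) : ℂ) = K at *
  generalize (∏ ν, Gamma (G.α ν * s + G.βt ν) * Gamma (G.α ν * s + (1 - G.α ν - G.β ν))) = PG
  generalize (∏ ν, 2 * sin (Real.pi * (G.α ν + G.β ν - G.α ν * s))) = PS
  have hpd : (2 * (Real.pi : ℂ)) ^ d ≠ 0 := pow_ne_zero _ (mul_ne_zero two_ne_zero hpi)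
  rw [inv_div, div_mul_div_comm, div_mul_div_comm, div_div, div_eq_div_iff]
  · linear_combination (-(PG * stirlingLin (2 * G.A) G.shift s * PS * E *
      Gamma (2 * G.A * s + G.shift) * cos (G.phase s))) * hconst
  · exact mul_ne_zero (mul_ne_zero (mul_ne_zero (mul_ne_zero hc2 hE0) hsl) hgam)
      (mul_ne_zero two_ne_zero hcs)
  · exact mul_ne_zero hpd (mul_ne_zero (mul_ne_zero hs2 hE0) (mul_ne_zero hgam hcs))

end GammaParams

/-! ### Bounds for the kernel on vertical lines -/

lemma norm_cos_le (z : ℂ) : ‖cos z‖ ≤ Real.exp |z.im| := by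
  have h1 : ‖exp (z * I)‖ ≤ Real.exp |z.im| := by
    rw [norm_exp]; apply Real.exp_le_exp.mpr
    simpa using neg_le_abs z.im
  have h2 : ‖exp (-z * I)‖ ≤ Real.exp |z.im| := by
    rw [norm_exp]; apply Real.exp_le_exp.mpr
    simpa using le_abs_self z.im
  rw [Complex.cos, norm_div]
  have := norm_add_le (exp (z * I)) (exp (-z * I))
  norm_num
  norm_num at this h1 h2
  linarith

lemma one_add_abs_linear_le (p q t : ℝ) : 1 + |p * t + q| ≤ (1 + |p| + |q|) * (1 + |t|) := by
  have := abs_add_le (p * t) q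
  rw [abs_mul] at this
  nlinarith [abs_nonneg p, abs_nonneg q, abs_nonneg t, mul_nonneg (abs_nonneg q) (abs_nonneg t)]

namespace GammaParams

variable {d : ℕ} (G : GammaParams d)

/-- The line `Re s = c` lies far enough to the right for the analysis of the kernel: all gamma
functions in its numerator, after reflection of the denominator, have arguments of positive real
part, and the remainder after two terms of the model grows with a nonnegative exponent. -/
structure IsFar (c : ℝ) : Prop where
  pos : 0 < c
  betat : ∀ ν, 0 < G.α ν * c + (G.βt ν).re
  beta : ∀ ν, 0 < G.α ν * c + (1 - G.α ν - G.β ν).re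
  shift : 5 / 2 ≤ 2 * G.A * c + G.shift.re

lemma eventually_isFar (hd : 0 < d) : ∀ᶠ c in atTop, G.IsFar c := by
  have hlin : ∀ p q T : ℝ, 0 < p → ∀ᶠ c : ℝ in atTop, T < p * c + q := fun p q T hp =>
    (tendsto_atTop_add_const_right _ q (tendsto_id.const_mul_atTop hp)).eventually
      (eventually_gt_atTop T)
  filter_upwards [eventually_gt_atTop 0,
    eventually_all.mpr fun ν => hlin (G.α ν) (G.βt ν).re 0 (G.α_pos ν),
    eventually_all.mpr fun ν => hlin (G.α ν) (1 - G.α ν - G.β ν).re 0 (G.α_pos ν),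
    hlin (2 * G.A) G.shift.re (5 / 2) (by linarith [G.A_pos hd])] with c h1 h2 h3 h4
  exact ⟨h1, h2, h3, h4.le⟩

/-- The model kernel on the line `Re s = c`, without the factor `e₀ h^{-s}`. -/
lemma exists_norm_gamma_cos_le {c : ℝ}
    (h : 1 / 2 ≤ 2 * G.A * c + G.shift.re) : ∃ K : ℝ, 0 < K ∧ ∀ t : ℝ,
      ‖Gamma (2 * G.A * (c + t * I) + G.shift) * cos (G.phase (c + t * I))‖ ≤
        K * (1 + |t|) ^ (2 * G.A * c + G.shift.re - 1 / 2) := by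
  obtain ⟨K, hK, hb⟩ := exists_norm_Gamma_le (x := 2 * G.A * c + G.shift.re) (by linarith)
  set e := 2 * G.A * c + G.shift.re - 1 / 2 with he
  set M := 1 + |2 * G.A| + |G.shift.im|
  have hM : 0 < M := by positivity
  refine ⟨K * M ^ e * Real.exp |Real.pi * G.k.im|, by positivity, fun t => ?_⟩
  set y := 2 * G.A * t + G.shift.im with hy
  have hw : (2 * G.A * (c + t * I) + G.shift : ℂ) =
      ((2 * G.A * c + G.shift.re : ℝ) : ℂ) + (y : ℂ) * I := by
    apply Complex.ext <;> simp [hy]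
  have him : (G.phase (c + t * I)).im = Real.pi / 2 * y + Real.pi * G.k.im := by
    rw [phase, hw]
    simp
    ring
  have hcos : ‖cos (G.phase (c + t * I))‖ ≤
      Real.exp (Real.pi / 2 * |y|) * Real.exp |Real.pi * G.k.im| := by
    refine (norm_cos_le _).trans ?_
    rw [← Real.exp_add, him]
    apply Real.exp_le_exp.mpr
    refine (abs_add_le _ _).trans ?_
    rw [abs_mul (Real.pi / 2), abs_of_pos (by positivity : 0 < Real.pi / 2)]
  rw [norm_mul, hw]
  calc _ ≤ ‖Gamma (((2 * G.A * c + G.shift.re : ℝ) : ℂ) + (y : ℂ) * I)‖ *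
        (Real.exp (Real.pi / 2 * |y|) * Real.exp |Real.pi * G.k.im|) := by gcongr
    _ = ‖Gamma (((2 * G.A * c + G.shift.re : ℝ) : ℂ) + (y : ℂ) * I)‖ *
        Real.exp (Real.pi / 2 * |y|) * Real.exp |Real.pi * G.k.im| := by ring
    _ ≤ K * (1 + |y|) ^ e * Real.exp |Real.pi * G.k.im| := by
        exact mul_le_mul_of_nonneg_right (hb y) (Real.exp_pos _).le
    _ ≤ K * (M * (1 + |t|)) ^ e * Real.exp |Real.pi * G.k.im| := by
        have he0 : 0 ≤ e := by rw [he]; linarith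
        gcongr
        exact one_add_abs_linear_le _ _ _
    _ = _ := by
        rw [Real.mul_rpow hM.le (by positivity)]
        ring

lemma continuous_kernel_line {c : ℝ} (h : ∀ ν, 0 < G.α ν * c + (G.βt ν).re) :
    Continuous fun t : ℝ => G.kernel (c + t * I) := by
  have h1 : Continuous fun t : ℝ => G.Deltat (c + t * I) := by
    refine continuous_finsetProd _ fun ν _ => ?_
    have hc := (continuous_Gamma_line (h ν)).comp
      (f := fun t : ℝ => G.α ν * t + (G.βt ν).im) (by fun_prop)
    refine hc.congr fun t => ?_
    simp only [Function.comp]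
    congr 1
    apply Complex.ext <;> simp
  have h2 : Continuous fun s : ℂ => (G.Delta s)⁻¹ := by
    simp only [Delta, ← Finset.prod_inv_distrib]
    refine continuous_finsetProd _ fun ν _ => ?_
    exact differentiable_one_div_Gamma.continuous.comp
      (g := fun s => (Gamma s)⁻¹) (by fun_prop)
  simp only [kernel, div_eq_mul_inv]
  exact h1.mul (h2.comp (g := fun s => (G.Delta s)⁻¹) (by fun_prop))

lemma continuous_gamma_shift_line {c : ℝ} (h : 0 < 2 * G.A * c + G.shift.re) :
    Continuous fun t : ℝ => Gamma (2 * G.A * (c + t * I) + G.shift) := by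
  have hc := (continuous_Gamma_line h).comp
    (f := fun t : ℝ => 2 * G.A * t + G.shift.im) (by fun_prop)
  refine hc.congr fun t => ?_
  simp only [Function.comp]
  congr 1
  apply Complex.ext <;> simp

lemma continuous_cos_phase : Continuous fun s : ℂ => cos (G.phase s) := by
  simp only [phase]
  fun_prop

lemma e0_ne_zero (hd : 0 < d) : G.e0 ≠ 0 := by
  have hA := G.A_pos hd
  have hp := Real.pi_pos
  refine mul_ne_zero ?_ (Finset.prod_ne_zero_iff.mpr fun ν _ => ?_)
  · have : 0 < Real.sqrt (2 / Real.pi) := by positivity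
    exact_mod_cast this.ne'
  · have : 0 < 2 * G.A / G.α ν := div_pos (by positivity) (G.α_pos ν)
    rw [cpow_def_of_ne_zero (by exact_mod_cast this.ne')]
    exact exp_ne_zero _

/-- The two-term model of the kernel: `model(s) (1 + κ/(w - 1))` with `w = 2As + g`. -/
def model₂ (κ s : ℂ) : ℂ := G.model s * (1 + κ / (2 * G.A * s + G.shift - 1))

lemma continuous_model_line (hd : 0 < d) {c : ℝ} (h : 0 < 2 * G.A * c + G.shift.re) :
    Continuous fun t : ℝ => G.model (c + t * I) := by
  have hh : (G.h : ℂ) ≠ 0 := by exact_mod_cast (G.h_pos hd).ne'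
  have hc : Continuous fun s : ℂ => (G.h : ℂ) ^ (-s) := by
    simp only [cpow_def_of_ne_zero hh]
    fun_prop
  exact (continuous_const.mul (hc.comp (by fun_prop))).mul ((G.continuous_gamma_shift_line h).mul
    (G.continuous_cos_phase.comp (by fun_prop)))

lemma continuous_model₂_line (hd : 0 < d) {c : ℝ} (h : 1 < 2 * G.A * c + G.shift.re) (κ : ℂ) :
    Continuous fun t : ℝ => G.model₂ κ (c + t * I) := by
  refine (G.continuous_model_line hd (by linarith)).mul (continuous_const.add
    (continuous_const.div (by fun_prop) fun t h0 => ?_))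
  have := congrArg re h0
  simp at this
  linarith

lemma norm_h_cpow (hd : 0 < d) (c t : ℝ) : ‖(G.h : ℂ) ^ (-(c + t * I : ℂ))‖ = G.h ^ (-c) := by
  rw [norm_cpow_eq_rpow_re_of_pos (G.h_pos hd)]
  simp

lemma exists_norm_model_le (hd : 0 < d) {c : ℝ} (h : 1 / 2 ≤ 2 * G.A * c + G.shift.re) :
    ∃ K : ℝ, 0 < K ∧ ∀ t : ℝ, ‖G.model (c + t * I)‖ ≤
      K * (1 + |t|) ^ (2 * G.A * c + G.shift.re - 1 / 2) := by
  obtain ⟨K, hK, hb⟩ := G.exists_norm_gamma_cos_le h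
  have h1 := norm_pos_iff.mpr (G.e0_ne_zero hd)
  have h2 := Real.rpow_pos_of_pos (G.h_pos hd) (-c)
  refine ⟨‖G.e0‖ * G.h ^ (-c) * K, by positivity, fun t => ?_⟩
  rw [model, norm_mul, norm_mul, G.norm_h_cpow hd, mul_assoc _ K]
  gcongr
  exact hb t

lemma firstOrder_correction {c : ℝ} (hA : 0 < G.A) (κ : ℂ) :
    FirstOrder (lineEnds c) κ fun s => 1 + 2 * G.A * κ / (2 * G.A * s + G.shift - 1) := by
  have hA' : (2 * G.A : ℂ) ≠ 0 := mul_ne_zero two_ne_zero (by exact_mod_cast hA.ne')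
  have ht : Tendsto (fun s : ℂ => (2 * G.A + (G.shift - 1) * s⁻¹)) (lineEnds c)
      (𝓝 (2 * G.A)) := by
    have := ((tendsto_inv_lineEnds c).const_mul (G.shift - 1)).const_add (2 * G.A : ℂ)
    simpa using this
  have hb := (((ht.inv₀ hA').const_mul (-κ * (G.shift - 1))).isBigO_one ℂ).mul
    (isBigO_refl (fun s : ℂ => (s ^ 2)⁻¹) (lineEnds c))
  simp only [one_mul] at hb
  refine IsBigO.congr' hb ?_ EventuallyEq.rfl
  filter_upwards [ht.eventually_ne hA', eventually_lineEnds (c := c) 1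
    (p := fun s => s ≠ 0) (by rintro s - h rfl; norm_num at h)] with s h1 h2
  have h4 : 2 * G.A + (G.shift - 1) * s⁻¹ = (2 * G.A * s + G.shift - 1) / s := by
    field_simp
    ring
  rw [h4] at h1 ⊢
  have h3 : 2 * G.A * s + G.shift - 1 ≠ 0 := fun h0 => h1 (by rw [h0, zero_div])
  field_simp
  ring

lemma inv_sq_isBigO_one_add_abs (c : ℝ) :
    (fun t : ℝ => (((c : ℂ) + t * I) ^ 2)⁻¹) =O[cocompact ℝ] fun t : ℝ => (1 + |t|) ^ (-2 : ℝ) := by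
  refine IsBigO.of_bound 4 ?_
  filter_upwards [eventually_abs_ge 1] with t ht
  have h1 : |t| ≤ ‖(c : ℂ) + t * I‖ := by simpa using abs_im_le_norm ((c : ℂ) + t * I)
  have h2 : 0 < ‖(c : ℂ) + t * I‖ := by linarith
  rw [norm_inv, norm_pow, Real.norm_of_nonneg (by positivity), Real.rpow_neg (by positivity),
    ← div_eq_mul_inv, inv_eq_one_div, div_le_div_iff₀ (by positivity) (by positivity),
    show (2 : ℝ) = ((2 : ℕ) : ℝ) by norm_num, Real.rpow_natCast]
  nlinarith

/-- The kernel agrees with its two-term model up to a relative error `O(t⁻²)` on a vertical line. -/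
lemma exists_kernel_sub_model₂_le (hd : 0 < d) {c : ℝ} (hc : G.IsFar c) :
    ∃ κ : ℂ, ∃ K : ℝ, 0 < K ∧ ∀ t : ℝ, ‖G.kernel (c + t * I) - G.model₂ κ (c + t * I)‖ ≤
      K * (1 + |t|) ^ (2 * G.A * c + G.shift.re - 5 / 2) := by
  have hs := hc.shift
  obtain ⟨κ, hκ⟩ := G.exists_firstOrder_kernel hd hc.pos hc.betat hc.beta (by linarith)
  obtain ⟨Km, hKm, hm⟩ := G.exists_norm_model_le hd (c := c) (by linarith)
  refine ⟨2 * G.A * κ, ?_⟩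
  have hcont : Continuous fun t : ℝ =>
      G.kernel (c + t * I) - G.model₂ (2 * G.A * κ) (c + t * I) :=
    (G.continuous_kernel_line hc.betat).sub (G.continuous_model₂_line hd (by linarith) _)
  refine exists_bound_of_isBigO hcont ?_
  have hE : (fun s => G.kernel s / G.model s - (1 + 2 * G.A * κ / (2 * G.A * s + G.shift - 1)))
      =O[lineEnds c] fun s => (s ^ 2)⁻¹ :=
    (IsBigO.sub hκ (G.firstOrder_correction (G.A_pos hd) κ)).congr_left fun s => by ring
  have hmne : ∀ᶠ s in lineEnds c, G.model s ≠ 0 := by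
    filter_upwards [hκ.tendsto_one (lineEnds_le c) |>.eventually_ne one_ne_zero] with s hs h0
    rw [h0, div_zero] at hs
    exact hs rfl
  rw [lineEnds, isBigO_map] at hE
  rw [lineEnds, eventually_map] at hmne
  have hmO : (fun t : ℝ => G.model (c + t * I)) =O[cocompact ℝ]
      fun t : ℝ => (1 + |t|) ^ (2 * G.A * c + G.shift.re - 1 / 2) :=
    IsBigO.of_bound Km (Eventually.of_forall fun t => by
      rw [Real.norm_of_nonneg (by positivity)]; exact hm t)
  refine IsBigO.congr' (hmO.mul (hE.trans (inv_sq_isBigO_one_add_abs c))) ?_ ?_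
  · filter_upwards [hmne] with t ht
    simp only [Function.comp, model₂]
    field_simp
  · refine Eventually.of_forall fun t => ?_
    simp only
    rw [← Real.rpow_add (by positivity)]
    congr 1
    ring

lemma exists_norm_kernel_le (hd : 0 < d) {c : ℝ} (hc : G.IsFar c) :
    ∃ K : ℝ, 0 < K ∧ ∀ t : ℝ, ‖G.kernel (c + t * I)‖ ≤
      K * (1 + |t|) ^ (2 * G.A * c + G.shift.re) := by
  have hs := hc.shift
  obtain ⟨κ, hκ⟩ := G.exists_firstOrder_kernel hd hc.pos hc.betat hc.beta (by linarith)
  obtain ⟨Km, hKm, hm⟩ := G.exists_norm_model_le hd (c := c) (by linarith)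
  refine exists_bound_of_isBigO (G.continuous_kernel_line hc.betat) ?_
  have ht := hκ.tendsto_one (lineEnds_le c)
  have hO := ht.isBigO_one ℝ
  have hmne := ht.eventually_ne one_ne_zero
  rw [lineEnds, isBigO_map] at hO
  rw [lineEnds, eventually_map] at hmne
  have hmO : (fun t : ℝ => G.model (c + t * I)) =O[cocompact ℝ]
      fun t : ℝ => (1 + |t|) ^ (2 * G.A * c + G.shift.re) :=
    IsBigO.of_bound Km (Eventually.of_forall fun t => by
      rw [Real.norm_of_nonneg (by positivity)]
      refine (hm t).trans ?_
      gcongr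
      · linarith [abs_nonneg t]
      · linarith)
  have h := hmO.mul (show (fun t : ℝ => G.kernel (c + t * I) / G.model (c + t * I))
    =O[cocompact ℝ] fun _ => (1 : ℝ) from hO)
  refine IsBigO.congr' h ?_ ?_
  · filter_upwards [hmne] with t ht
    have : G.model (c + t * I) ≠ 0 := fun h0 => by rw [h0, div_zero] at ht; exact ht rfl
    field_simp
  · refine Eventually.of_forall fun t => ?_
    simp

end GammaParams

open MeasureTheory Set

/-! ### Localized weights: Mellin transforms and oscillatory integrals -/

/-- A smooth real function supported on `[-1, 1]`. -/
structure IsTest (f : ℝ → ℝ) : Prop where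
  smooth : ContDiff ℝ (⊤ : ℕ∞) f
  support : Function.support f ⊆ Icc (-1) 1

lemma IsBump.isTest {f : ℝ → ℝ} (h : IsBump f) : IsTest f := ⟨h.smooth, h.support⟩

namespace IsTest

variable {f : ℝ → ℝ}

lemma tsupport_subset (h : IsTest f) : tsupport f ⊆ Icc (-1) 1 :=
  closure_minimal h.support isClosed_Icc

lemma deriv (h : IsTest f) : IsTest (deriv f) :=
  ⟨(contDiff_infty_iff_deriv.mp h.smooth).2,
    (support_deriv_subset.trans h.tsupport_subset)⟩

lemma hasDerivAt (h : IsTest f) (u : ℝ) : HasDerivAt f (_root_.deriv f u) u :=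
  ((contDiff_infty_iff_deriv.mp h.smooth).1 u).hasDerivAt

lemma continuous (h : IsTest f) : Continuous f := h.smooth.continuous

lemma exists_bound (h : IsTest f) : ∃ M : ℝ, 0 ≤ M ∧ ∀ u, |f u| ≤ M := by
  obtain ⟨M, hM⟩ := isCompact_Icc.exists_bound_of_continuousOn (s := Icc (-1 : ℝ) 1)
    h.continuous.continuousOn
  refine ⟨max M 0, le_max_right _ _, fun u => ?_⟩
  by_cases hu : u ∈ Icc (-1 : ℝ) 1
  · exact (hM u hu).trans (le_max_left _ _)
  · rw [Function.notMem_support.mp fun h' => hu (h.support h'), abs_zero]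
    exact le_max_right _ _

lemma weight_eq_zero (h : IsTest f) {L u : ℝ} (hL : 0 < L)
    (hu : u ∉ Icc (1 - 1 / L) (1 + 1 / L)) : weight f L u = 0 := by
  refine Function.notMem_support.mp fun h' => hu ?_
  have := h.support h'
  constructor
  · have h1 : -1 / L ≤ u - 1 := by rw [div_le_iff₀ hL]; exact this.1
    rw [neg_div] at h1
    linarith
  · have h1 : u - 1 ≤ 1 / L := by rw [le_div_iff₀ hL]; exact this.2
    linarith

lemma continuous_weight (h : IsTest f) (L : ℝ) : Continuous (weight f L) :=
  h.continuous.comp (by fun_prop)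

lemma hasDerivAt_weight (h : IsTest f) (L u : ℝ) :
    HasDerivAt (weight f L) (L * weight (_root_.deriv f) L u) u := by
  have h1 : HasDerivAt (fun u : ℝ => (u - 1) * L) L u := by
    simpa using ((hasDerivAt_id u).sub_const 1).mul_const L
  have := (h.hasDerivAt ((u - 1) * L)).comp u h1
  rw [mul_comm] at this
  exact this

end IsTest

lemma Icc_window_subset {L : ℝ} (hL : 2 ≤ L) : Icc (1 - 1 / L) (1 + 1 / L) ⊆ Icc (1 / 2) (3 / 2) := by
  have : 1 / L ≤ 1 / 2 := one_div_le_one_div_of_le (by norm_num) hL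
  exact Icc_subset_Icc (by linarith) (by linarith)

lemma norm_integral_window_le {F : ℝ → ℂ} {L C : ℝ} (hL : 2 ≤ L)
    (h0 : ∀ u ∉ Icc (1 - 1 / L) (1 + 1 / L), F u = 0)
    (h1 : ∀ u ∈ Icc (1 - 1 / L) (1 + 1 / L), ‖F u‖ ≤ C) :
    ‖∫ u in Ioi (0 : ℝ), F u‖ ≤ C * 2 / L := by
  have hsub : Icc (1 - 1 / L) (1 + 1 / L) ⊆ Ioi 0 := fun u hu => by
    have := (Icc_window_subset hL hu).1
    exact lt_of_lt_of_le (by norm_num) this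
  rw [setIntegral_eq_of_subset_of_forall_sdiff_eq_zero measurableSet_Ioi hsub
    (fun u hu => h0 u hu.2)]
  refine (norm_setIntegral_le_of_norm_le_const (by simp) h1).trans (le_of_eq ?_)
  have : 0 < L := by linarith
  rw [Measure.real, Real.volume_Icc, ENNReal.toReal_ofReal (by
    have : 0 ≤ 1 / L := by positivity
    linarith)]
  ring

lemma norm_cpow_le_of_mem {u : ℝ} (hu : u ∈ Icc (1 / 2 : ℝ) (3 / 2)) (p : ℂ) :
    ‖(u : ℂ) ^ p‖ ≤ 2 ^ |p.re| := by
  have hu0 : 0 < u := lt_of_lt_of_le (by norm_num) hu.1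
  rw [norm_cpow_eq_rpow_re_of_pos hu0]
  exact rpow_le_of_mem_Icc _ (by norm_num) (by linarith [hu.1]) (by linarith [hu.2])

/-- The integral of the derivative of a function supported near `1` vanishes. -/
lemma integral_deriv_window_eq_zero {H H' : ℝ → ℂ} {L : ℝ} (hL : 2 ≤ L)
    (h0 : ∀ u ∉ Icc (1 - 1 / L) (1 + 1 / L), H u = 0)
    (h0' : ∀ u ∉ Icc (1 - 1 / L) (1 + 1 / L), H' u = 0)
    (hd : ∀ u, 0 < u → HasDerivAt H (H' u) u) (hc : ContinuousOn H' (Ioi 0)) :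
    ∫ u in Ioi (0 : ℝ), H' u = 0 := by
  have hw := Icc_window_subset hL
  have hsub : Ioc (1 / 4 : ℝ) 2 ⊆ Ioi 0 := fun u hu => lt_trans (by norm_num) hu.1
  have hz : ∀ u ∈ Ioi (0 : ℝ) \ Ioc (1 / 4 : ℝ) 2, H' u = 0 := fun u hu => h0' u fun hu' =>
    hu.2 ⟨lt_of_lt_of_le (by norm_num) (hw hu').1, (hw hu').2.trans (by norm_num)⟩
  rw [setIntegral_eq_of_subset_of_forall_sdiff_eq_zero measurableSet_Ioi hsub hz,
    ← intervalIntegral.integral_of_le (by norm_num)]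
  have hu : ∀ u ∈ uIcc (1 / 4 : ℝ) 2, 0 < u := fun u hu => by
    rw [uIcc_of_le (by norm_num)] at hu
    exact lt_of_lt_of_le (by norm_num) hu.1
  rw [intervalIntegral.integral_eq_sub_of_hasDerivAt (fun u hx => hd u (hu u hx))
    (hc.mono hu).intervalIntegrable, h0 2 fun h => ?_, h0 (1 / 4) fun h => ?_, sub_zero]
  · have := (hw h).1; norm_num at this
  · have := (hw h).2; norm_num at this

/-- The oscillatory integral `∫ φ(u) u^p exp(iYu^q) du` against a localized weight. -/
def oscInt (f : ℝ → ℝ) (L : ℝ) (p : ℂ) (Y q : ℝ) : ℂ :=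
  ∫ u in Ioi (0 : ℝ), (weight f L u : ℂ) * (u : ℂ) ^ p * exp (I * (Y * u ^ q : ℝ))

lemma continuousOn_cpow_Ioi (p : ℂ) : ContinuousOn (fun u : ℝ => (u : ℂ) ^ p) (Ioi 0) :=
  continuous_ofReal.continuousOn.cpow_const fun u hu => Or.inl (by simpa using hu)

lemma continuousOn_osc (Y q : ℝ) :
    ContinuousOn (fun u : ℝ => exp (I * (Y * u ^ q : ℝ))) (Ioi 0) := by
  have : ContinuousOn (fun u : ℝ => Y * u ^ q) (Ioi 0) :=
    continuousOn_const.mul (continuousOn_id.rpow_const fun u hu => Or.inl (ne_of_gt hu))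
  exact (continuous_exp.comp (continuous_const.mul continuous_ofReal)).comp_continuousOn this

lemma IsTest.continuousOn_oscInt {f : ℝ → ℝ} (h : IsTest f) (L : ℝ) (p : ℂ) (Y q : ℝ) :
    ContinuousOn (fun u : ℝ => (weight f L u : ℂ) * (u : ℂ) ^ p * exp (I * (Y * u ^ q : ℝ)))
      (Ioi 0) :=
  ((continuous_ofReal.comp (h.continuous_weight L)).continuousOn.mul
    (continuousOn_cpow_Ioi p)).mul (continuousOn_osc Y q)

/-- A function that is continuous on `(0, ∞)` and vanishes off the window is integrable. -/
lemma integrableOn_window {F : ℝ → ℂ} {L : ℝ} (hL : 2 ≤ L)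
    (h0 : ∀ u ∉ Icc (1 - 1 / L) (1 + 1 / L), F u = 0) (hc : ContinuousOn F (Ioi 0)) :
    IntegrableOn F (Ioi 0) := by
  have hsub : Icc (1 - 1 / L) (1 + 1 / L) ⊆ Ioi 0 := fun u hu =>
    lt_of_lt_of_le (by norm_num) (Icc_window_subset hL hu).1
  have h : IntegrableOn F (Icc (1 - 1 / L) (1 + 1 / L)) :=
    (hc.mono hsub).integrableOn_compact isCompact_Icc
  exact (h.integrable_of_forall_notMem_eq_zero h0).integrableOn

lemma IsTest.integrableOn_oscInt {f : ℝ → ℝ} (h : IsTest f) {L : ℝ} (hL : 2 ≤ L) (p : ℂ)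
    (Y q : ℝ) : IntegrableOn (fun u : ℝ => (weight f L u : ℂ) * (u : ℂ) ^ p *
      exp (I * (Y * u ^ q : ℝ))) (Ioi 0) :=
  integrableOn_window hL (fun u hu => by simp [h.weight_eq_zero (by linarith) hu])
    (h.continuousOn_oscInt L p Y q)

lemma hasDerivAt_cpow_Ioi {u : ℝ} (hu : 0 < u) (p : ℂ) :
    HasDerivAt (fun u : ℝ => (u : ℂ) ^ p) (p * (u : ℂ) ^ (p - 1)) u := by
  have h1 := (hasDerivAt_id (u : ℂ)).cpow_const (c := p) (Or.inl (by simpa using hu))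
  simpa using h1.comp_ofReal

/-- Integration by parts in an oscillatory integral. -/
lemma IsTest.oscInt_by_parts {f : ℝ → ℝ} (h : IsTest f) {L : ℝ} (hL : 2 ≤ L) (p : ℂ)
    (Y q : ℝ) : I * q * Y * oscInt f L p Y q =
      -(L * oscInt (_root_.deriv f) L (p + 1 - q) Y q + (p + 1 - q) * oscInt f L (p - q) Y q) := by
  have hL0 : 0 < L := by linarith
  have hzero := integral_deriv_window_eq_zero (L := L) hL
    (H := fun u : ℝ => (weight f L u : ℂ) * (u : ℂ) ^ (p + 1 - q) * exp (I * (Y * u ^ q : ℝ)))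
    (H' := fun u : ℝ => L * ((weight (_root_.deriv f) L u : ℂ) * (u : ℂ) ^ (p + 1 - q) *
        exp (I * (Y * u ^ q : ℝ))) +
      (p + 1 - q) * ((weight f L u : ℂ) * (u : ℂ) ^ (p - q) * exp (I * (Y * u ^ q : ℝ))) +
      I * q * Y * ((weight f L u : ℂ) * (u : ℂ) ^ p * exp (I * (Y * u ^ q : ℝ))))
    (fun u hu => by simp [h.weight_eq_zero hL0 hu])
    (fun u hu => by simp [h.weight_eq_zero hL0 hu, h.deriv.weight_eq_zero hL0 hu])
    (fun u hu => by
      have hu0 : (u : ℂ) ≠ 0 := by exact_mod_cast hu.ne'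
      have d1 := (h.hasDerivAt_weight L u).ofReal_comp
      have d2 := hasDerivAt_cpow_Ioi hu (p + 1 - q)
      have d3 : HasDerivAt (fun u : ℝ => exp (I * (Y * u ^ q : ℝ)))
          (exp (I * (Y * u ^ q : ℝ)) * (I * (Y * (q * u ^ (q - 1)) : ℝ))) u :=
        ((((Real.hasDerivAt_rpow_const (p := q) (Or.inl hu.ne')).const_mul Y).ofReal_comp).const_mul
          I).cexp
      refine ((d1.mul d2).mul d3).congr_deriv ?_
      have e1 : (u : ℂ) ^ p = (u : ℂ) ^ (p + 1 - q) * ((u ^ (q - 1) : ℝ) : ℂ) := by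
        rw [ofReal_cpow hu.le, ← cpow_add _ _ hu0]
        congr 1
        push_cast
        ring
      rw [e1, show p + 1 - q - 1 = p - q by ring]
      simp only [Pi.mul_apply]
      push_cast
      ring)
    (((continuousOn_const.mul (h.deriv.continuousOn_oscInt L _ Y q)).add
      (continuousOn_const.mul (h.continuousOn_oscInt L _ Y q))).add
      (continuousOn_const.mul (h.continuousOn_oscInt L _ Y q)))
  have i1 := (h.deriv.integrableOn_oscInt hL (p + 1 - q) Y q).const_mul (L : ℂ)
  have i2 := (h.integrableOn_oscInt hL (p - q) Y q).const_mul (p + 1 - q)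
  have i3 := (h.integrableOn_oscInt hL p Y q).const_mul (I * q * Y)
  have i12 : IntegrableOn (fun u : ℝ => L * ((weight (_root_.deriv f) L u : ℂ) *
      (u : ℂ) ^ (p + 1 - q) * exp (I * (Y * u ^ q : ℝ))) +
      (p + 1 - q) * ((weight f L u : ℂ) * (u : ℂ) ^ (p - q) * exp (I * (Y * u ^ q : ℝ))))
      (Ioi 0) := i1.add i2
  rw [integral_add i12 i3, integral_add i1 i2, integral_const_mul, integral_const_mul,
    integral_const_mul] at hzero
  unfold oscInt
  linear_combination hzero

/-- Repeated integration by parts: the oscillatory integral of frequency `Y` against a weight of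
width `1/L` is `O(L⁻¹ (L/Y)^N)` for every `N`. -/
lemma IsTest.exists_norm_oscInt_le (N : ℕ) {q : ℝ} (hq : 0 < q) : ∀ {f : ℝ → ℝ}, IsTest f → ∀ p : ℂ,
    ∃ C : ℝ, 0 ≤ C ∧ ∀ L Y : ℝ, 2 ≤ L → Y ≠ 0 →
      ‖oscInt f L p Y q‖ ≤ C * (L⁻¹ * (L / |Y|) ^ N) := by
  induction N with
  | zero =>
    intro f h p
    obtain ⟨M, hM, hf⟩ := h.exists_bound
    refine ⟨M * 2 ^ |p.re| * 2, by positivity, fun L Y hL hY => ?_⟩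
    have := norm_integral_window_le (L := L) (C := M * 2 ^ |p.re|) hL
      (F := fun u : ℝ => (weight f L u : ℂ) * (u : ℂ) ^ p * exp (I * (Y * u ^ q : ℝ)))
      (fun u hu => by simp [h.weight_eq_zero (by linarith) hu])
      (fun u hu => by
        rw [norm_mul, norm_mul, norm_real, mul_comm I, norm_exp_ofReal_mul_I, mul_one]
        exact mul_le_mul (hf _) (norm_cpow_le_of_mem (Icc_window_subset hL hu) p) (norm_nonneg _) hM)
    rw [pow_zero, mul_one, ← div_eq_mul_inv]
    exact this
  | succ N ih =>
    intro f h p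
    obtain ⟨C₁, hC₁, h₁⟩ := ih h.deriv (p + 1 - q)
    obtain ⟨C₂, hC₂, h₂⟩ := ih h (p - q)
    refine ⟨(C₁ + ‖p + 1 - q‖ * C₂) / q, by positivity, fun L Y hL hY => ?_⟩
    have hL0 : 0 < L := by linarith
    have hY0 : 0 < |Y| := abs_pos.mpr hY
    have hbp := congrArg norm (h.oscInt_by_parts hL p Y q)
    rw [norm_mul, norm_neg, norm_mul, norm_mul, norm_I, one_mul, norm_real, norm_real,
      Real.norm_of_nonneg hq.le, Real.norm_eq_abs] at hbp
    have hle : ‖L * oscInt (_root_.deriv f) L (p + 1 - q) Y q +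
        (p + 1 - q) * oscInt f L (p - q) Y q‖ ≤
        (C₁ + ‖p + 1 - q‖ * C₂) * (L * (L⁻¹ * (L / |Y|) ^ N)) := by
      refine (norm_add_le _ _).trans ?_
      rw [norm_mul, norm_mul, norm_real, Real.norm_of_nonneg hL0.le]
      have a1 := h₁ L Y hL hY
      have a2 := h₂ L Y hL hY
      set D := L⁻¹ * (L / |Y|) ^ N with hD
      have hD0 : 0 ≤ D := by positivity
      have b1 : L * ‖oscInt (_root_.deriv f) L (p + 1 - q) Y q‖ ≤ L * (C₁ * D) := by gcongr
      have b2 : ‖p + 1 - q‖ * ‖oscInt f L (p - q) Y q‖ ≤ ‖p + 1 - q‖ * (C₂ * D) := by gcongr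
      have b3 : ‖p + 1 - q‖ * (C₂ * D) ≤ L * (‖p + 1 - q‖ * (C₂ * D)) :=
        le_mul_of_one_le_left (by positivity) (by linarith)
      nlinarith
    rw [← hbp] at hle
    have hkey : ‖oscInt f L p Y q‖ = q * |Y| * ‖oscInt f L p Y q‖ / (q * |Y|) := by field_simp
    rw [hkey, div_le_iff₀ (by positivity)]
    refine hle.trans (le_of_eq ?_)
    rw [pow_succ]
    field_simp

/-- The Mellin transform of the localized weight. -/
def weightMellin (f : ℝ → ℝ) (L : ℝ) (s : ℂ) : ℂ := mellin (fun u => (weight f L u : ℂ)) s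

lemma IsTest.continuousOn_mellin {f : ℝ → ℝ} (h : IsTest f) (L : ℝ) (s : ℂ) :
    ContinuousOn (fun u : ℝ => (u : ℂ) ^ (s - 1) • (weight f L u : ℂ)) (Ioi 0) :=
  (continuousOn_cpow_Ioi _).smul (continuous_ofReal.comp (h.continuous_weight L)).continuousOn

lemma IsTest.mellinConvergent {f : ℝ → ℝ} (h : IsTest f) {L : ℝ} (hL : 2 ≤ L) (s : ℂ) :
    MellinConvergent (fun u => (weight f L u : ℂ)) s :=
  integrableOn_window hL (fun u hu => by simp [h.weight_eq_zero (by linarith) hu])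
    (h.continuousOn_mellin L s)

lemma IsTest.weightMellin_by_parts {f : ℝ → ℝ} (h : IsTest f) {L : ℝ} (hL : 2 ≤ L) (s : ℂ) :
    s * weightMellin f L s = -(L * weightMellin (_root_.deriv f) L (s + 1)) := by
  have hL0 : 0 < L := by linarith
  have hzero := integral_deriv_window_eq_zero (L := L) hL
    (H := fun u : ℝ => (weight f L u : ℂ) * (u : ℂ) ^ s)
    (H' := fun u : ℝ => L * ((u : ℂ) ^ (s + 1 - 1) • (weight (_root_.deriv f) L u : ℂ)) +
      s * ((u : ℂ) ^ (s - 1) • (weight f L u : ℂ)))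
    (fun u hu => by simp [h.weight_eq_zero hL0 hu])
    (fun u hu => by simp [h.weight_eq_zero hL0 hu, h.deriv.weight_eq_zero hL0 hu])
    (fun u hu => by
      refine ((h.hasDerivAt_weight L u).ofReal_comp.mul (hasDerivAt_cpow_Ioi hu s)).congr_deriv ?_
      simp only [smul_eq_mul, add_sub_cancel_right]
      push_cast
      ring)
    ((continuousOn_const.mul (h.deriv.continuousOn_mellin L _)).add
      (continuousOn_const.mul (h.continuousOn_mellin L _)))
  have i1 := (h.deriv.mellinConvergent hL (s + 1)).const_mul (L : ℂ)
  have i2 := (h.mellinConvergent hL s).const_mul s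
  rw [integral_add i1 i2, integral_const_mul, integral_const_mul] at hzero
  unfold weightMellin mellin
  linear_combination hzero

lemma IsTest.exists_norm_weightMellin_le_strip {f : ℝ → ℝ} (h : IsTest f) :
    ∃ M : ℝ, 0 ≤ M ∧ ∀ L : ℝ, 2 ≤ L → ∀ s : ℂ,
      ‖weightMellin f L s‖ ≤ M * 2 ^ |s.re - 1| * 2 / L := by
  obtain ⟨M, hM, hf⟩ := h.exists_bound
  refine ⟨M, hM, fun L hL s => norm_integral_window_le hL
    (fun u hu => by simp [h.weight_eq_zero (by linarith) hu]) fun u hu => ?_⟩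
  rw [norm_smul, mul_comm, norm_real]
  have := norm_cpow_le_of_mem (Icc_window_subset hL hu) (s - 1)
  rw [sub_re, one_re] at this
  exact mul_le_mul (hf _) this (norm_nonneg _) hM

/-- Repeated integration by parts: each one gains a factor `L/|t|`. -/
lemma IsTest.exists_pow_mul_norm_weightMellin_le (N : ℕ) : ∀ {f : ℝ → ℝ}, IsTest f → ∀ σ : ℝ,
    ∃ C : ℝ, 0 ≤ C ∧ ∀ L : ℝ, 2 ≤ L → ∀ t : ℝ,
      |t| ^ N * ‖weightMellin f L (σ + t * I)‖ ≤ C * (L⁻¹ * L ^ N) := by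
  induction N with
  | zero =>
    intro f h σ
    obtain ⟨M, hM, hf⟩ := h.exists_norm_weightMellin_le_strip
    refine ⟨M * 2 ^ |σ - 1| * 2, by positivity, fun L hL t => ?_⟩
    have := hf L hL (σ + t * I)
    simpa [div_eq_mul_inv] using this
  | succ N ih =>
    intro f h σ
    obtain ⟨C, hC, hb⟩ := ih h.deriv (σ + 1)
    refine ⟨C, hC, fun L hL t => ?_⟩
    have hL0 : 0 < L := by linarith
    have hbp := congrArg norm (h.weightMellin_by_parts hL (σ + t * I))
    rw [norm_mul, norm_neg, norm_mul, norm_real, Real.norm_of_nonneg hL0.le,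
      show (σ + t * I + 1 : ℂ) = ((σ + 1 : ℝ) : ℂ) + t * I by push_cast; ring] at hbp
    have ht : |t| ≤ ‖(σ : ℂ) + t * I‖ := by simpa using abs_im_le_norm ((σ : ℂ) + t * I)
    calc |t| ^ (N + 1) * ‖weightMellin f L (σ + t * I)‖
        = |t| ^ N * (|t| * ‖weightMellin f L (σ + t * I)‖) := by ring
      _ ≤ |t| ^ N * (‖(σ : ℂ) + t * I‖ * ‖weightMellin f L (σ + t * I)‖) := by gcongr
      _ = L * (|t| ^ N * ‖weightMellin (_root_.deriv f) L ((σ + 1 : ℝ) + t * I)‖) := by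
          rw [hbp]; ring
      _ ≤ L * (C * (L⁻¹ * L ^ N)) := mul_le_mul_of_nonneg_left (hb L hL t) hL0.le
      _ = _ := by ring

lemma IsTest.differentiable_weightMellin {f : ℝ → ℝ} (h : IsTest f) {L : ℝ} (hL : 2 ≤ L) :
    Differentiable ℂ (weightMellin f L) := by
  intro s
  have hw := Icc_window_subset hL
  refine mellin_differentiableAt_of_isBigO_rpow (a := s.re + 1) (b := s.re - 1) ?_ ?_ (by linarith)
    ?_ (by linarith)
  · exact (continuous_ofReal.comp (h.continuous_weight L)).locallyIntegrable.locallyIntegrableOn _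
  · refine (isBigO_zero _ _).congr' ?_ EventuallyEq.rfl
    filter_upwards [eventually_gt_atTop 2] with u hu
    rw [h.weight_eq_zero (by linarith) fun h' => ?_, ofReal_zero]
    linarith [(hw h').2]
  · refine (isBigO_zero _ _).congr' ?_ EventuallyEq.rfl
    filter_upwards [mem_nhdsWithin_of_mem_nhds (Iio_mem_nhds (show (0 : ℝ) < 1 / 4 by norm_num))]
      with u hu
    rw [h.weight_eq_zero (by linarith) fun h' => ?_, ofReal_zero]
    have := (hw h').1
    rw [mem_Iio] at hu
    linarith

lemma IsTest.continuous_weightMellin_line {f : ℝ → ℝ} (h : IsTest f) {L : ℝ} (hL : 2 ≤ L) (σ : ℝ) :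
    Continuous fun t : ℝ => weightMellin f L (σ + t * I) :=
  (h.differentiable_weightMellin hL).continuous.comp (by fun_prop)

/-- The Mellin transform of a weight of width `1/L` has size `L⁻¹` for `|t| ≤ L` and decays rapidly
beyond; hence its moments. -/
lemma IsTest.exists_moment_le {f : ℝ → ℝ} (h : IsTest f) (σ : ℝ) {e : ℝ} (he : 0 ≤ e) :
    ∃ C : ℝ, 0 ≤ C ∧ ∀ L : ℝ, 2 ≤ L →
      Integrable (fun t : ℝ => (1 + |t|) ^ e * ‖weightMellin f L (σ + t * I)‖) ∧
      ∫ t : ℝ, (1 + |t|) ^ e * ‖weightMellin f L (σ + t * I)‖ ≤ C * L ^ e := by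
  obtain ⟨N, hN⟩ := exists_nat_ge (e + 2)
  obtain ⟨C₀, hC₀, h₀⟩ := IsTest.exists_pow_mul_norm_weightMellin_le 0 h σ
  obtain ⟨C₁, hC₁, h₁⟩ := IsTest.exists_pow_mul_norm_weightMellin_le N h σ
  have hint : Integrable fun r : ℝ => (1 + ‖r‖) ^ (-2 : ℝ) :=
    integrable_one_add_norm (by norm_num)
  refine ⟨2 ^ N * (C₀ + C₁) * ∫ r : ℝ, (1 + ‖r‖) ^ (-2 : ℝ), by positivity, fun L hL => ?_⟩
  have hL0 : 0 < L := by linarith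
  have hpt : ∀ t : ℝ, (1 + |t|) ^ e * ‖weightMellin f L (σ + t * I)‖ ≤
      2 ^ N * (C₀ + C₁) * L ^ e * L⁻¹ * (1 + ‖t / L‖) ^ (-2 : ℝ) := by
    intro t
    set m := ‖weightMellin f L (σ + t * I)‖ with hm
    have hm0 : 0 ≤ m := norm_nonneg _
    set r := |t| / L with hr
    have hr0 : 0 ≤ r := by positivity
    have hrn : ‖t / L‖ = r := by rw [norm_div, Real.norm_eq_abs, Real.norm_of_nonneg hL0.le]
    have a0 : m ≤ C₀ * L⁻¹ := by simpa using h₀ L hL t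
    have a1 : r ^ N * m ≤ C₁ * L⁻¹ := by
      have := h₁ L hL t
      rw [hr, div_pow, div_mul_eq_mul_div, div_le_iff₀ (by positivity)]
      linarith
    have a2 : (1 + r) ^ N * m ≤ 2 ^ N * (C₀ + C₁) * L⁻¹ := by
      have hb : (1 + r) ^ N ≤ 2 ^ N * (1 + r ^ N) := by
        rcases le_total r 1 with h' | h'
        · calc (1 + r) ^ N ≤ 2 ^ N := by gcongr; linarith
            _ ≤ _ := le_mul_of_one_le_right (by positivity) (by linarith [pow_nonneg hr0 N])
        · calc (1 + r) ^ N ≤ (2 * r) ^ N := by gcongr; linarith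
            _ = 2 ^ N * r ^ N := mul_pow _ _ _
            _ ≤ _ := by gcongr; linarith
      calc (1 + r) ^ N * m ≤ 2 ^ N * (1 + r ^ N) * m := by gcongr
        _ = 2 ^ N * (m + r ^ N * m) := by ring
        _ ≤ 2 ^ N * (C₀ * L⁻¹ + C₁ * L⁻¹) := by gcongr
        _ = _ := by ring
    have a3 : (1 + |t|) ^ e ≤ L ^ e * (1 + r) ^ e := by
      rw [← Real.mul_rpow hL0.le (by positivity)]
      apply Real.rpow_le_rpow (by positivity) _ he
      rw [hr]
      field_simp
      linarith
    have a4 : (1 + r) ^ e ≤ (1 + r) ^ N * (1 + r) ^ (-2 : ℝ) := by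
      rw [← Real.rpow_natCast, ← Real.rpow_add (by positivity)]
      apply Real.rpow_le_rpow_of_exponent_le (by linarith)
      linarith
    rw [hrn]
    calc (1 + |t|) ^ e * m ≤ L ^ e * ((1 + r) ^ N * (1 + r) ^ (-2 : ℝ)) * m := by
          gcongr
          exact a3.trans (by gcongr)
      _ = L ^ e * (1 + r) ^ (-2 : ℝ) * ((1 + r) ^ N * m) := by ring
      _ ≤ L ^ e * (1 + r) ^ (-2 : ℝ) * (2 ^ N * (C₀ + C₁) * L⁻¹) := by gcongr
      _ = _ := by ring
  have hg : Integrable fun t : ℝ => 2 ^ N * (C₀ + C₁) * L ^ e * L⁻¹ * (1 + ‖t / L‖) ^ (-2 : ℝ) :=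
    (hint.comp_div hL0.ne').const_mul _
  have hi : Integrable fun t : ℝ => (1 + |t|) ^ e * ‖weightMellin f L (σ + t * I)‖ := by
    refine hg.mono' ?_ (Eventually.of_forall fun t => ?_)
    · refine Continuous.aestronglyMeasurable (Continuous.mul ?_
        (h.continuous_weightMellin_line hL σ).norm)
      exact (by fun_prop : Continuous fun t : ℝ => 1 + |t|).rpow_const
        fun t => Or.inr he
    · rw [Real.norm_of_nonneg (by positivity)]
      exact hpt t
  refine ⟨hi, (integral_mono hi hg hpt).trans (le_of_eq ?_)⟩
  rw [integral_const_mul, Measure.integral_comp_div (fun r : ℝ => (1 + ‖r‖) ^ (-2 : ℝ)),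
    abs_of_pos hL0, smul_eq_mul]
  field_simp

lemma IsTest.integrable_weightMellin {f : ℝ → ℝ} (h : IsTest f) {L : ℝ} (hL : 2 ≤ L) (σ : ℝ) :
    Integrable fun t : ℝ => weightMellin f L (σ + t * I) := by
  obtain ⟨C, -, hC⟩ := h.exists_moment_le σ le_rfl
  have := (hC L hL).1
  simp only [Real.rpow_zero, one_mul] at this
  exact (integrable_norm_iff (h.continuous_weightMellin_line hL σ).aestronglyMeasurable).mp this

/-- Mellin inversion for the localized weight. -/
lemma IsTest.weight_eq_integral {f : ℝ → ℝ} (h : IsTest f) {L : ℝ} (hL : 2 ≤ L) (σ : ℝ) {u : ℝ}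
    (hu : 0 < u) : (weight f L u : ℂ) =
      1 / (2 * Real.pi) * ∫ t : ℝ, (u : ℂ) ^ (-(σ + t * I : ℂ)) * weightMellin f L (σ + t * I) := by
  have := mellinInv_mellin_eq σ (fun u => (weight f L u : ℂ)) hu (h.mellinConvergent hL σ)
    (h.integrable_weightMellin hL σ)
    (continuous_ofReal.comp (h.continuous_weight L)).continuousAt
  rw [← this, mellinInv, real_smul]
  push_cast
  rfl

/-! ### Mellin–Barnes integrals of gamma functions against a localized weight -/

lemma one_sub_line (c t : ℝ) : (1 - (c + t * I) : ℂ) = ((1 - c : ℝ) : ℂ) + ((-t : ℝ) : ℂ) * I := by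
  push_cast
  ring

lemma IsTest.continuous_weightMellin_dual {f : ℝ → ℝ} (h : IsTest f) {L : ℝ} (hL : 2 ≤ L) (c : ℝ) :
    Continuous fun t : ℝ => weightMellin f L (1 - (c + t * I)) :=
  (h.differentiable_weightMellin hL).continuous.comp (by fun_prop)

/-- The moments of the Mellin transform on the line reflected in `s ↦ 1 - s`. -/
lemma IsTest.exists_moment_dual_le {f : ℝ → ℝ} (h : IsTest f) (c : ℝ) {e : ℝ} (he : 0 ≤ e) :
    ∃ C : ℝ, 0 ≤ C ∧ ∀ L : ℝ, 2 ≤ L →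
      Integrable (fun t : ℝ => (1 + |t|) ^ e * ‖weightMellin f L (1 - (c + t * I))‖) ∧
      ∫ t : ℝ, (1 + |t|) ^ e * ‖weightMellin f L (1 - (c + t * I))‖ ≤ C * L ^ e := by
  obtain ⟨C, hC, hb⟩ := h.exists_moment_le (1 - c) he
  refine ⟨C, hC, fun L hL => ?_⟩
  obtain ⟨h1, h2⟩ := hb L hL
  have e1 : (fun t : ℝ => (1 + |t|) ^ e * ‖weightMellin f L (1 - (c + t * I))‖) =
      fun t : ℝ => (fun t : ℝ => (1 + |t|) ^ e *
        ‖weightMellin f L ((1 - c : ℝ) + t * I)‖) (-t) := by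
    ext t
    simp only [abs_neg, one_sub_line]
  rw [e1]
  exact ⟨h1.comp_neg, (integral_neg_eq_self (fun t : ℝ => (1 + |t|) ^ e *
        ‖weightMellin f L ((1 - c : ℝ) + t * I)‖) volume).le.trans h2⟩

lemma IsTest.integrable_weightMellin_dual {f : ℝ → ℝ} (h : IsTest f) {L : ℝ} (hL : 2 ≤ L) (c : ℝ) :
    Integrable fun t : ℝ => weightMellin f L (1 - (c + t * I)) := by
  have := (h.integrable_weightMellin hL (1 - c)).comp_neg
  simpa only [one_sub_line] using this

/-- Mellin inversion, in the dual variable. -/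
lemma IsTest.weight_eq_integral_dual {f : ℝ → ℝ} (h : IsTest f) {L : ℝ} (hL : 2 ≤ L) (c : ℝ) {u : ℝ}
    (hu : 0 < u) : (weight f L u : ℂ) =
      1 / (2 * Real.pi) * ∫ t : ℝ, (u : ℂ) ^ (c + t * I - 1 : ℂ) *
        weightMellin f L (1 - (c + t * I)) := by
  rw [h.weight_eq_integral hL (1 - c) hu, ← integral_neg_eq_self]
  congr 2
  ext t
  rw [one_sub_line]
  congr 2
  push_cast
  ring

/-- Gamma integrals with a complex rate, by analytic continuation from real rates. -/
lemma integral_cpow_mul_exp_neg_complex {w z : ℂ} (hw : 0 < w.re) (hz : 0 < z.re) :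
    ∫ t in Ioi (0 : ℝ), (t : ℂ) ^ (w - 1) * exp (-(z * t)) = (1 / z) ^ w * Gamma w := by
  have hint : ∀ {v b : ℝ}, -1 < v → 0 < b →
      IntegrableOn (fun t : ℝ => t ^ v * Real.exp (-b * t)) (Ioi 0) := by
    intro v b hv hb
    simpa using integrableOn_rpow_mul_exp_neg_mul_rpow hv one_pos hb
  have hmeas : ∀ z : ℂ, AEStronglyMeasurable (fun t : ℝ => (t : ℂ) ^ (w - 1) * exp (-(z * t)))
      (volume.restrict (Ioi 0)) := fun z =>
    ((continuousOn_cpow_Ioi _).mul (by fun_prop)).aestronglyMeasurable measurableSet_Ioi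
  set G : ℂ → ℂ := fun z => ∫ t in Ioi (0 : ℝ), (t : ℂ) ^ (w - 1) * exp (-(z * t)) with hG
  have hopen : IsOpen {z : ℂ | 0 < z.re} := isOpen_lt continuous_const continuous_re
  have hGd : DifferentiableOn ℂ G {z : ℂ | 0 < z.re} := by
    intro z₀ hz₀
    have hz₀' : 0 < z₀.re := hz₀
    refine DifferentiableAt.differentiableWithinAt ?_
    have hs : {z : ℂ | z₀.re / 2 < z.re} ∈ 𝓝 z₀ :=
      (isOpen_lt continuous_const continuous_re).mem_nhds
        (show z₀.re / 2 < z₀.re by linarith)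
    have hnorm : ∀ (z : ℂ) (t : ℝ), t ∈ Ioi (0 : ℝ) → z₀.re / 2 < z.re →
        ‖(t : ℂ) ^ (w - 1) * exp (-(z * t))‖ ≤
          t ^ (w.re - 1) * Real.exp (-(z₀.re / 2) * t) := by
      intro z t ht hz
      have ht0 : (0 : ℝ) < t := ht
      rw [norm_mul, norm_cpow_eq_rpow_re_of_pos ht0, norm_exp, sub_re, one_re, neg_re,
        re_mul_ofReal, ← neg_mul]
      gcongr
    have hd := hasDerivAt_integral_of_dominated_loc_of_deriv_le (𝕜 := ℂ)
      (μ := volume.restrict (Ioi (0 : ℝ)))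
      (F := fun z t => (t : ℂ) ^ (w - 1) * exp (-(z * t)))
      (F' := fun z t => (t : ℂ) ^ (w - 1) * (exp (-(z * t)) * -t))
      (bound := fun t : ℝ => t ^ w.re * Real.exp (-(z₀.re / 2) * t)) hs
      (Eventually.of_forall hmeas)
      ((hint (v := w.re - 1) (b := z₀.re / 2) (by linarith) (by linarith)).mono' (hmeas z₀)
        ((ae_restrict_iff' measurableSet_Ioi).mpr (Eventually.of_forall fun t ht =>
          hnorm z₀ t ht (by linarith))))
      (((continuousOn_cpow_Ioi _).mul (by fun_prop)).aestronglyMeasurable measurableSet_Ioi)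
      ((ae_restrict_iff' measurableSet_Ioi).mpr (Eventually.of_forall fun t ht z hz => by
        have ht0 : (0 : ℝ) < t := ht
        have h1 := hnorm z t ht hz
        rw [← mul_assoc, norm_mul, norm_neg, norm_real, Real.norm_of_nonneg ht0.le]
        calc _ ≤ t ^ (w.re - 1) * Real.exp (-(z₀.re / 2) * t) * t := by gcongr
          _ = t ^ (w.re - 1) * t * Real.exp (-(z₀.re / 2) * t) := by ring
          _ = _ := by rw [← Real.rpow_add_one ht0.ne', sub_add_cancel]))
      (hint (by linarith) (by linarith))
      (Eventually.of_forall fun t z hz => by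
        have : HasDerivAt (fun z : ℂ => -(z * t)) (-t : ℂ) z := by
          simpa using ((hasDerivAt_id z).mul_const (t : ℂ)).fun_neg
        exact this.cexp.const_mul _)
    exact hd.2.differentiableAt
  have hRd : DifferentiableOn ℂ (fun z : ℂ => (1 / z) ^ w * Gamma w) {z : ℂ | 0 < z.re} := by
    intro z₀ hz₀
    have hz₀' : 0 < z₀.re := hz₀
    have hne : z₀ ≠ 0 := by rintro rfl; simp at hz₀'
    have hsl : 1 / z₀ ∈ slitPlane := by
      left
      rw [one_div, inv_re]
      exact div_pos hz₀' (normSq_pos.mpr hne)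
    refine DifferentiableAt.differentiableWithinAt (DifferentiableAt.mul_const ?_ _)
    exact ((differentiableAt_const _).div differentiableAt_id hne).cpow_const hsl
  have hconv : IsPreconnected {z : ℂ | 0 < z.re} :=
    (convex_halfSpace_re_gt 0).isPreconnected
  refine (hGd.analyticOnNhd hopen).eqOn_of_preconnected_of_frequently_eq
    (hRd.analyticOnNhd hopen) hconv (z₀ := 1) (by simp) ?_ hz
  have hseq : Tendsto (fun r : ℝ => (r : ℂ)) (𝓝[>] 1) (𝓝[≠] 1) := by
    refine tendsto_nhdsWithin_iff.mpr ⟨?_, ?_⟩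
    · have := (continuous_ofReal.tendsto 1).mono_left (nhdsWithin_le_nhds (s := Ioi 1))
      simpa using this
    · filter_upwards [self_mem_nhdsWithin] with r hr
      have hr' : (1 : ℝ) < r := hr
      simpa using hr'.ne'
  refine hseq.frequently (Eventually.frequently ?_)
  filter_upwards [self_mem_nhdsWithin] with r hr
  exact Complex.integral_cpow_mul_exp_neg_mul_Ioi hw (lt_trans one_pos hr)

/-- The function `u^a exp(-z u^{1/m})`, whose Mellin transform is a gamma function. -/
def expKernel (m : ℝ) (a z : ℂ) (u : ℝ) : ℂ := (u : ℂ) ^ a * exp (-(z * (u ^ (1 / m) : ℝ)))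

lemma mellin_expKernel {m : ℝ} (hm : 0 < m) {a z s : ℂ} (hz : 0 < z.re) (hs : 0 < (m * (s + a)).re) :
    mellin (expKernel m a z) s = m * ((1 / z) ^ (m * (s + a)) * Gamma (m * (s + a))) := by
  have e1 : expKernel m a z = fun u : ℝ => (u : ℂ) ^ a •
      (fun u : ℝ => (fun r : ℝ => exp (-(z * r))) (u ^ (1 / m))) u := by
    ext u
    rw [expKernel, smul_eq_mul]
  have hm' : (m : ℂ) ≠ 0 := by exact_mod_cast hm.ne'
  rw [e1, mellin_cpow_smul, mellin_comp_rpow (fun r : ℝ => exp (-(z * r))),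
    abs_of_pos (by positivity), real_smul]
  have e2 : (s + a) / ((1 / m : ℝ) : ℂ) = m * (s + a) := by
    push_cast
    field_simp
  rw [e2, mellin]
  simp only [smul_eq_mul]
  rw [integral_cpow_mul_exp_neg_complex hs hz]
  push_cast
  rw [one_div, inv_inv]

lemma continuousOn_expKernel (m : ℝ) (a z : ℂ) : ContinuousOn (expKernel m a z) (Ioi 0) := by
  have : ContinuousOn (fun u : ℝ => u ^ (1 / m)) (Ioi 0) :=
    continuousOn_id.rpow_const fun u hu => Or.inl (ne_of_gt hu)
  exact (continuousOn_cpow_Ioi a).mul ((continuous_exp.comp ((continuous_const.mul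
    continuous_ofReal).neg)).comp_continuousOn this)

lemma mellinConvergent_expKernel {m : ℝ} (hm : 0 < m) {a z s : ℂ} (hz : 0 < z.re)
    (hs : 0 < (m * (s + a)).re) : MellinConvergent (expKernel m a z) s := by
  have e1 : expKernel m a z = fun u : ℝ => (u : ℂ) ^ a •
      (fun u : ℝ => (fun r : ℝ => exp (-(z * r))) (u ^ (1 / m))) u := by
    ext u
    rw [expKernel, smul_eq_mul]
  have hm' : (m : ℂ) ≠ 0 := by exact_mod_cast hm.ne'
  have e2 : (s + a) / ((1 / m : ℝ) : ℂ) = m * (s + a) := by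
    push_cast
    field_simp
  rw [e1, MellinConvergent.cpow_smul, MellinConvergent.comp_rpow
    (f := fun r : ℝ => exp (-(z * r))) (by positivity), e2]
  have hcz : Continuous fun r : ℝ => exp (-(z * r)) := by fun_prop
  refine mellinConvergent_of_isBigO_rpow_exp (a := z.re) (b := 0) hz
    (hcz.locallyIntegrable.locallyIntegrableOn _) ?_ ?_ hs
  · refine IsBigO.of_bound 1 (Eventually.of_forall fun r => ?_)
    rw [norm_exp, Real.norm_of_nonneg (Real.exp_pos _).le, one_mul]
    simp
  · simp only [neg_zero, Real.rpow_zero]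
    exact ((hcz.tendsto 0).mono_left nhdsWithin_le_nhds).isBigO_one ℝ

lemma cpow_line_eq {u : ℝ} (hu : 0 < u) (c t : ℝ) (b : ℂ) :
    (u : ℂ) ^ (c + t * I + b) = (u : ℂ) ^ ((c : ℂ) + b) * exp (((t * Real.log u : ℝ) : ℂ) * I) := by
  have hu0 : (u : ℂ) ≠ 0 := by exact_mod_cast hu.ne'
  rw [show (c + t * I + b : ℂ) = (c + b) + t * I by ring, cpow_add _ _ hu0,
    cpow_def_of_ne_zero hu0 (t * I), ← ofReal_log hu.le]
  congr 2
  push_cast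
  ring

/-- Parseval's formula for the weight against `expKernel`. -/
lemma IsTest.integral_weight_mul_expKernel {f : ℝ → ℝ} (h : IsTest f) {L : ℝ} (hL : 2 ≤ L)
    {m c : ℝ} (hm : 0 < m) {a z : ℂ} (hz : 0 < z.re) (hc : 0 < m * (c + a.re)) :
    ∫ u in Ioi (0 : ℝ), (weight f L u : ℂ) * expKernel m a z u =
      1 / (2 * Real.pi) * ∫ t : ℝ, weightMellin f L (1 - (c + t * I)) *
        (m * ((1 / z) ^ (m * (c + t * I + a)) * Gamma (m * (c + t * I + a)))) := by
  have hconv : IntegrableOn (fun u : ℝ => (u : ℂ) ^ ((c : ℂ) - 1) * expKernel m a z u) (Ioi 0) :=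
    mellinConvergent_expKernel (s := c) hm hz (by simpa using hc)
  have hw := h.integrable_weightMellin_dual hL c
  have hprod := hconv.mul_prod hw
  set F : ℝ → ℝ → ℂ := fun u t => exp (((t * Real.log u : ℝ) : ℂ) * I) *
    (((u : ℂ) ^ ((c : ℂ) - 1) * expKernel m a z u) * weightMellin f L (1 - (c + t * I))) with hF
  have hFi : Integrable (Function.uncurry F) ((volume.restrict (Ioi 0)).prod volume) := by
    refine hprod.bdd_mul (c := 1) (f := fun p : ℝ × ℝ => exp (((p.2 * Real.log p.1 : ℝ) : ℂ) * I))
      ?_ ?_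
    · refine Measurable.aestronglyMeasurable ?_
      have : Measurable fun p : ℝ × ℝ => p.2 * Real.log p.1 :=
        measurable_snd.mul (Real.measurable_log.comp measurable_fst)
      exact measurable_exp.comp ((measurable_ofReal.comp this).mul_const I)
    · exact Eventually.of_forall fun p => (norm_exp_ofReal_mul_I _).le
  have hswap := integral_integral_swap hFi
  have hL1 : ∫ u in Ioi (0 : ℝ), (weight f L u : ℂ) * expKernel m a z u =
      ∫ u in Ioi (0 : ℝ), 1 / (2 * Real.pi) * ∫ t : ℝ, F u t := by
    refine setIntegral_congr_fun measurableSet_Ioi fun u hu => ?_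
    rw [h.weight_eq_integral_dual hL c hu, mul_assoc, ← integral_mul_const]
    congr 2
    ext t
    rw [sub_eq_add_neg, cpow_line_eq hu, hF, ← sub_eq_add_neg (c : ℂ) 1]
    ring
  rw [hL1, integral_const_mul, hswap]
  congr 2
  ext t
  rw [← mellin_expKernel hm hz (by simpa using hc), mellin, ← integral_const_mul]
  refine setIntegral_congr_fun measurableSet_Ioi fun u hu => ?_
  simp only [hF]
  rw [sub_eq_add_neg (_ + _), cpow_line_eq hu, smul_eq_mul, ← sub_eq_add_neg (c : ℂ) 1]
  ring

lemma exists_norm_Gamma_linear_le {m c : ℝ} {a : ℂ} (hc : 0 < m * (c + a.re)) :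
    ∃ K : ℝ, 0 < K ∧ ∀ t : ℝ, ‖Gamma (m * (c + t * I + a))‖ *
      Real.exp (Real.pi / 2 * |(m * (c + t * I + a) : ℂ).im|) ≤
        K * (1 + |t|) ^ (m * (c + a.re)) := by
  obtain ⟨K, hK, hb⟩ := exists_norm_Gamma_le hc
  set M := 1 + |m| + |m * a.im|
  refine ⟨K * M ^ (m * (c + a.re)), by positivity, fun t => ?_⟩
  set y := m * t + m * a.im with hy
  have hw : (m * (c + t * I + a) : ℂ) = ((m * (c + a.re) : ℝ) : ℂ) + (y : ℂ) * I := by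
    apply Complex.ext <;> simp [hy]
    ring
  have him : (m * (c + t * I + a) : ℂ).im = y := by rw [hw]; simp
  rw [him, hw]
  refine (hb y).trans ?_
  rw [mul_assoc, ← Real.mul_rpow (by positivity) (by positivity)]
  gcongr
  calc (1 + |y|) ^ (m * (c + a.re) - 1 / 2) ≤ (1 + |y|) ^ (m * (c + a.re)) := by
        apply Real.rpow_le_rpow_of_exponent_le
        · linarith [abs_nonneg y]
        · linarith
    _ ≤ _ := by
        gcongr
        exact one_add_abs_linear_le _ _ _

lemma continuous_Gamma_linear {m c : ℝ} {a : ℂ} (hc : 0 < m * (c + a.re)) :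
    Continuous fun t : ℝ => Gamma (m * (c + t * I + a)) := by
  have := (continuous_Gamma_line hc).comp (f := fun t : ℝ => m * t + m * a.im) (by fun_prop)
  refine this.congr fun t => ?_
  simp only [Function.comp]
  congr 1
  apply Complex.ext <;> simp
  ring

/-- The boundary case of `integral_weight_mul_expKernel`: the parameter `z` tends to `∓i` and the
exponential becomes oscillatory. -/
lemma IsTest.oscInt_eq_integral_Gamma {f : ℝ → ℝ} (h : IsTest f) {L : ℝ} (hL : 2 ≤ L)
    {m c : ℝ} (hm : 0 < m) {a : ℂ} (hc : 0 < m * (c + a.re)) {Y : ℝ} (hY : 0 < Y) {ε : ℝ}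
    (hε : |ε| = 1) :
    oscInt f L a (ε * Y) (1 / m) =
      1 / (2 * Real.pi) * ∫ t : ℝ, weightMellin f L (1 - (c + t * I)) *
        (m * (exp (ε * (Real.pi / 2) * I * (m * (c + t * I + a))) *
          (Y : ℂ) ^ (-(m * (c + t * I + a))) * Gamma (m * (c + t * I + a)))) := by
  have hpi := Real.pi_pos
  have hY0 : (Y : ℂ) ≠ 0 := by exact_mod_cast hY.ne'
  -- `Z r` runs along the circle of radius `Y` and reaches the imaginary axis at `r = 1`
  set Z : ℝ → ℂ := fun r => Y * exp (-(r * ε * (Real.pi / 2) : ℝ) * I) with hZ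
  have hZre : ∀ r ∈ Ioo (0 : ℝ) 1, 0 < (Z r).re := by
    intro r hr
    have habs : |r * ε * (Real.pi / 2)| < Real.pi / 2 := by
      rw [abs_mul, abs_mul, hε, abs_of_pos hr.1, abs_of_pos (by positivity)]
      nlinarith [hr.2]
    have : (Z r).re = Y * Real.cos (r * ε * (Real.pi / 2)) := by
      rw [hZ]
      simp only
      rw [re_ofReal_mul, ← ofReal_neg, exp_ofReal_mul_I_re, Real.cos_neg]
    rw [this]
    exact mul_pos hY (Real.cos_pos_of_mem_Ioo (abs_lt.mp habs))
  have hZpow : ∀ r ∈ Ioo (0 : ℝ) 1, ∀ w : ℂ, (1 / Z r) ^ w =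
      exp ((r * ε * (Real.pi / 2) : ℝ) * I * w) * (Y : ℂ) ^ (-w) := by
    intro r hr w
    have habs : |r * ε * (Real.pi / 2)| < Real.pi := by
      rw [abs_mul, abs_mul, hε, abs_of_pos hr.1, abs_of_pos (by positivity)]
      nlinarith [hr.2]
    have e1 : 1 / Z r = ((Y⁻¹ : ℝ) : ℂ) * exp ((r * ε * (Real.pi / 2) : ℝ) * I) := by
      rw [hZ]
      simp only
      rw [neg_mul, exp_neg]
      push_cast
      field_simp
    have hlog : log (1 / Z r) = -Real.log Y + (r * ε * (Real.pi / 2) : ℝ) * I := by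
      rw [e1, log_ofReal_mul (by positivity) (exp_ne_zero _), log_exp, Real.log_inv]
      · push_cast; rfl
      · simpa using (abs_lt.mp habs).1
      · simpa using (abs_lt.mp habs).2.le
    have hne : 1 / Z r ≠ 0 := by
      rw [e1]
      exact mul_ne_zero (by exact_mod_cast (inv_pos.mpr hY).ne') (exp_ne_zero _)
    rw [cpow_def_of_ne_zero hne, hlog, cpow_def_of_ne_zero hY0, ← ofReal_log hY.le, ← exp_add]
    congr 1
    ring
  have hfil : ∀ᶠ r : ℝ in 𝓝[<] 1, r ∈ Ioo (0 : ℝ) 1 := Ioo_mem_nhdsLT one_pos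
  -- the left-hand sides converge
  have hlhs : Tendsto (fun r : ℝ => ∫ u in Ioi (0 : ℝ), (weight f L u : ℂ) * expKernel m a (Z r) u)
      (𝓝[<] 1) (𝓝 (oscInt f L a (ε * Y) (1 / m))) := by
    have hint := (h.integrableOn_oscInt hL a 0 0).norm
    refine tendsto_integral_filter_of_dominated_convergence _ ?_ ?_ hint ?_
    · refine Eventually.of_forall fun r => ?_
      exact ((continuous_ofReal.comp (h.continuous_weight L)).continuousOn.mul
        (continuousOn_expKernel m a (Z r))).aestronglyMeasurable measurableSet_Ioi
    · filter_upwards [hfil] with r hr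
      refine (ae_restrict_iff' measurableSet_Ioi).mpr (Eventually.of_forall fun u hu => ?_)
      have hu0 : (0 : ℝ) < u := hu
      have : ‖exp (-(Z r * (u ^ (1 / m) : ℝ)))‖ ≤ 1 := by
        rw [norm_exp, Real.exp_le_one_iff, neg_re, re_mul_ofReal]
        have := hZre r hr
        have : 0 ≤ (Z r).re * u ^ (1 / m) := by positivity
        linarith
      simp only [expKernel, norm_mul, zero_mul, ofReal_zero, mul_zero, exp_zero, mul_one]
      rw [← mul_assoc]
      exact mul_le_of_le_one_right (by positivity) this
    · refine Eventually.of_forall fun u => ?_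
      have hct : Continuous fun r : ℝ => (weight f L u : ℂ) * expKernel m a (Z r) u := by
        simp only [hZ, expKernel]
        fun_prop
      have := (hct.tendsto 1).mono_left (nhdsWithin_le_nhds (s := Iio 1))
      convert! this using 2
      rw [expKernel, ← mul_assoc]
      congr 2
      have hεI : exp (-(1 * ε * (Real.pi / 2) : ℝ) * I) = -(ε * I) := by
        rcases (abs_eq (by norm_num : (0 : ℝ) ≤ 1)).mp hε with rfl | rfl
        · rw [show (-(1 * 1 * (Real.pi / 2) : ℝ) * I : ℂ) = -(Real.pi / 2 * I) by push_cast; ring,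
            exp_neg, exp_pi_div_two_mul_I, inv_I]
          simp
        · rw [show (-(1 * -1 * (Real.pi / 2) : ℝ) * I : ℂ) = (Real.pi / 2 * I) by push_cast; ring,
            exp_pi_div_two_mul_I]
          simp
      simp only [hZ, hεI]
      push_cast
      ring
  -- the right-hand sides converge
  obtain ⟨K, hK, hb⟩ := exists_norm_Gamma_linear_le hc
  have hrhs : Tendsto (fun r : ℝ => ∫ t : ℝ, weightMellin f L (1 - (c + t * I)) *
        (m * ((1 / Z r) ^ (m * (c + t * I + a)) * Gamma (m * (c + t * I + a)))))
      (𝓝[<] 1) (𝓝 (∫ t : ℝ, weightMellin f L (1 - (c + t * I)) *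
        (m * (exp (ε * (Real.pi / 2) * I * (m * (c + t * I + a))) *
          (Y : ℂ) ^ (-(m * (c + t * I + a))) * Gamma (m * (c + t * I + a)))))) := by
    obtain ⟨C, -, hC⟩ := h.exists_moment_dual_le c hc.le
    have hdom := ((hC L hL).1).const_mul (m * Y ^ (-(m * (c + a.re))) * K)
    have hYc : Continuous fun t : ℝ => (Y : ℂ) ^ (-(m * (c + t * I + a))) := by
      simp only [cpow_def_of_ne_zero hY0]
      fun_prop
    have hYn : ∀ t : ℝ, ‖(Y : ℂ) ^ (-(m * (c + t * I + a)))‖ = Y ^ (-(m * (c + a.re))) := by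
      intro t
      rw [norm_cpow_eq_rpow_re_of_pos hY]
      simp
    refine tendsto_integral_filter_of_dominated_convergence _ ?_ ?_ hdom ?_
    · filter_upwards [hfil] with r hr
      refine Continuous.aestronglyMeasurable ?_
      simp only [hZpow r hr]
      exact (h.continuous_weightMellin_dual hL c).mul (continuous_const.mul
        (((by fun_prop : Continuous fun t : ℝ => exp (((r * ε * (Real.pi / 2) : ℝ) : ℂ) * I *
          (m * (c + t * I + a)))).mul hYc).mul (continuous_Gamma_linear hc)))
    · filter_upwards [hfil] with r hr
      refine Eventually.of_forall fun t => ?_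
      rw [hZpow r hr, norm_mul, norm_mul, norm_mul, norm_mul, hYn, norm_real,
        Real.norm_of_nonneg hm.le]
      have hexp : ‖exp (((r * ε * (Real.pi / 2) : ℝ) : ℂ) * I * (m * (c + t * I + a)))‖ ≤
          Real.exp (Real.pi / 2 * |(m * (c + t * I + a) : ℂ).im|) := by
        rw [norm_exp]
        apply Real.exp_le_exp.mpr
        generalize (m * (c + t * I + a) : ℂ) = w
        rw [mul_assoc, re_ofReal_mul, I_mul_re]
        refine (le_abs_self _).trans ?_
        rw [abs_mul, abs_mul, abs_mul, hε, abs_of_pos hr.1, abs_neg, abs_of_pos (by positivity)]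
        gcongr
        nlinarith [hr.2]
      have hbt := hb t
      calc _ ≤ ‖weightMellin f L (1 - (c + t * I))‖ * (m *
            (Real.exp (Real.pi / 2 * |(m * (c + t * I + a) : ℂ).im|) * Y ^ (-(m * (c + a.re))) *
              ‖Gamma (m * (c + t * I + a))‖)) := by gcongr
        _ = ‖weightMellin f L (1 - (c + t * I))‖ * m * Y ^ (-(m * (c + a.re))) *
            (‖Gamma (m * (c + t * I + a))‖ *
              Real.exp (Real.pi / 2 * |(m * (c + t * I + a) : ℂ).im|)) := by ring
        _ ≤ ‖weightMellin f L (1 - (c + t * I))‖ * m * Y ^ (-(m * (c + a.re))) *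
            (K * (1 + |t|) ^ (m * (c + a.re))) := by gcongr
        _ = _ := by ring
    · refine Eventually.of_forall fun t => ?_
      have hct : Continuous fun r : ℝ => weightMellin f L (1 - (c + t * I)) *
        (m * (exp ((r * ε * (Real.pi / 2) : ℝ) * I * (m * (c + t * I + a))) *
          (Y : ℂ) ^ (-(m * (c + t * I + a))) * Gamma (m * (c + t * I + a)))) := by
        fun_prop
      have := (hct.tendsto 1).mono_left (nhdsWithin_le_nhds (s := Iio 1))
      refine (this.congr' ?_).trans (le_of_eq ?_)
      · filter_upwards [hfil] with r hr
        rw [hZpow r hr]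
      · push_cast
        rw [one_mul]
  refine tendsto_nhds_unique hlhs ((hrhs.const_mul (1 / (2 * Real.pi) : ℂ)).congr' ?_)
  filter_upwards [hfil] with r hr
  exact (h.integral_weight_mul_expKernel hL hm (hZre r hr) hc).symm

/-- The cosine integral `∫ φ(u) u^a cos(Yu^q + kπ) du`. -/
def cosInt (f : ℝ → ℝ) (L : ℝ) (a k : ℂ) (Y q : ℝ) : ℂ :=
  ∫ u in Ioi (0 : ℝ), (weight f L u : ℂ) * (u : ℂ) ^ a * cos ((Y * u ^ q : ℝ) + k * Real.pi)

lemma IsTest.cosInt_eq {f : ℝ → ℝ} (h : IsTest f) {L : ℝ} (hL : 2 ≤ L) (a k : ℂ) (Y q : ℝ) :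
    cosInt f L a k Y q = exp (I * (k * Real.pi)) / 2 * oscInt f L a Y q +
      exp (-(I * (k * Real.pi))) / 2 * oscInt f L a (-Y) q := by
  have i1 := (h.integrableOn_oscInt hL a Y q).const_mul (exp (I * (k * Real.pi)) / 2)
  have i2 := (h.integrableOn_oscInt hL a (-Y) q).const_mul (exp (-(I * (k * Real.pi))) / 2)
  rw [oscInt, oscInt, ← integral_const_mul, ← integral_const_mul, ← integral_add i1 i2, cosInt]
  congr 1
  ext u
  rw [Complex.cos, add_mul, exp_add, neg_add, add_mul, exp_add]
  push_cast
  ring_nf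

lemma IsTest.exists_norm_cosInt_le (N : ℕ) {q : ℝ} (hq : 0 < q) {f : ℝ → ℝ} (h : IsTest f)
    (a k : ℂ) : ∃ C : ℝ, 0 ≤ C ∧ ∀ L Y : ℝ, 2 ≤ L → 0 < Y →
      ‖cosInt f L a k Y q‖ ≤ C * (L⁻¹ * (L / Y) ^ N) := by
  obtain ⟨C, hC, hb⟩ := IsTest.exists_norm_oscInt_le N hq h a
  refine ⟨‖exp (I * (k * Real.pi)) / 2‖ * C + ‖exp (-(I * (k * Real.pi))) / 2‖ * C, by positivity,
    fun L Y hL hY => ?_⟩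
  rw [h.cosInt_eq hL]
  have h1 := hb L Y hL hY.ne'
  have h2 := hb L (-Y) hL (neg_ne_zero.mpr hY.ne')
  rw [abs_neg] at h2
  rw [abs_of_pos hY] at h1 h2
  refine (norm_add_le _ _).trans ?_
  rw [norm_mul, norm_mul, add_mul, mul_assoc, mul_assoc]
  gcongr

/-- The gamma–cosine product `Γ(w) cos(π(w/2 + k))` at `w = m(s + a)`. -/
def gammaCos (m : ℝ) (a k s : ℂ) : ℂ :=
  Gamma (m * (s + a)) * cos (Real.pi * (m * (s + a) / 2 + k))

lemma IsTest.integrable_Gamma_exp {f : ℝ → ℝ} (h : IsTest f) {L : ℝ} (hL : 2 ≤ L)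
    {m c : ℝ} {a : ℂ} (hc : 0 < m * (c + a.re)) {Y : ℝ} (hY : 0 < Y) {ε : ℝ}
    (hε : |ε| = 1) : Integrable fun t : ℝ => weightMellin f L (1 - (c + t * I)) *
        (m * (exp (ε * (Real.pi / 2) * I * (m * (c + t * I + a))) *
          (Y : ℂ) ^ (-(m * (c + t * I + a))) * Gamma (m * (c + t * I + a)))) := by
  have hpi := Real.pi_pos
  have hY0 : (Y : ℂ) ≠ 0 := by exact_mod_cast hY.ne'
  obtain ⟨K, hK, hb⟩ := exists_norm_Gamma_linear_le hc
  obtain ⟨C, -, hC⟩ := h.exists_moment_dual_le c hc.le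
  have hdom := ((hC L hL).1).const_mul (|m| * Y ^ (-(m * (c + a.re))) * K)
  have hYc : Continuous fun t : ℝ => (Y : ℂ) ^ (-(m * (c + t * I + a))) := by
    simp only [cpow_def_of_ne_zero hY0]
    fun_prop
  have hYn : ∀ t : ℝ, ‖(Y : ℂ) ^ (-(m * (c + t * I + a)))‖ = Y ^ (-(m * (c + a.re))) := by
    intro t
    rw [norm_cpow_eq_rpow_re_of_pos hY]
    simp
  refine hdom.mono' ?_ (Eventually.of_forall fun t => ?_)
  · refine Continuous.aestronglyMeasurable ?_
    exact (h.continuous_weightMellin_dual hL c).mul (continuous_const.mul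
        (((by fun_prop : Continuous fun t : ℝ => exp (ε * (Real.pi / 2) * I *
          (m * (c + t * I + a)))).mul hYc).mul (continuous_Gamma_linear hc)))
  · rw [norm_mul, norm_mul, norm_mul, norm_mul, hYn, norm_real, Real.norm_eq_abs]
    have hexp : ‖exp (ε * (Real.pi / 2) * I * (m * (c + t * I + a)))‖ ≤
        Real.exp (Real.pi / 2 * |(m * (c + t * I + a) : ℂ).im|) := by
      rw [norm_exp]
      apply Real.exp_le_exp.mpr
      generalize (m * (c + t * I + a) : ℂ) = w
      rw [show (ε * (Real.pi / 2) : ℂ) = ((ε * (Real.pi / 2) : ℝ) : ℂ) by push_cast; rfl,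
        mul_assoc, re_ofReal_mul, I_mul_re]
      refine (le_abs_self _).trans ?_
      rw [abs_mul, abs_mul, hε, abs_neg, abs_of_pos (by positivity), one_mul]
    have hbt := hb t
    calc _ ≤ ‖weightMellin f L (1 - (c + t * I))‖ * (|m| *
          (Real.exp (Real.pi / 2 * |(m * (c + t * I + a) : ℂ).im|) * Y ^ (-(m * (c + a.re))) *
            ‖Gamma (m * (c + t * I + a))‖)) := by gcongr
      _ = ‖weightMellin f L (1 - (c + t * I))‖ * |m| * Y ^ (-(m * (c + a.re))) *
          (‖Gamma (m * (c + t * I + a))‖ *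
            Real.exp (Real.pi / 2 * |(m * (c + t * I + a) : ℂ).im|)) := by ring
      _ ≤ ‖weightMellin f L (1 - (c + t * I))‖ * |m| * Y ^ (-(m * (c + a.re))) *
          (K * (1 + |t|) ^ (m * (c + a.re))) := by gcongr
      _ = _ := by ring

/-- The Mellin–Barnes integral of `Γ(w) cos(π(w/2 + k))` against the weight is a cosine integral. -/
lemma IsTest.integral_gammaCos {f : ℝ → ℝ} (h : IsTest f) {L : ℝ} (hL : 2 ≤ L)
    {m c : ℝ} (hm : 0 < m) {a : ℂ} (hc : 0 < m * (c + a.re)) (k : ℂ) {y : ℝ} (hy : 0 < y) :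
    Integrable (fun t : ℝ => weightMellin f L (1 - (c + t * I)) *
        ((y : ℂ) ^ (-(c + t * I : ℂ)) * gammaCos m a k (c + t * I))) ∧
    1 / (2 * Real.pi) * ∫ t : ℝ, weightMellin f L (1 - (c + t * I)) *
        ((y : ℂ) ^ (-(c + t * I : ℂ)) * gammaCos m a k (c + t * I)) =
      1 / m * (y : ℂ) ^ a * cosInt f L a k (y ^ (1 / m)) (1 / m) := by
  have hm' : (m : ℂ) ≠ 0 := by exact_mod_cast hm.ne'
  have hy0 : (y : ℂ) ≠ 0 := by exact_mod_cast hy.ne'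
  have hY : 0 < y ^ (1 / m) := by positivity
  have hpow : ∀ s : ℂ, ((y ^ (1 / m) : ℝ) : ℂ) ^ (-(m * (s + a))) =
      (y : ℂ) ^ (-s) * (y : ℂ) ^ (-a) := by
    intro s
    rw [← cpow_add _ _ hy0, cpow_def_of_ne_zero (by exact_mod_cast hY.ne'),
      cpow_def_of_ne_zero hy0, ← ofReal_log hY.le, ← ofReal_log hy.le, Real.log_rpow hy]
    congr 1
    push_cast
    field_simp
    ring
  have i1 := (h.integrable_Gamma_exp hL hc hY (ε := 1) (by simp)).const_mul
    (exp (I * (k * Real.pi)) / 2)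
  have i2 := (h.integrable_Gamma_exp hL hc hY (ε := -1) (by simp)).const_mul
    (exp (-(I * (k * Real.pi))) / 2)
  have o1 := h.oscInt_eq_integral_Gamma hL hm hc hY (ε := 1) (by simp)
  have o2 := h.oscInt_eq_integral_Gamma hL hm hc hY (ε := -1) (by simp)
  rw [one_mul] at o1
  rw [neg_one_mul] at o2
  rw [h.cosInt_eq hL, o1, o2]
  have key := integral_add i1 i2
  rw [integral_const_mul, integral_const_mul] at key
  have hexp : ∀ t : ℝ, weightMellin f L (1 - (c + t * I)) *
        ((y : ℂ) ^ (-(c + t * I : ℂ)) * gammaCos m a k (c + t * I)) =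
      1 / m * (y : ℂ) ^ a * (exp (I * (k * Real.pi)) / 2 * (weightMellin f L (1 - (c + t * I)) *
        (m * (exp ((1 : ℝ) * (Real.pi / 2) * I * (m * (c + t * I + a))) *
          ((y ^ (1 / m) : ℝ) : ℂ) ^ (-(m * (c + t * I + a))) * Gamma (m * (c + t * I + a))))) +
      exp (-(I * (k * Real.pi))) / 2 * (weightMellin f L (1 - (c + t * I)) *
        (m * (exp ((-1 : ℝ) * (Real.pi / 2) * I * (m * (c + t * I + a))) *
          ((y ^ (1 / m) : ℝ) : ℂ) ^ (-(m * (c + t * I + a))) *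
            Gamma (m * (c + t * I + a)))))) := by
    intro t
    generalize (c + t * I : ℂ) = s
    have hya : (y : ℂ) ^ a * (y : ℂ) ^ (-a) = 1 := by
      rw [← cpow_add _ _ hy0, add_neg_cancel, cpow_zero]
    rw [hpow, gammaCos, Complex.cos]
    have e1 : exp (Real.pi * (m * (s + a) / 2 + k) * I) = exp (I * (k * Real.pi)) *
        exp ((1 : ℝ) * (Real.pi / 2) * I * (m * (s + a))) := by
      rw [← exp_add]
      congr 1
      push_cast
      ring
    have e2 : exp (-(Real.pi * (m * (s + a) / 2 + k)) * I) = exp (-(I * (k * Real.pi))) *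
        exp ((-1 : ℝ) * (Real.pi / 2) * I * (m * (s + a))) := by
      rw [← exp_add]
      congr 1
      push_cast
      ring
    rw [e1, e2]
    generalize exp ((1 : ℝ) * (Real.pi / 2) * I * (m * (s + a))) = E1
    generalize exp ((-1 : ℝ) * (Real.pi / 2) * I * (m * (s + a))) = E2
    generalize exp (I * (k * Real.pi)) = E3
    generalize exp (-(I * (k * Real.pi))) = E4
    generalize (y : ℂ) ^ a = ya at *
    generalize (y : ℂ) ^ (-a) = yb at *
    field_simp
    linear_combination (-(weightMellin f L (1 - s) * (y : ℂ) ^ (-s) * Gamma (m * (s + a)) *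
      (E3 * E1 + E4 * E2))) * hya
  simp only [hexp]
  refine ⟨(i1.add i2).const_mul _, ?_⟩
  rw [integral_const_mul, key]
  ring

/-! ### Shifting a contour past finitely many poles -/

/-- The integral over the boundary of the rectangle `[a, b] × [-T, T]`, anticlockwise. -/
def rectIntegral (f : ℂ → ℂ) (a b T : ℝ) : ℂ :=
  (∫ x in a..b, f (x + (-T : ℝ) * I)) - (∫ x in a..b, f (x + T * I)) +
    I * (∫ y in (-T)..T, f (b + y * I)) - I * ∫ y in (-T)..T, f (a + y * I)

/-- The union of the four lines that carry the sides of the rectangle `[a, b] × [-T, T]`. -/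
def frame (a b T : ℝ) : Set ℂ := {s | s.re = a ∨ s.re = b ∨ s.im = T ∨ s.im = -T}

lemma frame_left (a b T y : ℝ) : (a + y * I : ℂ) ∈ frame a b T := by simp [frame]

lemma frame_right (a b T y : ℝ) : (b + y * I : ℂ) ∈ frame a b T := by simp [frame]

lemma frame_top (a b T x : ℝ) : (x + T * I : ℂ) ∈ frame a b T := by simp [frame]

lemma frame_bot (a b T x : ℝ) : (x + (-T : ℝ) * I : ℂ) ∈ frame a b T := by simp [frame]

section RectangleIntegral

variable {a b T R : ℝ} {f g : ℂ → ℂ}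

lemma continuous_left (hf : ContinuousOn f (frame a b T)) : Continuous fun y : ℝ => f (a + y * I) :=
  hf.comp_continuous (by fun_prop) (frame_left a b T)

lemma continuous_right (hf : ContinuousOn f (frame a b T)) :
    Continuous fun y : ℝ => f (b + y * I) :=
  hf.comp_continuous (by fun_prop) (frame_right a b T)

lemma continuous_top (hf : ContinuousOn f (frame a b T)) : Continuous fun x : ℝ => f (x + T * I) :=
  hf.comp_continuous (by fun_prop) (frame_top a b T)

lemma continuous_bot (hf : ContinuousOn f (frame a b T)) :
    Continuous fun x : ℝ => f (x + (-T : ℝ) * I) :=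
  hf.comp_continuous (by fun_prop) (frame_bot a b T)

lemma rectIntegral_add (hf : ContinuousOn f (frame a b T)) (hg : ContinuousOn g (frame a b T)) :
    rectIntegral (fun s => f s + g s) a b T = rectIntegral f a b T + rectIntegral g a b T := by
  simp only [rectIntegral]
  rw [intervalIntegral.integral_add ((continuous_bot hf).intervalIntegrable _ _)
      ((continuous_bot hg).intervalIntegrable _ _),
    intervalIntegral.integral_add ((continuous_top hf).intervalIntegrable _ _)
      ((continuous_top hg).intervalIntegrable _ _),
    intervalIntegral.integral_add ((continuous_right hf).intervalIntegrable _ _)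
      ((continuous_right hg).intervalIntegrable _ _),
    intervalIntegral.integral_add ((continuous_left hf).intervalIntegrable _ _)
      ((continuous_left hg).intervalIntegrable _ _)]
  ring

lemma rectIntegral_const_mul (c : ℂ) (f : ℂ → ℂ) :
    rectIntegral (fun s => c * f s) a b T = c * rectIntegral f a b T := by
  simp only [rectIntegral, intervalIntegral.integral_const_mul]
  ring

lemma rectIntegral_congr (h : EqOn f g (frame a b T)) :
    rectIntegral f a b T = rectIntegral g a b T := by
  simp only [rectIntegral, h (frame_left a b T _), h (frame_right a b T _),
    h (frame_top a b T _), h (frame_bot a b T _)]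

lemma rectIntegral_eq_zero_of_differentiable (hf : Differentiable ℂ f) :
    rectIntegral f a b T = 0 := by
  have := integral_boundary_rect_eq_zero_of_differentiableOn f (a + (-T : ℝ) * I) (b + T * I)
    hf.differentiableOn
  simpa [rectIntegral] using this

/-- The rectangle integral of a function with a primitive near the sides. -/
lemma rectIntegral_eq_zero_of_hasDerivAt {P : ℂ → ℂ} (hf : ContinuousOn f (frame a b T))
    (hP : ∀ s ∈ frame a b T, HasDerivAt P (f s) s) : rectIntegral f a b T = 0 := by
  have hh : ∀ y : ℝ, (∀ x : ℝ, (x + y * I : ℂ) ∈ frame a b T) →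
      (Continuous fun x : ℝ => f (x + y * I)) →
      ∫ x in a..b, f (x + y * I) = P (b + y * I) - P (a + y * I) := by
    intro y hy hc
    refine intervalIntegral.integral_eq_sub_of_hasDerivAt (f := fun x : ℝ => P (x + y * I))
      (fun x _ => ?_) (hc.intervalIntegrable _ _)
    have h1 : HasDerivAt (fun x : ℂ => x + y * I) 1 (x : ℂ) := (hasDerivAt_id _).add_const _
    have h2 := (HasDerivAt.comp (x : ℂ) (hP _ (hy x)) h1).comp_ofReal
    simpa using h2
  have hv : ∀ x : ℝ, (∀ y : ℝ, (x + y * I : ℂ) ∈ frame a b T) →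
      (Continuous fun y : ℝ => f (x + y * I)) →
      I * ∫ y in (-T)..T, f (x + y * I) = P (x + T * I) - P (x + (-T : ℝ) * I) := by
    intro x hx hc
    rw [← intervalIntegral.integral_const_mul]
    refine intervalIntegral.integral_eq_sub_of_hasDerivAt (f := fun y : ℝ => P (x + y * I))
      (fun y _ => ?_) ((continuous_const.mul hc).intervalIntegrable _ _)
    have h1 : HasDerivAt (fun y : ℂ => x + y * I) I (y : ℂ) := by
      simpa using ((hasDerivAt_id (y : ℂ)).mul_const I).const_add (x : ℂ)
    have h2 := (HasDerivAt.comp (y : ℂ) (hP _ (hx y)) h1).comp_ofReal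
    rw [mul_comm] at h2
    exact h2
  rw [rectIntegral, hh _ (frame_bot a b T) (continuous_bot hf),
    hh _ (frame_top a b T) (continuous_top hf), hv _ (frame_right a b T) (continuous_right hf),
    hv _ (frame_left a b T) (continuous_left hf)]
  ring

lemma log_sub_log_neg_of_im_pos {z : ℂ} (hz : 0 < z.im) : log z - log (-z) = Real.pi * I := by
  rw [log, log, norm_neg, arg_neg_eq_arg_sub_pi_of_im_pos hz]
  push_cast
  ring

lemma sub_ne_zero_of_frame {p s : ℂ} (ha : a < p.re) (hb : p.re < b) (hT : |p.im| < T)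
    (hs : s ∈ frame a b T) : s - p ≠ 0 := by
  intro h
  rw [sub_eq_zero] at h
  rw [h] at hs
  have := abs_lt.mp hT
  rcases hs with h | h | h | h <;> linarith

/-- The winding number of a rectangle about an interior point. -/
lemma rectIntegral_inv {p : ℂ} (ha : a < p.re) (hb : p.re < b) (hT : |p.im| < T) :
    rectIntegral (fun s => (s - p)⁻¹) a b T = 2 * Real.pi * I := by
  have hT' := abs_lt.mp hT
  have hc : ContinuousOn (fun s => (s - p)⁻¹) (frame a b T) :=
    ContinuousOn.inv₀ (by fun_prop) fun s hs => sub_ne_zero_of_frame ha hb hT hs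
  have hlog : ∀ s : ℂ, s - p ∈ slitPlane → HasDerivAt (fun s => log (s - p)) (s - p)⁻¹ s := by
    intro s hs
    simpa using ((hasDerivAt_id s).sub_const p).clog hs
  have hh : ∀ y : ℝ, (∀ x : ℝ, (x + y * I : ℂ) - p ∈ slitPlane) →
      (Continuous fun x : ℝ => (x + y * I - p : ℂ)⁻¹) →
      ∫ x in a..b, (x + y * I - p : ℂ)⁻¹ = log (b + y * I - p) - log (a + y * I - p) := by
    intro y hy hc
    refine intervalIntegral.integral_eq_sub_of_hasDerivAt (f := fun x : ℝ => log (x + y * I - p))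
      (fun x _ => ?_) (hc.intervalIntegrable _ _)
    have h1 : HasDerivAt (fun x : ℂ => x + y * I) 1 (x : ℂ) := (hasDerivAt_id _).add_const _
    have h2 := (HasDerivAt.comp (x : ℂ) (hlog _ (hy x)) h1).comp_ofReal
    simpa using h2
  have e1 := hh (-T) (fun x => Or.inr (by simp; linarith)) (continuous_bot hc)
  have e2 := hh T (fun x => Or.inr (by simp; linarith)) (continuous_top hc)
  have e3 : I * ∫ y in (-T)..T, (b + y * I - p : ℂ)⁻¹ =
      log (b + T * I - p) - log (b + (-T : ℝ) * I - p) := by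
    rw [← intervalIntegral.integral_const_mul]
    refine intervalIntegral.integral_eq_sub_of_hasDerivAt (f := fun y : ℝ => log (b + y * I - p))
      (fun y _ => ?_) ((continuous_const.mul (continuous_right hc)).intervalIntegrable _ _)
    have h1 : HasDerivAt (fun y : ℂ => (b : ℂ) + y * I) I (y : ℂ) := by
      simpa using ((hasDerivAt_id (y : ℂ)).mul_const I).const_add (b : ℂ)
    have h2 := (HasDerivAt.comp (y : ℂ)
      (hlog _ (Or.inl (by simp; linarith))) h1).comp_ofReal
    rw [mul_comm] at h2
    exact h2
  -- the left side crosses the cut of `log (s - p)`, so `log (p - s)` is used there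
  have e4 : I * ∫ y in (-T)..T, (a + y * I - p : ℂ)⁻¹ =
      log (-(a + T * I - p)) - log (-(a + (-T : ℝ) * I - p)) := by
    rw [← intervalIntegral.integral_const_mul]
    refine intervalIntegral.integral_eq_sub_of_hasDerivAt (f := fun y : ℝ => log (-(a + y * I - p)))
      (fun y _ => ?_) ((continuous_const.mul (continuous_left hc)).intervalIntegrable _ _)
    have h1 : HasDerivAt (fun y : ℂ => -((a : ℂ) + y * I - p)) (-I) (y : ℂ) := by
      simpa using ((((hasDerivAt_id (y : ℂ)).mul_const I).const_add (a : ℂ)).sub_const p).fun_neg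
    have h2 := (h1.clog (Or.inl (by simp; linarith))).comp_ofReal
    refine h2.congr_deriv ?_
    rw [neg_div_neg_eq, div_eq_mul_inv]
  rw [rectIntegral, e1, e2, e3, e4]
  have l1 := log_sub_log_neg_of_im_pos (z := a + T * I - p) (by simp; linarith)
  have l2 := log_sub_log_neg_of_im_pos (z := -(a + (-T : ℝ) * I - p)) (by simp; linarith)
  rw [neg_neg] at l2
  linear_combination l1 + l2

/-- The product `∏ (s - p)` over a multiset of points. -/
def rootProd (m : Multiset ℂ) (s : ℂ) : ℂ := (m.map fun p => s - p).prod

lemma rootProd_cons (p : ℂ) (m : Multiset ℂ) (s : ℂ) :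
    rootProd (p ::ₘ m) s = (s - p) * rootProd m s := by simp [rootProd]

lemma rootProd_ne_zero {m : Multiset ℂ} {s : ℂ} (h : s ∉ m) : rootProd m s ≠ 0 := by
  rw [rootProd]
  refine Multiset.prod_ne_zero fun h0 => ?_
  obtain ⟨p, hp, hp0⟩ := Multiset.mem_map.mp h0
  rw [sub_eq_zero] at hp0
  exact h (hp0 ▸ hp)

lemma differentiable_rootProd (m : Multiset ℂ) : Differentiable ℂ (rootProd m) := by
  induction m using Multiset.induction_on with
  | empty =>
    have : rootProd 0 = fun _ => (1 : ℂ) := by ext s; simp [rootProd]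
    rw [this]
    fun_prop
  | cons p m ih =>
    have : rootProd (p ::ₘ m) = fun s => (s - p) * rootProd m s := by
      ext s; exact rootProd_cons p m s
    rw [this]
    fun_prop

/-- The points inside both the rectangle and the circle. -/
def insideBoth (a b T R : ℝ) (p : ℂ) : Prop := a < p.re ∧ p.re < b ∧ |p.im| < T ∧ ‖p‖ < R

lemma notMem_of_frame {m : Multiset ℂ} (hm : ∀ p ∈ m, insideBoth a b T R p) {s : ℂ}
    (hs : s ∈ frame a b T ∪ Metric.sphere 0 R) : s ∉ m := by
  intro h
  obtain ⟨h1, h2, h3, h4⟩ := hm s h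
  rcases hs with hs | hs
  · exact sub_ne_zero_of_frame h1 h2 h3 hs (sub_self s)
  · rw [mem_sphere_zero_iff_norm] at hs
    linarith

lemma continuousOn_div_rootProd {m : Multiset ℂ} (hm : ∀ p ∈ m, insideBoth a b T R p)
    {G : ℂ → ℂ} (hG : Continuous G) :
    ContinuousOn (fun s => G s / rootProd m s) (frame a b T ∪ Metric.sphere 0 R) :=
  hG.continuousOn.div (differentiable_rootProd m).continuous.continuousOn
    fun _ hs => rootProd_ne_zero (notMem_of_frame hm hs)

lemma circleIntegral_eq_zero_of_differentiable (hR : 0 < R) (hf : Differentiable ℂ f) :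
    ∮ s in C(0, R), f s = 0 :=
  (hf.diffContOnCl (s := Metric.ball 0 R)).circleIntegral_eq_zero hR.le

/-- Partial fractions: the two contours agree on the inverse of a polynomial with roots inside
both. -/
lemma rectIntegral_inv_rootProd (hR : 0 < R) (n : ℕ) : ∀ m : Multiset ℂ, Multiset.card m = n →
    (∀ p ∈ m, insideBoth a b T R p) →
    rectIntegral (fun s => 1 / rootProd m s) a b T = ∮ s in C(0, R), 1 / rootProd m s := by
  induction n using Nat.strong_induction_on with
  | _ n ih =>
  intro m hmn hm
  rcases Multiset.empty_or_exists_mem m with rfl | ⟨p, hp⟩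
  · have : (fun s => 1 / rootProd 0 s) = fun _ => (1 : ℂ) := by ext s; simp [rootProd]
    rw [this, rectIntegral_eq_zero_of_differentiable (by fun_prop),
      circleIntegral_eq_zero_of_differentiable hR (by fun_prop)]
  obtain ⟨h1, h2, h3, h4⟩ := hm p hp
  by_cases hall : ∀ q ∈ m, q = p
  · obtain ⟨k, hk⟩ : ∃ k, n = k + 1 := Nat.exists_eq_succ_of_ne_zero fun h0 => by
      rw [h0, Multiset.card_eq_zero] at hmn
      rw [hmn] at hp
      simp at hp
    have hrep : m = Multiset.replicate (k + 1) p := Multiset.eq_replicate.mpr ⟨hmn.trans hk, hall⟩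
    have hfun : (fun s => 1 / rootProd m s) = fun s => ((s - p) ^ (k + 1))⁻¹ := by
      ext s
      rw [hrep, rootProd, Multiset.map_replicate, Multiset.prod_replicate, one_div]
    rw [hfun]
    rcases k with _ | k
    · simp only [zero_add, pow_one]
      rw [rectIntegral_inv h1 h2 h3, circleIntegral.integral_sub_inv_of_mem_ball
        (by simpa using h4)]
    · have hz : (fun s : ℂ => ((s - p) ^ (k + 1 + 1))⁻¹) = fun s => (s - p) ^ (-(k + 2 : ℤ)) := by
        ext s
        rw [zpow_neg]
        norm_cast
      rw [rectIntegral_eq_zero_of_hasDerivAt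
        (P := fun s => -((k + 1 : ℂ)⁻¹ * ((s - p) ^ (k + 1))⁻¹)), hz,
        circleIntegral.integral_sub_zpow_of_ne (by omega)]
      · exact ContinuousOn.inv₀ (by fun_prop) fun s hs =>
          pow_ne_zero _ (sub_ne_zero_of_frame h1 h2 h3 hs)
      · intro s hs
        have hne := sub_ne_zero_of_frame h1 h2 h3 hs
        have hd := ((((hasDerivAt_id s).sub_const p).fun_pow (k + 1)).fun_inv
          (pow_ne_zero (k + 1) hne)).const_mul ((k + 1 : ℂ)⁻¹) |>.fun_neg
        refine hd.congr_deriv ?_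
        have hk1 : (k + 1 : ℂ) ≠ 0 := by exact_mod_cast Nat.succ_ne_zero k
        simp only [id]
        push_cast
        field_simp
        ring
  · push Not at hall
    obtain ⟨q, hq, hqp⟩ := hall
    obtain ⟨m₁, rfl⟩ := Multiset.exists_cons_of_mem hp
    obtain ⟨m₂, rfl⟩ := Multiset.exists_cons_of_mem
      ((Multiset.mem_cons.mp hq).resolve_left hqp)
    rw [Multiset.card_cons, Multiset.card_cons] at hmn
    -- two distinct roots: `(p - q)/((s - p)(s - q)) = 1/(s - p) - 1/(s - q)`
    have hpq : p - q ≠ 0 := sub_ne_zero.mpr (Ne.symm hqp)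
    have hmp : ∀ r ∈ p ::ₘ m₂, insideBoth a b T R r := fun r hr => by
      rcases Multiset.mem_cons.mp hr with h | h
      · exact hm r (h ▸ hp)
      · exact hm r (Multiset.mem_cons_of_mem (Multiset.mem_cons_of_mem h))
    have hmq : ∀ r ∈ q ::ₘ m₂, insideBoth a b T R r := fun r hr =>
      hm r (Multiset.mem_cons_of_mem hr)
    have hEq : EqOn (fun s => 1 / rootProd (p ::ₘ q ::ₘ m₂) s)
        (fun s => (p - q)⁻¹ * (1 / rootProd (p ::ₘ m₂) s) +
          -(p - q)⁻¹ * (1 / rootProd (q ::ₘ m₂) s)) (frame a b T ∪ Metric.sphere 0 R) := by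
      intro s hs
      have hn := notMem_of_frame hm hs
      simp only [Multiset.mem_cons, not_or] at hn
      have n1 : s - p ≠ 0 := sub_ne_zero.mpr hn.1
      have n2 : s - q ≠ 0 := sub_ne_zero.mpr hn.2.1
      have n3 := rootProd_ne_zero hn.2.2
      simp only [rootProd_cons]
      field_simp
      ring
    have c1 : ContinuousOn (fun s => (p - q)⁻¹ * (1 / rootProd (p ::ₘ m₂) s))
        (frame a b T ∪ Metric.sphere 0 R) :=
      continuousOn_const.mul (continuousOn_div_rootProd hmp continuous_const)
    have c2 : ContinuousOn (fun s => -(p - q)⁻¹ * (1 / rootProd (q ::ₘ m₂) s))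
        (frame a b T ∪ Metric.sphere 0 R) :=
      continuousOn_const.mul (continuousOn_div_rootProd hmq continuous_const)
    have i1 := ih (Multiset.card m₂ + 1) (by omega) (p ::ₘ m₂) (Multiset.card_cons _ _) hmp
    have i2 := ih (Multiset.card m₂ + 1) (by omega) (q ::ₘ m₂) (Multiset.card_cons _ _) hmq
    rw [rectIntegral_congr (hEq.mono subset_union_left), rectIntegral_add
        (c1.mono subset_union_left) (c2.mono subset_union_left),
      rectIntegral_const_mul, rectIntegral_const_mul, i1, i2,
      circleIntegral.integral_congr hR.le (hEq.mono subset_union_right),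
      circleIntegral.integral_add
        (ContinuousOn.circleIntegrable hR.le (c1.mono subset_union_right))
        (ContinuousOn.circleIntegrable hR.le (c2.mono subset_union_right)),
      circleIntegral.integral_const_mul, circleIntegral.integral_const_mul]

/-- The two contours agree on meromorphic functions with finitely many poles, all inside both. -/
lemma rectIntegral_div_rootProd (hR : 0 < R) (m : Multiset ℂ) :
    (∀ p ∈ m, insideBoth a b T R p) → ∀ G : ℂ → ℂ, Differentiable ℂ G →
    rectIntegral (fun s => G s / rootProd m s) a b T = ∮ s in C(0, R), G s / rootProd m s := by
  induction m using Multiset.induction_on with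
  | empty =>
    intro _ G hG
    have : (fun s => G s / rootProd 0 s) = G := by ext s; simp [rootProd]
    rw [this, rectIntegral_eq_zero_of_differentiable hG,
      circleIntegral_eq_zero_of_differentiable hR hG]
  | cons p m ih =>
    intro hm G hG
    have hm' : ∀ r ∈ m, insideBoth a b T R r := fun r hr => hm r (Multiset.mem_cons_of_mem hr)
    have hd : Differentiable ℂ (dslope G p) := by
      rw [← differentiableOn_univ, differentiableOn_dslope univ_mem]
      exact hG.differentiableOn
    have hEq : EqOn (fun s => G s / rootProd (p ::ₘ m) s)
        (fun s => G p * (1 / rootProd (p ::ₘ m) s) + dslope G p s / rootProd m s)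
        (frame a b T ∪ Metric.sphere 0 R) := by
      intro s hs
      have hn := notMem_of_frame hm hs
      simp only [Multiset.mem_cons, not_or] at hn
      have n1 : s - p ≠ 0 := sub_ne_zero.mpr hn.1
      have n3 := rootProd_ne_zero hn.2
      have hds := sub_smul_dslope G p s
      rw [smul_eq_mul] at hds
      simp only [rootProd_cons]
      field_simp
      linear_combination -hds
    have c1 : ContinuousOn (fun s => G p * (1 / rootProd (p ::ₘ m) s))
        (frame a b T ∪ Metric.sphere 0 R) :=
      continuousOn_const.mul (continuousOn_div_rootProd hm continuous_const)
    have c2 := continuousOn_div_rootProd hm' hd.continuous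
    rw [rectIntegral_congr (hEq.mono subset_union_left), rectIntegral_add
        (c1.mono subset_union_left) (c2.mono subset_union_left),
      rectIntegral_const_mul, rectIntegral_inv_rootProd hR _ _ rfl hm, ih hm' _ hd,
      circleIntegral.integral_congr hR.le (hEq.mono subset_union_right),
      circleIntegral.integral_add
        (ContinuousOn.circleIntegrable hR.le (c1.mono subset_union_right))
        (ContinuousOn.circleIntegrable hR.le (c2.mono subset_union_right)),
      circleIntegral.integral_const_mul]

end RectangleIntegral

lemma norm_exp_mul_sq (ε : ℝ) (s : ℂ) :
    ‖exp (ε * s ^ 2)‖ = Real.exp (ε * (s.re ^ 2 - s.im ^ 2)) := by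
  rw [norm_exp, re_ofReal_mul, sq, mul_re]
  congr 1
  ring

lemma tendsto_exp_linear_sub_sq (C : ℝ) {ε : ℝ} (hε : 0 < ε) :
    Tendsto (fun T : ℝ => Real.exp (C * T - ε * T ^ 2)) atTop (𝓝 0) := by
  refine Real.tendsto_exp_atBot.comp ?_
  have h1 : Tendsto (fun T : ℝ => C + -ε * T) atTop atBot :=
    tendsto_atBot_add_const_left _ C (tendsto_id.const_mul_atTop_of_neg (by linarith))
  exact (tendsto_id.atTop_mul_atBot₀ h1).congr fun T => by simp only [id]; ring

/-- The contour shift with a Gaussian convergence factor `exp(εs²)`. -/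
lemma line_sub_line_gaussian {a b R ε C T₀ : ℝ} (hab : a ≤ b) (hR : 0 < R) (hε : 0 < ε)
    {m : Multiset ℂ} (hm : ∀ p ∈ m, a < p.re ∧ p.re < b ∧ ‖p‖ < R) {G : ℂ → ℂ}
    (hG : Differentiable ℂ G)
    (hgrow : ∀ s : ℂ, a ≤ s.re → s.re ≤ b → T₀ ≤ |s.im| →
      ‖G s / rootProd m s‖ ≤ C * Real.exp (C * |s.im|))
    (ha : Integrable fun t : ℝ => exp (ε * (a + t * I) ^ 2) * (G (a + t * I) / rootProd m (a + t * I)))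
    (hb : Integrable fun t : ℝ => exp (ε * (b + t * I) ^ 2) *
      (G (b + t * I) / rootProd m (b + t * I))) :
    I * (∫ t : ℝ, exp (ε * (b + t * I) ^ 2) * (G (b + t * I) / rootProd m (b + t * I))) -
      I * (∫ t : ℝ, exp (ε * (a + t * I) ^ 2) * (G (a + t * I) / rootProd m (a + t * I))) =
    ∮ s in C(0, R), exp (ε * s ^ 2) * (G s / rootProd m s) := by
  set F : ℂ → ℂ := fun s => exp (ε * s ^ 2) * (G s / rootProd m s) with hF
  have hFG : F = fun s => (exp (ε * s ^ 2) * G s) / rootProd m s := by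
    ext s; rw [hF]; ring
  have hd : Differentiable ℂ fun s => exp (ε * s ^ 2) * G s := by fun_prop
  have hrect : ∀ᶠ T : ℝ in atTop, rectIntegral F a b T = ∮ s in C(0, R), F s := by
    filter_upwards [eventually_ge_atTop R] with T hT
    rw [hFG]
    refine rectIntegral_div_rootProd hR m (fun p hp => ?_) _ hd
    obtain ⟨h1, h2, h3⟩ := hm p hp
    exact ⟨h1, h2, (abs_im_le_norm p).trans_lt (h3.trans_le hT), h3⟩
  have hnt : Tendsto (fun T : ℝ => -T) atTop atBot := tendsto_neg_atTop_atBot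
  have v1 := (intervalIntegral_tendsto_integral hb hnt tendsto_id).const_mul I
  have v2 := (intervalIntegral_tendsto_integral ha hnt tendsto_id).const_mul I
  set M := max |a| |b| with hM
  have hhor : ∀ η : ℝ, |η| = 1 →
      Tendsto (fun T : ℝ => ∫ x in a..b, F (x + (η * T : ℝ) * I)) atTop (𝓝 0) := by
    intro η hη
    have hz := (tendsto_exp_linear_sub_sq C hε).const_mul (C * Real.exp (ε * M ^ 2) * |b - a|)
    rw [mul_zero] at hz
    refine squeeze_zero_norm' ?_ hz
    filter_upwards [eventually_ge_atTop T₀, eventually_ge_atTop 0] with T hT hT0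
    have habs : |η * T| = T := by rw [abs_mul, hη, one_mul, abs_of_nonneg hT0]
    have hbd : ∀ x ∈ Set.uIoc a b, ‖F (x + (η * T : ℝ) * I)‖ ≤
        C * Real.exp (ε * M ^ 2) * Real.exp (C * T - ε * T ^ 2) := by
      intro x hx
      rw [uIoc_of_le hab] at hx
      have hre : ((x : ℂ) + (η * T : ℝ) * I).re = x := by
        rw [add_re, ofReal_re, re_ofReal_mul]; simp
      have him : ((x : ℂ) + (η * T : ℝ) * I).im = η * T := by
        rw [add_im, ofReal_im, im_ofReal_mul]; simp
      have hg := hgrow (x + (η * T : ℝ) * I) (by rw [hre]; exact hx.1.le) (by rw [hre]; exact hx.2)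
        (by rw [him, habs]; exact hT)
      rw [him, habs] at hg
      have hxM : x ^ 2 ≤ M ^ 2 := by
        rw [← sq_abs x]
        gcongr
        exact abs_le_max_abs_abs hx.1.le hx.2
      have hC : 0 ≤ C * Real.exp (C * T) := (norm_nonneg _).trans hg
      rw [hF]
      simp only
      rw [norm_mul, norm_exp_mul_sq, hre, him, ← sq_abs (η * T), habs]
      calc _ ≤ Real.exp (ε * (M ^ 2 - T ^ 2)) * (C * Real.exp (C * T)) := by gcongr
        _ = _ := by
          rw [show ε * (M ^ 2 - T ^ 2) = ε * M ^ 2 + -(ε * T ^ 2) by ring, Real.exp_add,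
            sub_eq_add_neg (C * T), Real.exp_add]
          ring
    refine (intervalIntegral.norm_integral_le_of_norm_le_const hbd).trans (le_of_eq ?_)
    ring
  have h1 := hhor (-1) (by simp)
  have h2 := hhor 1 (by simp)
  simp only [neg_one_mul] at h1
  simp only [one_mul] at h2
  have hlim := ((h1.sub h2).add v1).sub v2
  have hconst : Tendsto (fun T : ℝ => rectIntegral F a b T) atTop (𝓝 (∮ s in C(0, R), F s)) :=
    tendsto_const_nhds.congr' (hrect.mono fun T hT => hT.symm)
  have := tendsto_nhds_unique hlim hconst
  rw [sub_zero, zero_add] at this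
  exact this

/-- The contour shift: two vertical line integrals differ by the integral over a circle that
encloses all poles between them, provided the integrand grows at most exponentially in the strip
and is integrable on the two lines. -/
lemma line_sub_line {a b R C T₀ : ℝ} (hab : a ≤ b) (hR : 0 < R)
    {m : Multiset ℂ} (hm : ∀ p ∈ m, a < p.re ∧ p.re < b ∧ ‖p‖ < R) {G : ℂ → ℂ}
    (hG : Differentiable ℂ G)
    (hgrow : ∀ s : ℂ, a ≤ s.re → s.re ≤ b → T₀ ≤ |s.im| →
      ‖G s / rootProd m s‖ ≤ C * Real.exp (C * |s.im|))
    (ha : Integrable fun t : ℝ => G (a + t * I) / rootProd m (a + t * I))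
    (hb : Integrable fun t : ℝ => G (b + t * I) / rootProd m (b + t * I)) :
    I * (∫ t : ℝ, G (b + t * I) / rootProd m (b + t * I)) -
      I * (∫ t : ℝ, G (a + t * I) / rootProd m (a + t * I)) =
    ∮ s in C(0, R), G s / rootProd m s := by
  have hfil : ∀ᶠ ε : ℝ in 𝓝[>] 0, ε ∈ Ioo (0 : ℝ) 1 := Ioo_mem_nhdsGT one_pos
  have hbound : ∀ ε ∈ Ioo (0 : ℝ) 1, ∀ σ t : ℝ,
      ‖exp (ε * (σ + t * I) ^ 2)‖ ≤ Real.exp (σ ^ 2) := by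
    intro ε hε σ t
    rw [norm_exp_mul_sq]
    apply Real.exp_le_exp.mpr
    simp only [add_re, ofReal_re, mul_re, I_re, mul_zero, ofReal_im, I_im, mul_one, sub_self,
      add_zero, add_im, mul_im, zero_add]
    nlinarith [sq_nonneg σ, sq_nonneg t, mul_nonneg hε.1.le (sq_nonneg t), hε.2]
  have hmeas : ∀ ε σ : ℝ, Continuous fun t : ℝ => exp (ε * ((σ : ℂ) + t * I) ^ 2) := by
    intro ε σ
    fun_prop
  have hint : ∀ σ : ℝ, Integrable (fun t : ℝ => G (σ + t * I) / rootProd m (σ + t * I)) →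
      ∀ ε ∈ Ioo (0 : ℝ) 1, Integrable fun t : ℝ => exp (ε * (σ + t * I) ^ 2) *
        (G (σ + t * I) / rootProd m (σ + t * I)) := fun σ hσ ε hε =>
    hσ.bdd_mul (hmeas ε σ).aestronglyMeasurable (Eventually.of_forall fun t => hbound ε hε σ t)
  have hline : ∀ σ : ℝ, Integrable (fun t : ℝ => G (σ + t * I) / rootProd m (σ + t * I)) →
      Tendsto (fun ε : ℝ => ∫ t : ℝ, exp (ε * (σ + t * I) ^ 2) *
        (G (σ + t * I) / rootProd m (σ + t * I))) (𝓝[>] 0)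
        (𝓝 (∫ t : ℝ, G (σ + t * I) / rootProd m (σ + t * I))) := by
    intro σ hσ
    refine tendsto_integral_filter_of_dominated_convergence _ ?_ ?_
      (hσ.norm.const_mul (Real.exp (σ ^ 2))) ?_
    · exact Eventually.of_forall fun ε =>
        (hmeas ε σ).aestronglyMeasurable.mul hσ.aestronglyMeasurable
    · filter_upwards [hfil] with ε hε
      refine Eventually.of_forall fun t => ?_
      rw [norm_mul]
      exact mul_le_mul_of_nonneg_right (hbound ε hε σ t) (norm_nonneg _)
    · refine Eventually.of_forall fun t => ?_
      have hc : Continuous fun ε : ℝ => exp (ε * (σ + t * I) ^ 2) *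
        (G (σ + t * I) / rootProd m (σ + t * I)) := by fun_prop
      have := (hc.tendsto 0).mono_left (nhdsWithin_le_nhds (s := Ioi 0))
      simpa using this
  have hcirc : Tendsto (fun ε : ℝ => ∮ s in C(0, R), exp (ε * s ^ 2) * (G s / rootProd m s))
      (𝓝[>] 0) (𝓝 (∮ s in C(0, R), G s / rootProd m s)) := by
    have hk : ContinuousOn (fun s => G s / rootProd m s) (Metric.sphere 0 R) :=
      hG.continuous.continuousOn.div (differentiable_rootProd m).continuous.continuousOn
        fun s hs => rootProd_ne_zero fun h => by
          have := (hm s h).2.2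
          rw [mem_sphere_zero_iff_norm] at hs
          linarith
    have hkc : Continuous fun θ : ℝ => G (circleMap 0 R θ) / rootProd m (circleMap 0 R θ) :=
      hk.comp_continuous (continuous_circleMap 0 R) fun θ => circleMap_mem_sphere 0 hR.le θ
    have hcc : Continuous fun ε : ℝ => ∮ s in C(0, R), exp (ε * s ^ 2) * (G s / rootProd m s) := by
      simp only [circleIntegral]
      refine intervalIntegral.continuous_parametric_intervalIntegral_of_continuous' ?_ 0 (2 * Real.pi)
      have h1 : Continuous fun p : ℝ × ℝ => deriv (circleMap 0 R) p.2 := by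
        simp only [deriv_circleMap]
        fun_prop
      have h2 := hkc.comp (continuous_snd (X := ℝ) (Y := ℝ))
      exact h1.smul ((by fun_prop : Continuous fun p : ℝ × ℝ =>
        exp ((p.1 : ℂ) * circleMap 0 R p.2 ^ 2)).mul h2)
    have := (hcc.tendsto 0).mono_left (nhdsWithin_le_nhds (s := Ioi 0))
    simpa using this
  refine tendsto_nhds_unique (((hline b hb).const_mul I).sub ((hline a ha).const_mul I))
    (hcirc.congr' ?_)
  filter_upwards [hfil] with ε hε
  exact (line_sub_line_gaussian hab hR hε.1 hm hG hgrow (hint a ha ε hε) (hint b hb ε hε)).symm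

/-! ### Entire numerators of meromorphic functions -/

lemma meromorphicOrderAt_sub_pow (p : ℂ) (n : ℕ) (s : ℂ) :
    meromorphicOrderAt (fun z : ℂ => (z - p) ^ n) s = if s = p then (n : WithTop ℤ) else 0 := by
  split_ifs with h
  · subst h
    change _ = ((n : ℤ) : WithTop ℤ)
    rw [meromorphicOrderAt_eq_int_iff (by fun_prop)]
    exact ⟨fun _ => 1, by fun_prop, one_ne_zero, Eventually.of_forall fun z => by simp⟩
  · have hne : (s - p) ^ n ≠ 0 := pow_ne_zero _ (sub_ne_zero.mpr h)
    have ha : AnalyticAt ℂ (fun z : ℂ => (z - p) ^ n) s := by fun_prop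
    rw [ha.meromorphicOrderAt_eq, ha.analyticOrderAt_eq_zero.mpr hne]
    rfl

lemma rootProd_replicate_sum {S : Finset ℂ} (n : ℂ → ℕ) (s : ℂ) :
    rootProd (∑ p ∈ S, Multiset.replicate (n p) p) s = ∏ p ∈ S, (s - p) ^ n p := by
  classical
  induction S using Finset.induction_on with
  | empty => simp [rootProd]
  | insert a S ha ih =>
    rw [Finset.sum_insert ha, Finset.prod_insert ha, ← ih]
    simp [rootProd, Multiset.map_replicate]

/-- A meromorphic function on the plane whose poles are confined to a bounded set is the quotient
of an entire function by a polynomial with roots at these poles. -/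
lemma exists_entire_numerator {f : ℂ → ℂ} (hf : MeromorphicOn f univ) {R : ℝ}
    (hR : ∀ s : ℂ, R ≤ ‖s‖ → 0 ≤ meromorphicOrderAt f s) :
    ∃ m : Multiset ℂ, ∃ g : ℂ → ℂ, Differentiable ℂ g ∧
      (∀ p ∈ m, meromorphicOrderAt f p < 0) ∧
      f =ᶠ[codiscrete ℂ] fun s => g s / rootProd m s := by
  classical
  have hfin : {s : ℂ | meromorphicOrderAt f s < 0}.Finite := by
    have hcod : {s : ℂ | AnalyticAt ℂ f s} ∈ codiscrete ℂ :=
      hf.analyticAt_mem_codiscreteWithin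
    have hK : IsCompact (Metric.closedBall (0 : ℂ) R) := isCompact_closedBall 0 R
    by_contra hinf
    have hsub : {s : ℂ | meromorphicOrderAt f s < 0} ⊆ Metric.closedBall 0 R := by
      intro s hs
      rw [mem_closedBall_zero_iff]
      by_contra hcon
      exact absurd (hR s (not_le.mp hcon).le) (not_le.mpr hs)
    obtain ⟨z, -, hz⟩ := Set.Infinite.exists_accPt_of_subset_isCompact hinf hK hsub
    have h1 : ∀ᶠ s in 𝓝[≠] z, AnalyticAt ℂ f s := (hf z (mem_univ z)).eventually_analyticAt
    rw [accPt_iff_frequently_nhdsNE] at hz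
    obtain ⟨s, hs1, hs2⟩ := (hz.and_eventually h1).exists
    exact absurd hs2.meromorphicOrderAt_nonneg (not_le.mpr hs1)
  set S := hfin.toFinset with hS
  set n : ℂ → ℕ := fun p => (-(meromorphicOrderAt f p).untop₀).toNat with hn
  set m : Multiset ℂ := ∑ p ∈ S, Multiset.replicate (n p) p with hm
  have hmem : ∀ p ∈ m, meromorphicOrderAt f p < 0 := by
    intro p hp
    rw [hm, Multiset.mem_sum] at hp
    obtain ⟨q, hq, hpq⟩ := hp
    rw [Multiset.eq_of_mem_replicate hpq]
    exact hfin.mem_toFinset.mp hq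
  set Q := rootProd m with hQ
  have hQf : Q = fun s => ∏ p ∈ S, (s - p) ^ n p := by
    ext s; exact rootProd_replicate_sum n s
  have hQd : Differentiable ℂ Q := differentiable_rootProd m
  have hQm : MeromorphicOn Q univ := fun s _ => (hQd.analyticAt s).meromorphicAt
  have hQf' : MeromorphicOn (Q * f) univ := hQm.mul hf
  have hord : ∀ s : ℂ, 0 ≤ meromorphicOrderAt (Q * f) s := by
    intro s
    rw [meromorphicOrderAt_mul (hQm s (mem_univ s)) (hf s (mem_univ s))]
    by_cases hs : meromorphicOrderAt f s < 0
    · have hsS : s ∈ S := hfin.mem_toFinset.mpr hs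
      have hQo : meromorphicOrderAt Q s = n s := by
        have hsplit : Q = (fun z => (z - s) ^ n s) * fun z => ∏ p ∈ S.erase s, (z - p) ^ n p := by
          rw [hQf]
          ext z
          rw [Pi.mul_apply, Finset.mul_prod_erase S (fun p => (z - p) ^ n p) hsS]
        have han : AnalyticAt ℂ (fun z => ∏ p ∈ S.erase s, (z - p) ^ n p) s := by fun_prop
        rw [hsplit, meromorphicOrderAt_mul (by fun_prop) han.meromorphicAt,
          meromorphicOrderAt_sub_pow, if_pos rfl, han.meromorphicOrderAt_eq,
          han.analyticOrderAt_eq_zero.mpr]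
        · simp
        · exact Finset.prod_ne_zero_iff.mpr fun p hp =>
            pow_ne_zero _ (sub_ne_zero.mpr (Finset.ne_of_mem_erase hp).symm)
      rw [hQo]
      obtain ⟨k, hk⟩ := WithTop.ne_top_iff_exists.mp hs.ne_top
      rw [hn]
      simp only
      rw [← hk] at hs ⊢
      have hk0 : k < 0 := by exact_mod_cast hs
      rw [WithTop.untop₀_coe]
      have : (0 : ℤ) ≤ ((-k).toNat : ℤ) + k := by omega
      exact_mod_cast this
    · exact add_nonneg (hQd.analyticAt s).meromorphicOrderAt_nonneg (not_lt.mp hs)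
  set g := toMeromorphicNFOn (Q * f) univ with hg
  have hgd : Differentiable ℂ g := by
    intro s
    have hnf := meromorphicNFOn_toMeromorphicNFOn (Q * f) univ (mem_univ s)
    refine (hnf.meromorphicOrderAt_nonneg_iff_analyticAt.mp ?_).differentiableAt
    rw [meromorphicOrderAt_toMeromorphicNFOn hQf' (mem_univ s)]
    exact hord s
  refine ⟨m, g, hgd, hmem, ?_⟩
  have h1 : Q * f =ᶠ[codiscrete ℂ] g := toMeromorphicNFOn_eqOn_codiscrete hQf'
  have h2 : ∀ᶠ s in codiscrete ℂ, s ∉ (S : Set ℂ) := S.finite_toSet.compl_mem_codiscrete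
  filter_upwards [h1, h2] with s hs1 hs2
  have hsm : s ∉ m := fun h => hs2 (hfin.mem_toFinset.mpr (hmem s h))
  rw [← hs1, Pi.mul_apply, mul_div_cancel_left₀ _ (rootProd_ne_zero hsm)]

/-! ### Exponential growth on vertical strips -/

/-- `f` grows at most exponentially in `|Im s|`, uniformly on every vertical strip. -/
def ExpGrowth (f : ℂ → ℂ) : Prop :=
  ∀ b b' : ℝ, ∃ C T : ℝ, 0 ≤ C ∧ ∀ s : ℂ, b ≤ s.re → s.re ≤ b' → T ≤ |s.im| →
    ‖f s‖ ≤ C * Real.exp (C * |s.im|)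

lemma ExpGrowth.mul {f g : ℂ → ℂ} (hf : ExpGrowth f) (hg : ExpGrowth g) :
    ExpGrowth fun s => f s * g s := by
  intro b b'
  obtain ⟨C, T, hC, h1⟩ := hf b b'
  obtain ⟨C', T', hC', h2⟩ := hg b b'
  refine ⟨C * C' + (C + C'), max T T', by positivity, fun s hb hb' hT => ?_⟩
  have k1 := h1 s hb hb' ((le_max_left _ _).trans hT)
  have k2 := h2 s hb hb' ((le_max_right _ _).trans hT)
  rw [norm_mul]
  calc ‖f s‖ * ‖g s‖ ≤ (C * Real.exp (C * |s.im|)) * (C' * Real.exp (C' * |s.im|)) := by gcongr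
    _ = (C * C') * Real.exp ((C + C') * |s.im|) := by
      rw [add_mul, Real.exp_add]; ring
    _ ≤ _ := by
      have : 0 ≤ C * C' := by positivity
      have hE := Real.exp_nonneg ((C * C' + (C + C')) * |s.im|)
      refine mul_le_mul (by linarith) (Real.exp_le_exp.mpr ?_) (Real.exp_nonneg _) (by linarith)
      exact mul_le_mul_of_nonneg_right (by linarith) (abs_nonneg _)

lemma expGrowth_prod {ι : Type*} (S : Finset ι) {f : ι → ℂ → ℂ} (hf : ∀ i ∈ S, ExpGrowth (f i)) :
    ExpGrowth fun s => ∏ i ∈ S, f i s := by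
  classical
  induction S using Finset.induction_on with
  | empty =>
    intro b b'
    refine ⟨1, 0, zero_le_one, fun s _ _ _ => ?_⟩
    simp
  | insert i S hi ih =>
    simp only [Finset.prod_insert hi]
    exact (hf i (Finset.mem_insert_self i S)).mul
      (ih fun j hj => hf j (Finset.mem_insert_of_mem hj))

lemma ExpGrowth.comp_linear {f : ℂ → ℂ} (hf : ExpGrowth f) {α : ℝ} (hα : 0 < α) (β : ℂ) :
    ExpGrowth fun s => f (α * s + β) := by
  intro b b'
  obtain ⟨C, T, hC, h1⟩ := hf (α * b + β.re) (α * b' + β.re)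
  have hre : ∀ s : ℂ, (α * s + β).re = α * s.re + β.re := fun s => by
    rw [add_re, re_ofReal_mul]
  have him : ∀ s : ℂ, (α * s + β).im = α * s.im + β.im := fun s => by
    rw [add_im, im_ofReal_mul]
  have hE : 1 ≤ Real.exp (C * |β.im|) := Real.one_le_exp (by positivity)
  refine ⟨C * Real.exp (C * |β.im|) + C * α, (T + |β.im|) / α, by positivity,
    fun s hb hb' hT => ?_⟩
  rw [div_le_iff₀ hα] at hT
  have h2 : |α * s.im| = α * |s.im| := by rw [abs_mul, abs_of_pos hα]
  have h3 : T ≤ |α * s.im + β.im| := by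
    have := abs_sub_abs_le_abs_sub (α * s.im) (-β.im)
    rw [abs_neg, sub_neg_eq_add] at this
    linarith
  have h4 := h1 (α * s + β) (by rw [hre]; gcongr) (by rw [hre]; gcongr) (by rw [him]; exact h3)
  rw [him] at h4
  have h5 := abs_add_le (α * s.im) β.im
  have h0 := abs_nonneg s.im
  calc ‖f (α * s + β)‖ ≤ C * Real.exp (C * |α * s.im + β.im|) := h4
    _ ≤ C * Real.exp (C * |β.im| + C * α * |s.im|) := by
      gcongr
      nlinarith
    _ = C * Real.exp (C * |β.im|) * Real.exp (C * α * |s.im|) := by rw [Real.exp_add]; ring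
    _ ≤ _ := by
      gcongr
      · have : 0 ≤ C * α := by positivity
        linarith
      · have : 0 ≤ C * Real.exp (C * |β.im|) := by positivity
        linarith

lemma norm_Gamma_le_Gamma_re {z : ℂ} (hz : 0 < z.re) : ‖Gamma z‖ ≤ Real.Gamma z.re := by
  rw [Gamma_eq_integral hz, Real.Gamma_eq_integral hz]
  refine (norm_integral_le_integral_norm _).trans (le_of_eq ?_)
  refine setIntegral_congr_fun measurableSet_Ioi fun x hx => ?_
  have hx' : (0 : ℝ) < x := hx
  rw [norm_mul, norm_cpow_eq_rpow_re_of_pos hx', norm_real, Real.norm_of_nonneg (Real.exp_nonneg _)]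
  simp

lemma norm_inv_Gamma_le_sub_nat (n : ℕ) {z : ℂ} (hz : 1 ≤ |z.im|) :
    ‖(Gamma z)⁻¹‖ ≤ ‖(Gamma (z - n))⁻¹‖ := by
  induction n with
  | zero => simp
  | succ n ih =>
    refine ih.trans ?_
    set w : ℂ := z - (n + 1 : ℕ) with hw
    have him : w.im = z.im := by simp [hw]
    have hw1 : 1 ≤ ‖w‖ := hz.trans (him ▸ abs_im_le_norm w)
    have hw0 : w ≠ 0 := norm_pos_iff.mp (by linarith)
    have : z - n = w + 1 := by rw [hw]; push_cast; ring
    rw [this, Gamma_add_one w hw0, mul_inv, norm_mul, norm_inv]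
    exact mul_le_of_le_one_left (norm_nonneg _) (inv_le_one_of_one_le₀ hw1)

lemma norm_sin_le (z : ℂ) : ‖sin z‖ ≤ Real.exp |z.im| := by
  have := norm_cos_le (z - Real.pi / 2)
  rw [cos_sub_pi_div_two] at this
  simpa using this

/-- The reciprocal gamma function grows at most exponentially: to the left of the critical line
this is the reflection formula, and shifts to the right only decrease it. -/
lemma expGrowth_inv_Gamma : ExpGrowth fun z => (Gamma z)⁻¹ := by
  intro b b'
  obtain ⟨n, hn⟩ := exists_nat_ge b'
  obtain ⟨M, hM⟩ := (isCompact_Icc (a := (1 : ℝ)) (b := 1 - b + n)).exists_bound_of_continuousOn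
    (f := Real.Gamma) fun x hx => (Real.differentiableAt_Gamma fun m => by
      have := hx.1
      have : (0 : ℝ) ≤ m := m.cast_nonneg
      linarith).continuousAt.continuousWithinAt
  refine ⟨max M Real.pi, 1, (Real.pi_pos.le).trans (le_max_right _ _), fun z hb hb' hT => ?_⟩
  refine (norm_inv_Gamma_le_sub_nat n hT).trans ?_
  set w : ℂ := z - n with hw
  have him : w.im = z.im := by simp [hw]
  have hre : w.re = z.re - n := by simp [hw]
  have hpos : 0 < (1 - w).re := by rw [sub_re, one_re, hre]; linarith
  have hrefl := Gamma_mul_Gamma_one_sub w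
  have hsin : sin (Real.pi * w) ≠ 0 := by
    intro h0
    rw [sin_eq_zero_iff] at h0
    obtain ⟨k, hk⟩ := h0
    have := congrArg Complex.im hk
    rw [im_ofReal_mul, him] at this
    have h1 : ((k : ℂ) * Real.pi).im = 0 := by
      rw [← ofReal_intCast, ← ofReal_mul, ofReal_im]
    rw [h1, mul_eq_zero] at this
    rcases this with h | h
    · exact Real.pi_ne_zero h
    · rw [h] at hT; norm_num at hT
  have hG : (Gamma w)⁻¹ = Gamma (1 - w) * sin (Real.pi * w) / Real.pi := by
    have hpi : (Real.pi : ℂ) ≠ 0 := ofReal_ne_zero.mpr Real.pi_ne_zero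
    have hG0 : Gamma w ≠ 0 := by
      intro h0
      rw [h0, zero_mul] at hrefl
      exact div_ne_zero hpi hsin hrefl.symm
    rw [eq_div_iff hsin] at hrefl
    rw [eq_div_iff hpi, inv_mul_eq_iff_eq_mul₀ hG0, ← mul_assoc]
    exact hrefl.symm
  have hGb : ‖Gamma (1 - w)‖ ≤ M := by
    refine (norm_Gamma_le_Gamma_re hpos).trans ((le_abs_self _).trans (hM _ ?_))
    rw [sub_re, one_re, hre]
    constructor <;> linarith
  have hsb : ‖sin (Real.pi * w)‖ ≤ Real.exp (Real.pi * |z.im|) := by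
    refine (norm_sin_le _).trans (le_of_eq ?_)
    rw [im_ofReal_mul, him, abs_mul, abs_of_pos Real.pi_pos]
  have hM0 : 0 ≤ M := (norm_nonneg _).trans hGb
  rw [hG, norm_div, norm_mul, norm_real, Real.norm_of_nonneg Real.pi_pos.le]
  calc ‖Gamma (1 - w)‖ * ‖sin (Real.pi * w)‖ / Real.pi
      ≤ ‖Gamma (1 - w)‖ * ‖sin (Real.pi * w)‖ :=
        div_le_self (by positivity) (by linarith [Real.pi_gt_three])
    _ ≤ M * Real.exp (Real.pi * |z.im|) := by gcongr
    _ ≤ _ := by gcongr; exacts [le_max_left _ _, le_max_right _ _]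

lemma eventually_nhdsNE_of_codiscrete {P : ℂ → Prop} (h : ∀ᶠ s in codiscrete ℂ, P s) (s : ℂ) :
    ∀ᶠ z in 𝓝[≠] s, P z := by
  have h1 := mem_codiscreteWithin_iff_forall_mem_nhdsNE.mp h s (mem_univ s)
  rw [compl_univ, union_empty] at h1
  exact h1

lemma ExpGrowth.of_eventuallyEq_codiscrete {f g : ℂ → ℂ} (hf : ExpGrowth f)
    (hfg : f =ᶠ[codiscrete ℂ] g) {R : ℝ} (hg : ∀ s : ℂ, R ≤ ‖s‖ → ContinuousAt g s) :
    ExpGrowth g := by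
  intro b b'
  obtain ⟨C, T, hC, h1⟩ := hf (b - 1) (b' + 1)
  refine ⟨C, max T R + 1, hC, fun s hb hb' hT => ?_⟩
  have hsR : R ≤ ‖s‖ := by
    have := le_max_right T R
    linarith [abs_im_le_norm s]
  have hgc := ((hg s hsR).norm.tendsto).mono_left (nhdsWithin_le_nhds (s := {s}ᶜ))
  have hlim : Tendsto (fun z : ℂ => C * Real.exp (C * |z.im|)) (𝓝[≠] s)
      (𝓝 (C * Real.exp (C * |s.im|))) := by
    have : Continuous fun z : ℂ => C * Real.exp (C * |z.im|) := by fun_prop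
    exact (this.tendsto s).mono_left nhdsWithin_le_nhds
  have hev : ∀ᶠ z in 𝓝[≠] s, f z = g z :=
    eventually_nhdsNE_of_codiscrete hfg s
  have o1 : ∀ᶠ z : ℂ in 𝓝[≠] s, b - 1 < z.re ∧ z.re < b' + 1 ∧ max T R < |z.im| := by
    apply eventually_nhdsWithin_of_eventually_nhds
    have c1 := (continuous_re.tendsto s).eventually (lt_mem_nhds (show b - 1 < s.re by linarith))
    have c2 := (continuous_re.tendsto s).eventually (gt_mem_nhds (show s.re < b' + 1 by linarith))
    have c3 := (continuous_im.abs.tendsto s).eventually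
      (lt_mem_nhds (show max T R < |s.im| by linarith))
    filter_upwards [c1, c2, c3] with z h1 h2 h3 using ⟨h1, h2, h3⟩
  refine le_of_tendsto_of_tendsto hgc hlim ?_
  filter_upwards [hev, o1] with z hz ho
  rw [← hz]
  exact h1 z ho.1.le ho.2.1.le ((le_max_left _ _).trans ho.2.2.le)

/-! ### Exceptional sets on vertical lines and the poles of the continuation -/

lemma ae_line_of_codiscrete {P : ℂ → Prop} (h : ∀ᶠ s in codiscrete ℂ, P s) (c : ℝ) :
    ∀ᵐ t : ℝ, P (c + t * I) := by
  have hD : {s | P s}ᶜ.Countable := by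
    have hd : IsDiscrete {s | P s}ᶜ := by
      have := isDiscrete_of_codiscreteWithin (U := univ) (s := {s | P s}ᶜ) (by rwa [compl_compl])
      simpa using this
    have : IsLindelof ({s | P s}ᶜ) := HereditarilyLindelofSpace.isLindelof _
    exact this.countable_of_isDiscrete hd
  have hinj : Function.Injective fun t : ℝ => (c + t * I : ℂ) := by
    intro t t' htt
    have := congrArg Complex.im htt
    simpa using this
  exact (hD.preimage hinj).measure_zero volume

namespace GammaParams

variable {d : ℕ} (G : GammaParams d)

lemma differentiable_inv_Delta : Differentiable ℂ fun s => (G.Delta s)⁻¹ := by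
  simp only [Delta, ← Finset.prod_inv_distrib]
  refine Differentiable.fun_finsetProd fun ν _ => ?_
  have : Differentiable ℂ fun s => (G.α ν : ℂ) * s + G.β ν := by fun_prop
  exact differentiable_one_div_Gamma.comp this

lemma meromorphicAt_Delta (s : ℂ) : MeromorphicAt G.Delta s := by
  have := (G.differentiable_inv_Delta.analyticAt s).meromorphicAt.inv
  refine this.congr (Eventually.of_forall fun z => ?_)
  simp

lemma Delta_ne_zero_of_abs_im : ∃ T : ℝ, ∀ s : ℂ, T ≤ |s.im| → G.Delta s ≠ 0 := by
  refine ⟨∑ ν, (1 + |(G.β ν).im|) / G.α ν, fun s hs => ?_⟩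
  refine Finset.prod_ne_zero_iff.mpr fun ν _ => Gamma_ne_zero fun m hm => ?_
  have hα := G.α_pos ν
  have h1 : (1 + |(G.β ν).im|) / G.α ν ≤ |s.im| :=
    (Finset.single_le_sum (f := fun ν => (1 + |(G.β ν).im|) / G.α ν)
      (fun ν _ => div_nonneg (by positivity) (G.α_pos ν).le) (Finset.mem_univ ν)).trans hs
  rw [div_le_iff₀ hα] at h1
  have h2 := congrArg Complex.im hm
  rw [add_im, im_ofReal_mul] at h2
  simp only [neg_im, natCast_im, neg_zero] at h2
  have h3 : |G.α ν * s.im| = |(G.β ν).im| := by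
    rw [eq_neg_of_add_eq_zero_left h2, abs_neg]
  rw [abs_mul, abs_of_pos hα] at h3
  linarith

lemma eventually_Delta_ne_zero : ∀ᶠ s in codiscrete ℂ, G.Delta s ≠ 0 := by
  obtain ⟨T, hT⟩ := G.Delta_ne_zero_of_abs_im
  have hx : (G.Delta ((|T| : ℝ) * I))⁻¹ ≠ 0 := inv_ne_zero (hT _ (by simp [le_abs_self]))
  have ha : AnalyticOnNhd ℂ (fun s => (G.Delta s)⁻¹) univ := fun s _ =>
    G.differentiable_inv_Delta.analyticAt s
  have := ha.preimage_zero_mem_codiscrete hx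
  filter_upwards [this] with s hs h0
  simp [h0] at hs

lemma continuation_order_nonneg {phi : ℂ → ℂ} (hphi : MeromorphicOn phi univ) {s : ℂ}
    (h : 0 ≤ meromorphicOrderAt (fun z => G.Delta z * phi z) s) :
    0 ≤ meromorphicOrderAt phi s := by
  have hev : ∀ᶠ z in 𝓝[≠] s, G.Delta z ≠ 0 :=
    eventually_nhdsNE_of_codiscrete G.eventually_Delta_ne_zero s
  have heq : phi =ᶠ[𝓝[≠] s] (fun z => (G.Delta z)⁻¹) * fun z => G.Delta z * phi z := by
    filter_upwards [hev] with z hz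
    rw [Pi.mul_apply, inv_mul_cancel_left₀ hz]
  have ha := G.differentiable_inv_Delta.analyticAt s
  have hm : MeromorphicAt (fun z => G.Delta z * phi z) s :=
    (G.meromorphicAt_Delta s).mul (hphi s (mem_univ s))
  rw [meromorphicOrderAt_congr heq, meromorphicOrderAt_mul ha.meromorphicAt hm]
  exact add_nonneg ha.meromorphicOrderAt_nonneg h

lemma VerticalDecay.expGrowth {phi : ℂ → ℂ} (h : G.VerticalDecay phi) : ExpGrowth phi := by
  have h1 : ExpGrowth fun s => (G.Delta s)⁻¹ := by
    simp only [Delta, ← Finset.prod_inv_distrib]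
    exact expGrowth_prod _ fun ν _ => expGrowth_inv_Gamma.comp_linear (G.α_pos ν) (G.β ν)
  have h2 : ExpGrowth fun s => G.Delta s * phi s := by
    intro b b'
    obtain ⟨T, hT⟩ := h b b' 1 one_pos
    refine ⟨1, T, zero_le_one, fun s hb hb' hs => ?_⟩
    have := hT s.re s.im hb hb' hs
    rw [re_add_im] at this
    refine this.le.trans ?_
    rw [one_mul, one_mul]
    exact Real.one_le_exp (abs_nonneg _)
  obtain ⟨T₀, hT₀⟩ := G.Delta_ne_zero_of_abs_im
  intro b b'
  obtain ⟨C, T, hC, hb⟩ := (h1.mul h2) b b'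
  refine ⟨C, max T T₀, hC, fun s k1 k2 k3 => ?_⟩
  have := hb s k1 k2 ((le_max_left _ _).trans k3)
  simpa only [inv_mul_cancel_left₀ (hT₀ s ((le_max_right _ _).trans k3))] using this

end GammaParams

/-! ### Dirichlet series on vertical lines -/

/-- The general Dirichlet series `∑ bₙ mₙ^{-s}`. -/
def dirichlet (b : ℕ → ℂ) (m : ℕ → ℝ) (s : ℂ) : ℂ := ∑' n, b n * (m n : ℂ) ^ (-s)

section Dirichlet
variable {b : ℕ → ℂ} {m : ℕ → ℝ} {σ c : ℝ}

lemma norm_dirichlet_term (hm : IsFrequency m) (c t : ℝ) (n : ℕ) :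
    ‖b n * (m n : ℂ) ^ (-(c + t * I : ℂ))‖ = ‖b n‖ * m n ^ (-c) := by
  rw [norm_mul, norm_cpow_eq_rpow_re_of_pos (hm.pos n)]
  simp

lemma AbsConvergent.summable_norm (hb : AbsConvergent b m σ) (hm : IsFrequency m) (hc : σ ≤ c) :
    Summable fun n => ‖b n‖ * m n ^ (-c) := by
  have := hb c (by simpa using hc)
  refine this.congr fun n => ?_
  have := norm_dirichlet_term (b := b) hm c 0 n
  simpa using this

lemma continuous_dirichlet_term (hm : IsFrequency m) (c : ℝ) (n : ℕ) :
    Continuous fun t : ℝ => b n * (m n : ℂ) ^ (-(c + t * I : ℂ)) := by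
  have : (m n : ℂ) ≠ 0 := by exact_mod_cast (hm.pos n).ne'
  simp only [cpow_def_of_ne_zero this]
  fun_prop

lemma AbsConvergent.continuous_dirichlet (hb : AbsConvergent b m σ) (hm : IsFrequency m)
    (hc : σ ≤ c) : Continuous fun t : ℝ => dirichlet b m (c + t * I) :=
  continuous_tsum (continuous_dirichlet_term hm c) (hb.summable_norm hm hc)
    fun n t => (norm_dirichlet_term hm c t n).le

lemma AbsConvergent.norm_dirichlet_le (hb : AbsConvergent b m σ) (hm : IsFrequency m)
    (hc : σ ≤ c) (t : ℝ) : ‖dirichlet b m (c + t * I)‖ ≤ ∑' n, ‖b n‖ * m n ^ (-c) :=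
  tsum_of_norm_bounded (hb.summable_norm hm hc).hasSum fun n => (norm_dirichlet_term hm c t n).le

lemma AbsConvergent.integrable_dirichlet_mul (hb : AbsConvergent b m σ) (hm : IsFrequency m)
    (hc : σ ≤ c) {F : ℝ → ℂ} (hF : Integrable F) :
    Integrable fun t : ℝ => dirichlet b m (c + t * I) * F t :=
  hF.bdd_mul (hb.continuous_dirichlet hm hc).aestronglyMeasurable
    (Eventually.of_forall (hb.norm_dirichlet_le hm hc))

lemma AbsConvergent.norm_integral_dirichlet_mul_le (hb : AbsConvergent b m σ) (hm : IsFrequency m)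
    (hc : σ ≤ c) {F : ℝ → ℂ} (hF : Integrable F) :
    ‖∫ t : ℝ, dirichlet b m (c + t * I) * F t‖ ≤ (∑' n, ‖b n‖ * m n ^ (-c)) * ∫ t, ‖F t‖ := by
  rw [← integral_const_mul]
  refine norm_integral_le_of_norm_le (hF.norm.const_mul _) (Eventually.of_forall fun t => ?_)
  rw [norm_mul]
  gcongr
  exact hb.norm_dirichlet_le hm hc t

/-- Termwise integration of a Dirichlet series along a line of absolute convergence. -/
lemma AbsConvergent.hasSum_integral_dirichlet_mul (hb : AbsConvergent b m σ) (hm : IsFrequency m)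
    (hc : σ ≤ c) {F : ℝ → ℂ} (hF : Integrable F) :
    HasSum (fun n => b n * ∫ t : ℝ, (m n : ℂ) ^ (-(c + t * I : ℂ)) * F t)
      (∫ t : ℝ, dirichlet b m (c + t * I) * F t) := by
  have hint : ∀ n, Integrable fun t : ℝ => b n * (m n : ℂ) ^ (-(c + t * I : ℂ)) * F t := fun n =>
    hF.bdd_mul (continuous_dirichlet_term hm c n).aestronglyMeasurable
      (Eventually.of_forall fun t => (norm_dirichlet_term hm c t n).le)
  have hnorm : ∀ n, ∫ t : ℝ, ‖b n * (m n : ℂ) ^ (-(c + t * I : ℂ)) * F t‖ =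
      ‖b n‖ * m n ^ (-c) * ∫ t, ‖F t‖ := by
    intro n
    rw [← integral_const_mul]
    congr 1
    ext t
    rw [norm_mul, norm_dirichlet_term hm]
  have hs : Summable fun n => ∫ t : ℝ, ‖b n * (m n : ℂ) ^ (-(c + t * I : ℂ)) * F t‖ := by
    simp only [hnorm]
    exact (hb.summable_norm hm hc).mul_right _
  have := hasSum_integral_of_summable_integral_norm hint hs
  simp only [dirichlet, ← tsum_mul_right]
  refine this.congr_fun fun n => ?_
  rw [← integral_const_mul]
  simp only [mul_assoc]

end Dirichlet

/-! ### The local mean as an integral over a dual line -/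

lemma norm_cpow_line {x : ℝ} (hx : 0 < x) (c t : ℝ) : ‖(x : ℂ) ^ (c + t * I : ℂ)‖ = x ^ c := by
  rw [norm_cpow_eq_rpow_re_of_pos hx]
  simp

lemma continuous_const_cpow_ofReal {x : ℝ} (hx : 0 < x) : Continuous fun s : ℂ => (x : ℂ) ^ s :=
  Continuous.const_cpow continuous_id (Or.inl (by exact_mod_cast hx.ne'))

/-- The smoothed sum as an integral of its Dirichlet series over a line of absolute convergence. -/
lemma AbsConvergent.tsum_weight_eq {a : ℕ → ℂ} {l : ℕ → ℝ} {σ c : ℝ} (ha : AbsConvergent a l σ)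
    (hl : IsFrequency l) (hc : σ ≤ c) {f : ℝ → ℝ} (hf : IsTest f) {L : ℝ} (hL : 2 ≤ L) {x : ℝ}
    (hx : 0 < x) :
    Integrable (fun t : ℝ => dirichlet a l (c + t * I) *
        (weightMellin f L (c + t * I) * (x : ℂ) ^ (c + t * I : ℂ))) ∧
    ∑' n, a n * (weight f L (l n / x) : ℂ) = 1 / (2 * Real.pi) * ∫ t : ℝ,
      dirichlet a l (c + t * I) * (weightMellin f L (c + t * I) * (x : ℂ) ^ (c + t * I : ℂ)) := by
  have hF : Integrable fun t : ℝ => weightMellin f L (c + t * I) * (x : ℂ) ^ (c + t * I : ℂ) := by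
    have hcont : Continuous fun t : ℝ => (x : ℂ) ^ (c + t * I : ℂ) :=
      (continuous_const_cpow_ofReal hx).comp (by fun_prop)
    exact (hf.integrable_weightMellin hL c).mul_bdd hcont.aestronglyMeasurable
      (Eventually.of_forall fun t => (norm_cpow_line hx c t).le)
  refine ⟨ha.integrable_dirichlet_mul hl hc hF, ?_⟩
  have hs := (ha.hasSum_integral_dirichlet_mul hl hc hF).mul_left (1 / (2 * Real.pi) : ℂ)
  rw [← hs.tsum_eq]
  congr 1
  ext n
  have hln := hl.pos n
  rw [hf.weight_eq_integral hL c (div_pos hln hx), mul_left_comm]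
  congr 3
  ext t
  have hx0 : (x : ℂ) ≠ 0 := by exact_mod_cast hx.ne'
  have hdiv : ((l n / x : ℝ) : ℂ) ^ (-(c + t * I : ℂ)) =
      (l n : ℂ) ^ (-(c + t * I : ℂ)) * (x : ℂ) ^ (c + t * I : ℂ) := by
    rw [ofReal_div, div_cpow_ofReal_nonneg hln.le hx.le, cpow_neg (x : ℂ), div_inv_eq_mul]
  rw [hdiv]
  ring

namespace GammaParams

variable {d : ℕ} (G : GammaParams d)

/-- The part of the integrand on the dual line that does not involve the Dirichlet series,
with a general kernel `K` in place of the quotient of gamma factors. -/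
def dualFactor (K : ℂ → ℂ) (f : ℝ → ℝ) (L x : ℝ) (s : ℂ) : ℂ :=
  K s * (weightMellin f L (1 - s) * (x : ℂ) ^ (1 - s))

lemma norm_cpow_one_sub_line {x : ℝ} (hx : 0 < x) (c t : ℝ) :
    ‖(x : ℂ) ^ (1 - (c + t * I) : ℂ)‖ = x ^ (1 - c) := by
  rw [norm_cpow_eq_rpow_re_of_pos hx]
  simp

/-- A kernel of polynomial growth of degree `e` gives an integral of size `x^{1-c} L^e`. -/
lemma exists_integral_norm_dualFactor_le {f : ℝ → ℝ} (hf : IsTest f) (c : ℝ) {e : ℝ} (he : 0 ≤ e) :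
    ∃ C : ℝ, 0 ≤ C ∧ ∀ (K : ℂ → ℂ) (B : ℝ), Continuous (fun t : ℝ => K (c + t * I)) →
      (∀ t : ℝ, ‖K (c + t * I)‖ ≤ B * (1 + |t|) ^ e) → ∀ L x : ℝ, 2 ≤ L → 0 < x →
      Integrable (fun t : ℝ => dualFactor K f L x (c + t * I)) ∧
      ∫ t : ℝ, ‖dualFactor K f L x (c + t * I)‖ ≤ B * x ^ (1 - c) * (C * L ^ e) := by
  obtain ⟨C, hC, hmom⟩ := hf.exists_moment_dual_le c he
  refine ⟨C, hC, fun K B hK hB L x hL hx => ?_⟩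
  obtain ⟨h1, h2⟩ := hmom L hL
  have hB0 : 0 ≤ B := by
    have := (norm_nonneg _).trans (hB 0)
    simpa using this
  have hle : ∀ t : ℝ, ‖dualFactor K f L x (c + t * I)‖ ≤
      B * x ^ (1 - c) * ((1 + |t|) ^ e * ‖weightMellin f L (1 - (c + t * I))‖) := by
    intro t
    rw [dualFactor, norm_mul, norm_mul, norm_cpow_one_sub_line hx]
    have := hB t
    have hxc : 0 ≤ x ^ (1 - c) := by positivity
    calc _ ≤ (B * (1 + |t|) ^ e) * (‖weightMellin f L (1 - (c + t * I))‖ * x ^ (1 - c)) := by gcongr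
      _ = _ := by ring
  have hcont : Continuous fun t : ℝ => dualFactor K f L x (c + t * I) :=
    hK.mul ((hf.continuous_weightMellin_dual hL c).mul
      ((continuous_const_cpow_ofReal hx).comp (by fun_prop)))
  have hi : Integrable fun t : ℝ => dualFactor K f L x (c + t * I) :=
    (h1.const_mul _).mono' hcont.aestronglyMeasurable (Eventually.of_forall hle)
  refine ⟨hi, (integral_mono hi.norm (h1.const_mul _) hle).trans ?_⟩
  rw [integral_const_mul]
  gcongr

/-- Shifting the contour past all poles and applying the functional equation turns the local mean
into an integral of the dual Dirichlet series against the kernel. -/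
lemma localMean_eq_integral (hd : 0 < d) {a b : ℕ → ℂ} {l m : ℕ → ℝ} {σ : ℝ}
    (hl : IsFrequency l) (hm : IsFrequency m) (ha : AbsConvergent a l σ)
    (hb : AbsConvergent b m σ) {phi psi : ℂ → ℂ} (hphi : IsContinuation phi a l σ)
    (hpsi : IsContinuation psi b m σ) {ω : ℂ} (hfe : G.FunctionalEquation ω phi psi)
    (hdecay : G.VerticalDecay phi) {f : ℝ → ℝ} (hf : IsTest f) {R₀ : ℝ} (hR₀ : 0 < R₀)
    (hsing₀ : G.SingularitiesInDisk phi R₀) {c : ℝ} (hcσ : σ < c) (hcR : R₀ + 1 < c)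
    (hc : G.IsFar c) {R : ℝ} (hR : 0 < R) (hsing : G.SingularitiesInDisk phi R) {L : ℝ}
    (hL : 2 ≤ L) {x : ℝ} (hx : 0 < x) :
    localMean a l phi R (weight f L) x = ω / (2 * Real.pi) *
      ∫ t : ℝ, dirichlet b m (c + t * I) * dualFactor G.kernel f L x (c + t * I) := by
  obtain ⟨p, g, hg, hp, heq⟩ := exists_entire_numerator hphi.meromorphic
    (fun s hs => G.continuation_order_nonneg hphi.meromorphic (hsing s hs))
  have hpR : ∀ q ∈ p, ‖q‖ < R := fun q hq => by
    by_contra hcon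
    exact absurd (G.continuation_order_nonneg hphi.meromorphic (hsing q (not_lt.mp hcon)))
      (not_le.mpr (hp q hq))
  have hpR₀ : ∀ q ∈ p, ‖q‖ < R₀ := fun q hq => by
    by_contra hcon
    exact absurd (G.continuation_order_nonneg hphi.meromorphic (hsing₀ q (not_lt.mp hcon)))
      (not_le.mpr (hp q hq))
  set W : ℂ → ℂ := fun s => weightMellin f L s * (x : ℂ) ^ s with hW
  have hx0 : (x : ℂ) ≠ 0 := by exact_mod_cast hx.ne'
  have hWd : Differentiable ℂ W := by
    refine (hf.differentiable_weightMellin hL).mul fun s => ?_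
    exact (differentiableAt_id.const_cpow (Or.inl hx0))
  have hcpos := hc.pos
  -- the right line
  obtain ⟨hi₁, hsum⟩ := ha.tsum_weight_eq hl hcσ.le hf hL hx
  have hae := ae_line_of_codiscrete heq
  have hright : (fun t : ℝ => g (c + t * I) * W (c + t * I) / rootProd p (c + t * I)) =ᵐ[volume]
      fun t : ℝ => dirichlet a l (c + t * I) *
        (weightMellin f L (c + t * I) * (x : ℂ) ^ (c + t * I : ℂ)) := by
    filter_upwards [hae c] with t ht
    rw [mul_div_right_comm, ← ht, hphi.eq_series _ (by simpa using hcσ)]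
    rfl
  -- the left line, run through backwards
  obtain ⟨Kc, -, hKb⟩ := G.exists_norm_kernel_le hd hc
  have hs52 := hc.shift
  obtain ⟨_, -, hdual⟩ := exists_integral_norm_dualFactor_le hf c
    (e := 2 * G.A * c + G.shift.re) (by linarith)
  have hi₂ := hb.integrable_dirichlet_mul hm hcσ.le
    (hdual G.kernel Kc (G.continuous_kernel_line hc.betat) hKb L x hL hx).1
  have hleft : (fun t : ℝ => g (1 - (c + t * I)) * W (1 - (c + t * I)) /
        rootProd p (1 - (c + t * I))) =ᵐ[volume]
      fun t : ℝ => ω * (dirichlet b m (c + t * I) * dualFactor G.kernel f L x (c + t * I)) := by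
    have hneg : ∀ {P : ℂ → Prop}, (∀ᶠ s in codiscrete ℂ, P s) →
        ∀ᵐ t : ℝ, P (1 - (c + t * I)) := fun {P} h => by
      have h1 := ae_line_of_codiscrete h (1 - c)
      have h2 := (Measure.measurePreserving_neg (volume : Measure ℝ)).quasiMeasurePreserving.ae h1
      filter_upwards [h2] with t ht
      rwa [one_sub_line]
    filter_upwards [hneg heq, hneg hfe, hneg G.eventually_Delta_ne_zero] with t h1 h2 h3
    rw [mul_div_right_comm, ← h1]
    have h4 : phi (1 - (c + t * I)) = ω * G.kernel (c + t * I) * psi (c + t * I) := by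
      rw [sub_sub_cancel] at h2
      rw [kernel, eq_comm, ← mul_right_inj' h3, h2]
      field_simp
    rw [h4, hpsi.eq_series _ (by simpa using hcσ), hW]
    simp only [dualFactor, dirichlet]
    ring
  have hleft' : ∀ t : ℝ, g (((1 - c : ℝ) : ℂ) + ((-t : ℝ) : ℂ) * I) *
      W (((1 - c : ℝ) : ℂ) + ((-t : ℝ) : ℂ) * I) /
        rootProd p (((1 - c : ℝ) : ℂ) + ((-t : ℝ) : ℂ) * I) =
      g (1 - (c + t * I)) * W (1 - (c + t * I)) / rootProd p (1 - (c + t * I)) := by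
    intro t
    rw [one_sub_line]
  have hintL : Integrable fun t : ℝ => g ((1 - c : ℝ) + t * I) * W ((1 - c : ℝ) + t * I) /
      rootProd p ((1 - c : ℝ) + t * I) := by
    have h1 := ((hi₂.const_mul ω).congr hleft.symm)
    simp only [← hleft'] at h1
    simpa only [neg_neg] using h1.comp_neg
  have hvalL : ∫ t : ℝ, g ((1 - c : ℝ) + t * I) * W ((1 - c : ℝ) + t * I) /
      rootProd p ((1 - c : ℝ) + t * I) =
      ω * ∫ t : ℝ, dirichlet b m (c + t * I) * dualFactor G.kernel f L x (c + t * I) := by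
    rw [← integral_const_mul, ← integral_congr_ae hleft, ← integral_neg_eq_self]
    simp only [hleft']
  -- growth between the lines
  have hgr : ExpGrowth fun s => g s / rootProd p s :=
    (VerticalDecay.expGrowth G hdecay).of_eventuallyEq_codiscrete heq (R := R) fun s hs =>
      hg.continuous.continuousAt.div (differentiable_rootProd p).continuous.continuousAt
        (rootProd_ne_zero fun h => absurd (hpR s h) (not_lt.mpr hs))
  have hWg : ExpGrowth W := by
    obtain ⟨M, hM, hMb⟩ := hf.exists_norm_weightMellin_le_strip
    intro u v
    obtain ⟨N, hN⟩ := (isCompact_Icc (a := u) (b := v)).exists_bound_of_continuousOn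
      (f := fun r : ℝ => M * 2 ^ |r - 1| * 2 / L * x ^ r) (by
        have h1 : Continuous fun r : ℝ => x ^ r := Real.continuous_const_rpow hx.ne'
        have h2 : Continuous fun r : ℝ => (2 : ℝ) ^ |r - 1| :=
          (Real.continuous_const_rpow two_ne_zero).comp (by fun_prop)
        fun_prop)
    refine ⟨max N 0, 0, le_max_right _ _, fun s h1 h2 _ => ?_⟩
    have h3 := (le_abs_self _).trans (hN s.re ⟨h1, h2⟩)
    have h4 : ‖W s‖ ≤ max N 0 := by
      rw [hW, norm_mul, norm_cpow_eq_rpow_re_of_pos hx]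
      refine le_trans ?_ (h3.trans (le_max_left _ _))
      gcongr
      exact hMb L hL s
    refine h4.trans (le_mul_of_one_le_right (le_max_right _ _) (Real.one_le_exp ?_))
    exact mul_nonneg (le_max_right _ _) (abs_nonneg _)
  obtain ⟨C, T, -, hCT⟩ := (hgr.mul hWg) (1 - c) c
  have hpstrip : ∀ q ∈ p, 1 - c < q.re ∧ q.re < c ∧ ‖q‖ < R := fun q hq => by
    have h1 := abs_le.mp ((abs_re_le_norm q).trans (hpR₀ q hq).le)
    exact ⟨by linarith, by linarith, hpR q hq⟩
  have h1c : 1 - c ≤ c := by linarith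
  have hshift := line_sub_line h1c hR hpstrip (G := fun s => g s * W s) (hg.mul hWd)
    (fun s h1 h2 h3 => by
      have := hCT s h1 h2 h3
      rwa [mul_div_right_comm]) hintL (hi₁.congr hright.symm)
  rw [integral_congr_ae hright, hvalL] at hshift
  have hcirc : ∮ s in C(0, R), phi s * mellin (fun u => (weight f L u : ℂ)) s * (x : ℂ) ^ s =
      ∮ s in C(0, R), g s * W s / rootProd p s := by
    refine circleIntegral.circleIntegral_congr_codiscreteWithin ?_ hR.ne'
    filter_upwards [codiscreteWithin_mono (subset_univ _) heq] with s hs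
    change phi s * weightMellin f L s * (x : ℂ) ^ s = _
    rw [hs, hW]
    ring
  have hpi : (Real.pi : ℂ) ≠ 0 := ofReal_ne_zero.mpr Real.pi_ne_zero
  have key : ∀ V₁ V₂ : ℂ, 1 / (2 * Real.pi) * V₁ -
      (2 * Real.pi * I)⁻¹ * (I * V₁ - I * (ω * V₂)) = ω / (2 * Real.pi) * V₂ := by
    intro V₁ V₂
    field_simp
    ring
  rw [localMean, residualTerm, hcirc, ← hshift, hsum]
  exact key _ _

end GammaParams

/-! ### Summing the cosine integrals -/

/-- Repeated integration by parts makes the series of cosine integrals, weighted by any power of the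
frequencies, absolutely convergent with sum `O(L⁻¹)` as soon as `L ≪ x^q`. -/
lemma exists_tsum_norm_cosInt_le {b : ℕ → ℂ} {m : ℕ → ℝ} {σ : ℝ} (hb : AbsConvergent b m σ)
    (hm : IsFrequency m) {f : ℝ → ℝ} (hf : IsTest f) {q h D : ℝ} (hq : 0 < q) (hh : 0 < h)
    (a k : ℂ) : ∃ C : ℝ, 0 ≤ C ∧ ∀ L x : ℝ, 2 ≤ L → 0 < x → L ≤ D * x ^ q →
      Summable (fun n => ‖b n * ((m n : ℂ) ^ a * cosInt f L a k ((h * m n * x) ^ q) q)‖) ∧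
      ∑' n, ‖b n * ((m n : ℂ) ^ a * cosInt f L a k ((h * m n * x) ^ q) q)‖ ≤ C * L⁻¹ := by
  obtain ⟨N, hN⟩ := exists_nat_ge ((σ + a.re) / q)
  rw [div_le_iff₀ hq] at hN
  obtain ⟨C, hC, hcos⟩ := hf.exists_norm_cosInt_le N hq a k
  have hs := hb.summable_norm hm (c := q * N - a.re) (by linarith)
  set S := ∑' n, ‖b n‖ * m n ^ (-(q * N - a.re)) with hS
  have hS0 : 0 ≤ S := tsum_nonneg fun n =>
    mul_nonneg (norm_nonneg _) (Real.rpow_nonneg (hm.pos n).le _)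
  refine ⟨|C * (D * h ^ (-q)) ^ N| * S, by positivity, fun L x hL hx hLx => ?_⟩
  have hL0 : 0 < L := by linarith
  have hterm : ∀ n, ‖b n * ((m n : ℂ) ^ a * cosInt f L a k ((h * m n * x) ^ q) q)‖ ≤
      |C * (D * h ^ (-q)) ^ N| * L⁻¹ * (‖b n‖ * m n ^ (-(q * N - a.re))) := by
    intro n
    have hmn := hm.pos n
    have hY : 0 < (h * m n * x) ^ q := by positivity
    have hratio : L / (h * m n * x) ^ q ≤ D * h ^ (-q) * m n ^ (-q) := by
      rw [div_le_iff₀ hY, Real.mul_rpow (by positivity) hx.le, Real.mul_rpow hh.le hmn.le,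
        Real.rpow_neg hh.le, Real.rpow_neg hmn.le]
      have h1 : 0 < h ^ q := by positivity
      have h2 : 0 < m n ^ q := by positivity
      refine hLx.trans (le_of_eq ?_)
      field_simp
    have hpow : m n ^ a.re * (m n ^ (-q)) ^ N = m n ^ (-(q * N - a.re)) := by
      rw [← Real.rpow_mul_natCast hmn.le, ← Real.rpow_add hmn]
      congr 1
      ring
    rw [norm_mul, norm_mul, norm_cpow_eq_rpow_re_of_pos hmn]
    calc ‖b n‖ * (m n ^ a.re * ‖cosInt f L a k ((h * m n * x) ^ q) q‖)
        ≤ ‖b n‖ * (m n ^ a.re * (C * (L⁻¹ * (D * h ^ (-q) * m n ^ (-q)) ^ N))) := by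
          refine mul_le_mul_of_nonneg_left (mul_le_mul_of_nonneg_left
            ((hcos L _ hL hY).trans ?_) (by positivity)) (norm_nonneg _)
          gcongr
      _ = C * (D * h ^ (-q)) ^ N * L⁻¹ * (‖b n‖ * (m n ^ a.re * (m n ^ (-q)) ^ N)) := by
          rw [mul_pow]; ring
      _ ≤ _ := by
          rw [hpow]
          gcongr
          exact le_abs_self _
  have hsum := (hs.mul_left (|C * (D * h ^ (-q)) ^ N| * L⁻¹))
  refine ⟨Summable.of_nonneg_of_le (fun n => norm_nonneg _) hterm hsum, ?_⟩
  refine ((Summable.of_nonneg_of_le (fun n => norm_nonneg _) hterm hsum).tsum_le_tsum hterm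
    hsum).trans (le_of_eq ?_)
  rw [tsum_mul_left]
  ring

namespace GammaParams

variable {d : ℕ} (G : GammaParams d)

/-! ### The model kernel as a sum of cosine transforms -/

lemma model₂_eq (hd : 0 < d) (κ : ℂ) {s : ℂ} (hs : 2 * G.A * s + G.shift - 1 ≠ 0) :
    G.model₂ κ s = G.e0 * (G.h : ℂ) ^ (-s) * (gammaCos (2 * G.A) G.a G.k s +
      κ * gammaCos (2 * G.A) (G.a - 1 / (2 * G.A)) (G.k + 1 / 2) s) := by
  have hA : (G.A : ℂ) ≠ 0 := by exact_mod_cast (G.A_pos hd).ne'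
  have hw : (2 * G.A : ℝ) * (s + G.a) = 2 * G.A * s + G.shift := by
    rw [shift]; push_cast; ring
  have hw' : (2 * G.A : ℝ) * (s + (G.a - 1 / (2 * G.A))) = 2 * G.A * s + G.shift - 1 := by
    rw [shift]; push_cast; field_simp; ring
  rw [model₂, model, gammaCos, gammaCos, hw, hw', phase]
  have hG : Gamma (2 * G.A * s + G.shift) =
      (2 * G.A * s + G.shift - 1) * Gamma (2 * G.A * s + G.shift - 1) := by
    rw [← Gamma_add_one _ hs, sub_add_cancel]
  have hc : (Real.pi : ℂ) * ((2 * G.A * s + G.shift - 1) / 2 + (G.k + 1 / 2)) =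
      Real.pi * ((2 * G.A * s + G.shift) / 2 + G.k) := by ring
  rw [hc, hG]
  generalize (2 * G.A * s + G.shift - 1 : ℂ) = w at *
  field_simp

/-- The `n`-th integral of the model kernel is a combination of two cosine integrals. -/
lemma integral_model₂ (hd : 0 < d) {f : ℝ → ℝ} (hf : IsTest f) {L : ℝ} (hL : 2 ≤ L) {c : ℝ}
    (hc : G.IsFar c) (κ : ℂ) {x μ : ℝ} (hx : 0 < x) (hμ : 0 < μ) :
    1 / (2 * Real.pi) * ∫ t : ℝ, (μ : ℂ) ^ (-(c + t * I : ℂ)) *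
        dualFactor (G.model₂ κ) f L x (c + t * I) =
      G.e0 / (2 * G.A) * (x * ((G.h * x : ℝ) : ℂ) ^ G.a) *
        ((μ : ℂ) ^ G.a * cosInt f L G.a G.k ((G.h * μ * x) ^ (1 / (2 * G.A))) (1 / (2 * G.A))) +
      G.e0 * κ / (2 * G.A) * (x * ((G.h * x : ℝ) : ℂ) ^ (G.a - 1 / (2 * G.A))) *
        ((μ : ℂ) ^ (G.a - 1 / (2 * G.A)) * cosInt f L (G.a - 1 / (2 * G.A)) (G.k + 1 / 2)
          ((G.h * μ * x) ^ (1 / (2 * G.A))) (1 / (2 * G.A))) := by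
  have hA := G.A_pos hd
  have hh := G.h_pos hd
  have hs := hc.shift
  have hy : 0 < G.h * μ * x := by positivity
  have hre : G.shift.re = 2 * G.A * G.a.re := by
    rw [shift, show (2 * G.A : ℂ) = ((2 * G.A : ℝ) : ℂ) by push_cast; rfl, re_ofReal_mul]
  have hre' : (G.a - 1 / (2 * G.A)).re = G.a.re - 1 / (2 * G.A) := by
    rw [sub_re, show (1 / (2 * G.A) : ℂ) = ((1 / (2 * G.A) : ℝ) : ℂ) by push_cast; rfl, ofReal_re]
  have hc1 : 0 < 2 * G.A * (c + G.a.re) := by rw [hre] at hs; linarith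
  have hc2 : 0 < 2 * G.A * (c + (G.a - 1 / (2 * G.A)).re) := by
    rw [hre']
    rw [hre] at hs
    have : 2 * G.A * (c + (G.a.re - 1 / (2 * G.A))) = 2 * G.A * c + 2 * G.A * G.a.re - 1 := by
      field_simp
      ring
    linarith
  obtain ⟨i1, e1⟩ := hf.integral_gammaCos hL (m := 2 * G.A) (by positivity) hc1 G.k hy
  obtain ⟨i2, e2⟩ := hf.integral_gammaCos hL (m := 2 * G.A) (by positivity) hc2 (G.k + 1 / 2) hy
  have hx0 : (x : ℂ) ≠ 0 := by exact_mod_cast hx.ne'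
  have hsplit : ∀ z : ℂ, ((G.h * μ * x : ℝ) : ℂ) ^ z = ((G.h * x : ℝ) : ℂ) ^ z * (μ : ℂ) ^ z := by
    intro z
    rw [mul_right_comm, ofReal_mul, mul_cpow_ofReal_nonneg (by positivity) hμ.le]
  have hint : ∀ t : ℝ, (μ : ℂ) ^ (-(c + t * I : ℂ)) * dualFactor (G.model₂ κ) f L x (c + t * I) =
      G.e0 * x * (weightMellin f L (1 - (c + t * I)) * (((G.h * μ * x : ℝ) : ℂ) ^ (-(c + t * I : ℂ)) *
        gammaCos (2 * G.A) G.a G.k (c + t * I))) +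
      G.e0 * x * κ * (weightMellin f L (1 - (c + t * I)) *
        (((G.h * μ * x : ℝ) : ℂ) ^ (-(c + t * I : ℂ)) *
          gammaCos (2 * G.A) (G.a - 1 / (2 * G.A)) (G.k + 1 / 2) (c + t * I))) := by
    intro t
    have hne : (2 * G.A * (c + t * I) + G.shift - 1 : ℂ) ≠ 0 := by
      intro h0
      have := congrArg Complex.re h0
      rw [sub_re, add_re, show (2 * G.A : ℂ) = ((2 * G.A : ℝ) : ℂ) by push_cast; rfl,
        re_ofReal_mul] at this
      simp at this
      linarith
    rw [dualFactor, G.model₂_eq hd κ hne, hsplit, ofReal_mul, mul_cpow_ofReal_nonneg hh.le hx.le,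
      sub_eq_add_neg (1 : ℂ) (c + t * I), cpow_add _ _ hx0, cpow_one]
    ring
  have hsum := integral_add (i1.const_mul (G.e0 * x)) (i2.const_mul (G.e0 * x * κ))
  rw [integral_const_mul, integral_const_mul] at hsum
  simp only [hint]
  rw [hsum, mul_add, mul_left_comm, mul_left_comm _ (G.e0 * x * κ), e1, e2, hsplit, hsplit]
  push_cast
  ring

/-- The terms of the Voronoi series as cosine integrals. -/
lemma voronoiTerm_eq (hd : 0 < d) {b : ℕ → ℂ} {m : ℕ → ℝ} (hm : IsFrequency m) (f : ℝ → ℝ) (L : ℝ)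
    {x : ℝ} (hx : 0 < x) (n : ℕ) :
    G.voronoiTerm b m (weight f L) x n = b n * ((m n : ℂ) ^ G.a *
      cosInt f L G.a G.k ((G.h * m n * x) ^ (1 / (2 * G.A))) (1 / (2 * G.A))) := by
  have hh := G.h_pos hd
  have hmn := hm.pos n
  have ha : (G.theta : ℂ) - I * G.xi = -G.a := by
    rw [theta, xi]
    nth_rewrite 3 [← re_add_im G.a]
    push_cast
    ring
  rw [voronoiTerm, ha, cpow_neg, div_inv_eq_mul, mul_assoc, cosInt]
  congr 2
  refine setIntegral_congr_fun measurableSet_Ioi fun u hu => ?_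
  have hu' : (0 : ℝ) < u := hu
  have hu0 : (u : ℂ) ≠ 0 := by exact_mod_cast hu'.ne'
  have h1 : ((weight f L u / u ^ G.theta : ℝ) : ℂ) * (u : ℂ) ^ (I * G.xi) =
      (weight f L u : ℂ) * (u : ℂ) ^ G.a := by
    rw [div_eq_mul_inv, ← Real.rpow_neg hu'.le, ofReal_mul, ofReal_cpow hu'.le, mul_assoc,
      ← cpow_add _ _ hu0]
    congr 2
    rw [ofReal_neg, ← neg_neg G.a, ← ha]
    ring
  rw [h1, Real.mul_rpow (by positivity) hu'.le]

lemma mainTerm_eq (hd : 0 < d) {b : ℕ → ℂ} {m : ℕ → ℝ} (ω : ℂ) (φ : ℝ → ℝ) {x : ℝ} (hx : 0 < x) :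
    G.mainTerm ω b m φ x = ω * (G.e0 / (2 * G.A) * (x * ((G.h * x : ℝ) : ℂ) ^ G.a)) *
      ∑' n, G.voronoiTerm b m φ x n := by
  have hh := G.h_pos hd
  have hh0 : (G.h : ℂ) ≠ 0 := by exact_mod_cast hh.ne'
  have hA0 : (G.A : ℂ) ≠ 0 := by exact_mod_cast (G.A_pos hd).ne'
  have hhx : ((G.h * x : ℝ) : ℂ) ≠ 0 := by exact_mod_cast (mul_pos hh hx).ne'
  have ha : 1 - (G.theta : ℂ) + I * G.xi = 1 + G.a := by
    rw [theta, xi]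
    nth_rewrite 3 [← re_add_im G.a]
    push_cast
    ring
  rw [mainTerm, ha, cpow_add _ _ hhx, cpow_one, ofReal_mul]
  field_simp

end GammaParams

/-! ### Evaluation of the dual integral -/

namespace GammaParams

variable {d : ℕ} (G : GammaParams d)

/-- The integral over the dual line is the leading term up to a relative error `x^{-1/(2A)}`: the
first correction of the model kernel gives cosine integrals of lower order, and the remainder of
the kernel is estimated trivially. -/
lemma exists_dual_integral_sub_mainTerm_le (hd : 0 < d) {b : ℕ → ℂ} {m : ℕ → ℝ} {σ c : ℝ}
    (hm : IsFrequency m) (hb : AbsConvergent b m σ) (hcσ : σ ≤ c) (hc : G.IsFar c) {f : ℝ → ℝ}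
    (hf : IsTest f) {D : ℝ} (hD : 0 < D) {ω : ℂ} (hω : ‖ω‖ = 1) :
    ∃ C : ℝ, 0 ≤ C ∧ ∀ L x : ℝ, 2 ≤ L → 1 ≤ x → L ≤ D * x ^ (1 / (2 * G.A)) →
      Summable (G.voronoiTerm b m (weight f L) x) ∧
      ‖ω / (2 * Real.pi) * (∫ t : ℝ, dirichlet b m (c + t * I) *
          dualFactor G.kernel f L x (c + t * I)) - G.mainTerm ω b m (weight f L) x‖ ≤
        C * (L⁻¹ * x ^ (1 - G.theta - 1 / (2 * G.A))) ∧
      ‖G.mainTerm ω b m (weight f L) x‖ ≤ C * (L⁻¹ * x ^ (1 - G.theta)) := by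
  have hA := G.A_pos hd
  have hh := G.h_pos hd
  have hs := hc.shift
  have hpi := Real.pi_pos
  set q : ℝ := 1 / (2 * G.A) with hq
  have hq0 : 0 < q := by positivity
  obtain ⟨κ, K, hK, hrem⟩ := G.exists_kernel_sub_model₂_le hd hc
  obtain ⟨Kc, -, hker⟩ := G.exists_norm_kernel_le hd hc
  obtain ⟨_, -, hdual⟩ := exists_integral_norm_dualFactor_le hf c
    (e := 2 * G.A * c + G.shift.re) (by linarith)
  set e : ℝ := 2 * G.A * c + G.shift.re - 5 / 2 with he
  obtain ⟨Cr, hCr, hdualr⟩ := exists_integral_norm_dualFactor_le hf c (e := e) (by linarith)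
  obtain ⟨C₁, hC₁, hsum₁⟩ := exists_tsum_norm_cosInt_le hb hm hf (D := D) hq0 hh G.a G.k
  obtain ⟨C₂, hC₂, hsum₂⟩ := exists_tsum_norm_cosInt_le hb hm hf (D := D) hq0 hh
    (G.a - 1 / (2 * G.A)) (G.k + 1 / 2)
  set S := ∑' n, ‖b n‖ * m n ^ (-c) with hS
  have hS0 : 0 ≤ S := tsum_nonneg fun n =>
    mul_nonneg (norm_nonneg _) (Real.rpow_nonneg (hm.pos n).le _)
  have hre' : (G.a - 1 / (2 * G.A)).re = G.a.re - q := by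
    rw [sub_re, show (1 / (2 * G.A) : ℂ) = ((1 / (2 * G.A) : ℝ) : ℂ) by push_cast; rfl, ofReal_re]
  set M₁ : ℝ := ‖G.e0 / (2 * G.A)‖ * G.h ^ G.a.re * C₁ with hM₁
  set M₂ : ℝ := ‖G.e0 * κ / (2 * G.A)‖ * G.h ^ (G.a.re - q) * C₂ with hM₂
  set M₃ : ℝ := 1 / (2 * Real.pi) * (S * (K * (Cr * D ^ (e + 1)))) with hM₃
  have hM₁0 : 0 ≤ M₁ := by positivity
  have hM₂0 : 0 ≤ M₂ := by positivity
  have hM₃0 : 0 ≤ M₃ := by positivity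
  refine ⟨M₁ + M₂ + M₃, by positivity, fun L x hL hx hLx => ?_⟩
  have hx0 : 0 < x := by linarith
  have hL0 : 0 < L := by linarith
  obtain ⟨s₁, b₁⟩ := hsum₁ L x hL hx0 hLx
  obtain ⟨s₂, b₂⟩ := hsum₂ L x hL hx0 hLx
  have hvor : G.voronoiTerm b m (weight f L) x = fun n => b n * ((m n : ℂ) ^ G.a *
      cosInt f L G.a G.k ((G.h * m n * x) ^ q) q) := funext (G.voronoiTerm_eq hd hm f L hx0)
  have hmain := G.mainTerm_eq hd (b := b) (m := m) ω (weight f L) hx0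
  rw [hvor] at hmain
  set T₁ : ℕ → ℂ := fun n => b n * ((m n : ℂ) ^ G.a *
      cosInt f L G.a G.k ((G.h * m n * x) ^ q) q) with hT₁
  set T₂ : ℕ → ℂ := fun n => b n * ((m n : ℂ) ^ (G.a - 1 / (2 * G.A)) *
      cosInt f L (G.a - 1 / (2 * G.A)) (G.k + 1 / 2) ((G.h * m n * x) ^ q) q) with hT₂
  -- `c₁ ∑ T₁` is the leading term, `c₂ ∑ T₂` comes from the first correction of the model
  set c₁ : ℂ := G.e0 / (2 * G.A) * (x * ((G.h * x : ℝ) : ℂ) ^ G.a) with hc₁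
  set c₂ : ℂ := G.e0 * κ / (2 * G.A) * (x * ((G.h * x : ℝ) : ℂ) ^ (G.a - 1 / (2 * G.A))) with hc₂
  have hxnorm : ∀ z : ℂ, ‖(x : ℂ) * ((G.h * x : ℝ) : ℂ) ^ z‖ = G.h ^ z.re * x ^ (1 + z.re) := by
    intro z
    rw [norm_mul, norm_real, Real.norm_of_nonneg hx0.le,
      norm_cpow_eq_rpow_re_of_pos (mul_pos hh hx0), Real.mul_rpow hh.le hx0.le,
      Real.rpow_add hx0, Real.rpow_one]
    ring
  have n₁ : ‖c₁‖ = ‖G.e0 / (2 * G.A)‖ * (G.h ^ G.a.re * x ^ (1 - G.theta)) := by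
    rw [hc₁, norm_mul, hxnorm, theta, sub_neg_eq_add]
  have n₂ : ‖c₂‖ = ‖G.e0 * κ / (2 * G.A)‖ * (G.h ^ (G.a.re - q) * x ^ (1 - G.theta - q)) := by
    rw [hc₂, norm_mul, hxnorm, hre', theta, sub_neg_eq_add, add_sub_assoc]
  -- the kernel is the model plus a remainder
  obtain ⟨ik, -⟩ := hdual G.kernel Kc (G.continuous_kernel_line hc.betat) hker L x hL hx0
  obtain ⟨ir, br⟩ := hdualr (fun s => G.kernel s - G.model₂ κ s) K
    ((G.continuous_kernel_line hc.betat).sub (G.continuous_model₂_line hd (by linarith) κ))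
    hrem L x hL hx0
  have hlin : ∀ s, dualFactor G.kernel f L x s - dualFactor (fun s => G.kernel s - G.model₂ κ s)
      f L x s = dualFactor (G.model₂ κ) f L x s := fun s => by
    simp only [dualFactor]; ring
  have im : Integrable fun t : ℝ => dualFactor (G.model₂ κ) f L x (c + t * I) :=
    (ik.sub ir).congr (Eventually.of_forall fun t => hlin _)
  have hmodel : 1 / (2 * Real.pi) * (∫ t : ℝ, dirichlet b m (c + t * I) *
      dualFactor (G.model₂ κ) f L x (c + t * I)) = c₁ * ∑' n, T₁ n + c₂ * ∑' n, T₂ n := by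
    have h1 := (hb.hasSum_integral_dirichlet_mul hm hcσ im).mul_left (1 / (2 * Real.pi) : ℂ)
    have h2 := (s₁.of_norm.hasSum.mul_left c₁).add (s₂.of_norm.hasSum.mul_left c₂)
    refine h1.unique (h2.congr_fun fun n => ?_)
    rw [mul_left_comm, G.integral_model₂ hd hf hL hc κ hx0 (hm.pos n)]
    ring
  have hsplit : ∫ t : ℝ, dirichlet b m (c + t * I) * dualFactor G.kernel f L x (c + t * I) =
      (∫ t : ℝ, dirichlet b m (c + t * I) * dualFactor (G.model₂ κ) f L x (c + t * I)) +
      ∫ t : ℝ, dirichlet b m (c + t * I) *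
        dualFactor (fun s => G.kernel s - G.model₂ κ s) f L x (c + t * I) := by
    rw [← integral_add (hb.integrable_dirichlet_mul hm hcσ im)
      (hb.integrable_dirichlet_mul hm hcσ ir)]
    congr 1
    ext t
    rw [← hlin]
    ring
  have t₁ : ‖∑' n, T₁ n‖ ≤ C₁ * L⁻¹ := (norm_tsum_le_tsum_norm s₁).trans b₁
  have t₂ : ‖∑' n, T₂ n‖ ≤ C₂ * L⁻¹ := (norm_tsum_le_tsum_norm s₂).trans b₂
  have hr := hb.norm_integral_dirichlet_mul_le hm hcσ ir
  set V := ∫ t : ℝ, dirichlet b m (c + t * I) *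
    dualFactor (fun s => G.kernel s - G.model₂ κ s) f L x (c + t * I) with hV
  -- the size of the remainder
  have hVle : ‖1 / (2 * (Real.pi : ℂ)) * V‖ ≤ M₃ * (L⁻¹ * x ^ (1 - G.theta - q)) := by
    have hLe : L ^ e ≤ L⁻¹ * (D ^ (e + 1) * x ^ (q * (e + 1))) := by
      have h1 : L ^ (e + 1) ≤ D ^ (e + 1) * x ^ (q * (e + 1)) := by
        rw [Real.rpow_mul hx0.le, ← Real.mul_rpow hD.le (by positivity)]
        exact Real.rpow_le_rpow hL0.le hLx (by linarith)
      rw [inv_mul_eq_div, le_div_iff₀ hL0, ← Real.rpow_add_one hL0.ne']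
      exact h1
    have hexp : x ^ (1 - c) * x ^ (q * (e + 1)) ≤ x ^ (1 - G.theta - q) := by
      rw [← Real.rpow_add hx0]
      refine Real.rpow_le_rpow_of_exponent_le hx ?_
      have h1 : q * (2 * G.A) = 1 := by rw [hq]; field_simp
      have h2 : q * (e + 1) = c - G.theta - 3 / 2 * q := by
        rw [he, G.shift_re]
        linear_combination (c - G.theta) * h1
      linarith
    have hnorm : ‖1 / (2 * (Real.pi : ℂ))‖ = 1 / (2 * Real.pi) := by
      rw [show (1 / (2 * (Real.pi : ℂ))) = ((1 / (2 * Real.pi) : ℝ) : ℂ) by push_cast; rfl,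
        norm_real, Real.norm_of_nonneg (by positivity)]
    rw [norm_mul, hnorm]
    have hxc : 0 < x ^ (1 - c) := by positivity
    calc 1 / (2 * Real.pi) * ‖V‖
        ≤ 1 / (2 * Real.pi) * (S * (K * x ^ (1 - c) *
            (Cr * (L⁻¹ * (D ^ (e + 1) * x ^ (q * (e + 1))))))) := by
          refine mul_le_mul_of_nonneg_left (hr.trans ?_) (by positivity)
          refine mul_le_mul_of_nonneg_left (br.trans ?_) hS0
          gcongr
      _ = M₃ * (L⁻¹ * (x ^ (1 - c) * x ^ (q * (e + 1)))) := by rw [hM₃]; ring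
      _ ≤ _ := by gcongr
  have hdiff : ω / (2 * Real.pi) * (∫ t : ℝ, dirichlet b m (c + t * I) *
      dualFactor G.kernel f L x (c + t * I)) - G.mainTerm ω b m (weight f L) x =
      ω * (c₂ * ∑' n, T₂ n + 1 / (2 * Real.pi) * V) := by
    rw [hsplit, hmain]
    linear_combination ω * hmodel
  have hX₁ : 0 < L⁻¹ * x ^ (1 - G.theta) := by positivity
  have hX₂ : 0 < L⁻¹ * x ^ (1 - G.theta - q) := by positivity
  refine ⟨hvor ▸ s₁.of_norm, ?_, ?_⟩
  · rw [hdiff, norm_mul, hω, one_mul]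
    have h2 : ‖c₂ * ∑' n, T₂ n‖ ≤ M₂ * (L⁻¹ * x ^ (1 - G.theta - q)) := by
      rw [norm_mul, n₂]
      calc _ ≤ ‖G.e0 * κ / (2 * G.A)‖ * (G.h ^ (G.a.re - q) * x ^ (1 - G.theta - q)) *
            (C₂ * L⁻¹) := by gcongr
        _ = _ := by rw [hM₂]; ring
    refine (norm_add_le _ _).trans ((add_le_add h2 hVle).trans ?_)
    rw [← add_mul]
    exact mul_le_mul_of_nonneg_right (by linarith) hX₂.le
  · rw [hmain, norm_mul, norm_mul, hω, one_mul, n₁]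
    calc _ ≤ ‖G.e0 / (2 * G.A)‖ * (G.h ^ G.a.re * x ^ (1 - G.theta)) * (C₁ * L⁻¹) := by gcongr
      _ = M₁ * (L⁻¹ * x ^ (1 - G.theta)) := by rw [hM₁]; ring
      _ ≤ _ := by gcongr; linarith

end GammaParams
end Voronoi

end

theorem theorem1
    (a b : ℕ → ℂ) (lam mu : ℕ → ℝ)
    (ha : a 0 ≠ 0) (hb : b 0 ≠ 0)
    (hlam : Voronoi.IsFrequency lam) (hmu : Voronoi.IsFrequency mu)
    (σs : ℝ) (hσs : 0 < σs)
    (hca : Voronoi.AbsConvergent a lam σs) (hcb : Voronoi.AbsConvergent b mu σs)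
    (phi psi : ℂ → ℂ)
    (hphi : Voronoi.IsContinuation phi a lam σs) (hpsi : Voronoi.IsContinuation psi b mu σs)
    (d : ℕ) (hd : 0 < d) (G : Voronoi.GammaParams d)
    (ω : ℂ) (hω : ‖ω‖ = 1)
    (hfe : G.FunctionalEquation ω phi psi)
    (hdecay : G.VerticalDecay phi)
    (φ₀ : ℝ → ℝ) (hφ₀ : Voronoi.IsBump φ₀) (δ : ℝ) (hδ : 0 < δ) :
    G.e0 ≠ 0 ∧
    ∃ C : ℝ, 0 < C ∧ ∃ X₀ : ℝ, 0 < X₀ ∧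
      ∀ R : ℝ, 0 < R → G.SingularitiesInDisk phi R →
      ∀ X : ℝ, X₀ ≤ X → ∀ x ∈ Set.Icc X (4 * X),
        Summable (G.voronoiTerm b mu (Voronoi.weight φ₀ (G.L δ X)) x) ∧
        ‖Voronoi.localMean a lam phi R (Voronoi.weight φ₀ (G.L δ X)) x
            - G.mainTerm ω b mu (Voronoi.weight φ₀ (G.L δ X)) x‖
          ≤ C * ((G.L δ X)⁻¹ * x ^ (1 - G.theta - 1 / (2 * G.A))) ∧
        ‖Voronoi.localMean a lam phi R (Voronoi.weight φ₀ (G.L δ X)) x‖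
          ≤ C * (x ^ (1 - G.theta) * (G.L δ X)⁻¹) := by
  refine ⟨G.e0_ne_zero hd, ?_⟩
  by_cases hex : ∃ R : ℝ, 0 < R ∧ G.SingularitiesInDisk phi R
  swap
  -- without an admissible radius there is nothing to prove
  · exact ⟨1, one_pos, 1, one_pos, fun R hR hsing => absurd ⟨R, hR, hsing⟩ hex⟩
  obtain ⟨R₀, hR₀, hsing₀⟩ := hex
  obtain ⟨c, hc, hcσ, hcR⟩ := ((G.eventually_isFar hd).and
    ((Filter.eventually_gt_atTop σs).and (Filter.eventually_gt_atTop (R₀ + 1)))).exists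
  have hA := G.A_pos hd
  obtain ⟨C, hC, hbound⟩ := G.exists_dual_integral_sub_mainTerm_le hd hmu hcb hcσ.le hc
    hφ₀.isTest (inv_pos.mpr hδ) hω
  -- the second entry of the maximum makes `L ≥ 2`, so that the weight lives on `[1/2, 3/2]`
  refine ⟨2 * C + 1, by positivity, max 1 ((2 * δ) ^ (2 * G.A)), by positivity, ?_⟩
  intro R hR hsing X hX x hx
  have hX1 : 1 ≤ X := (le_max_left _ _).trans hX
  have hx1 : 1 ≤ x := hX1.trans hx.1
  have hx0 : 0 < x := by linarith
  have hL : 2 ≤ G.L δ X := by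
    have h1 : 2 * δ ≤ X ^ (1 / (2 * G.A)) := by
      have := Real.rpow_le_rpow (z := 1 / (2 * G.A)) (by positivity)
        ((le_max_right _ _).trans hX) (by positivity)
      rwa [← Real.rpow_mul (by positivity), mul_one_div_cancel (by positivity),
        Real.rpow_one] at this
    rw [Voronoi.GammaParams.L, inv_mul_eq_div, le_div_iff₀ hδ]
    exact h1
  have hLx : G.L δ X ≤ δ⁻¹ * x ^ (1 / (2 * G.A)) := by
    have := hx.1
    rw [Voronoi.GammaParams.L]
    gcongr
  obtain ⟨h1, h2, h3⟩ := hbound (G.L δ X) x hL hx1 hLx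
  rw [← G.localMean_eq_integral hd hlam hmu hca hcb hphi hpsi hfe hdecay hφ₀.isTest hR₀
    hsing₀ hcσ hcR hc hR hsing hL hx0] at h2
  have hL0 : 0 < (G.L δ X)⁻¹ := by positivity
  have hp : 0 < x ^ (1 - G.theta - 1 / (2 * G.A)) := by positivity
  have hp' : x ^ (1 - G.theta - 1 / (2 * G.A)) ≤ x ^ (1 - G.theta) :=
    Real.rpow_le_rpow_of_exponent_le hx1 (sub_le_self _ (by positivity))
  refine ⟨h1, h2.trans ?_, ?_⟩
  · exact mul_le_mul_of_nonneg_right (by linarith) (by positivity)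
  · have h4 := norm_add_le (Voronoi.localMean a lam phi R (Voronoi.weight φ₀ (G.L δ X)) x -
      G.mainTerm ω b mu (Voronoi.weight φ₀ (G.L δ X)) x)
      (G.mainTerm ω b mu (Voronoi.weight φ₀ (G.L δ X)) x)
    rw [sub_add_cancel] at h4
    have h5 : C * ((G.L δ X)⁻¹ * x ^ (1 - G.theta - 1 / (2 * G.A))) ≤
        C * ((G.L δ X)⁻¹ * x ^ (1 - G.theta)) := by gcongr
    have h6 : 0 < x ^ (1 - G.theta) * (G.L δ X)⁻¹ := by positivity
    nlinarith
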